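/- Consider embedded surfaces of class $C^{1,1}$ in $\mathbb{R}^3$, with area $A(\Sigma)$ (two-dimensional Hausdorff measure) and scalar mean curvature $H=\frac12(\kappa_1+\kappa_2)$, which is defined almost everywhere and taken with respect to the outer unit normal, so that $H=1/R>0$ on a sphere of radius $R$. Let $\mathcal{A}_{1,1}$ be the class of axisymmetric $C^{1,1}$-surfaces, that is, of the surfaces $\{(x(s)\cos t,\,x(s)\sin t,\,z(s)) : s\in[0,L],\ t\in[0,2\pi[\}$ with $x(s)=\int_0^s\cos\theta$, $z(s)=\int_0^s\sin\theta$, where $L>0$ and $\theta:[0,L]\to\mathbb{R}$ is Lipschitz continuous with $\theta(0)=0$, $\theta(L)=\pi$, $x(L)=0$, $z(L)>0$, $x>0$ on $]0,L[$, and $s\mapsto(x(s),z(s))$ is one-to-one on $]0,L[$. Let $A_0>0$. There exist a sequence $(\Sigma_n)_{n\in\mathbb{N}}$ of $C^{1,1}$-surfaces homeomorphic to the sphere, none of them invariant under all rotations about some line, and a sequence $(\widetilde\Sigma_n)_{n\in\mathbb{N}}\subset\mathcal{A}_{1,1}$ such that $H$ is integrable on each of these surfaces, $A(\Sigma_n)=A(\widetilde\Sigma_n)=A_0$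 for every $n\in\mathbb{N}$, and $$\lim_{n\to+\infty}\int_{\Sigma_n}H\,dA=-\infty,\qquad \lim_{n\to+\infty}\int_{\widetilde\Sigma_n}H\,dA=0^+ .$$ Moreover, the surfaces $\widetilde\Sigma_n$ can be chosen to approach a double sphere: there is a sphere $S$ of radius $\sqrt{A_0/(8\pi)}$ such that $\widetilde\Sigma_n\to S$ in Hausdorff distance and $\int_{\widetilde\Sigma_n}f\,dA\to 2\int_S f\,dA$ for every continuous $f:\mathbb{R}^3\to\mathbb{R}$. -/

import Mathlib

open Set Filter Topology MeasureTheory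
open scoped NNReal ENNReal RealInnerProductSpace

noncomputable section

namespace TotalMeanCurvature

/-- The Euclidean plane, in which local parametrizations are defined. -/
abbrev E2 : Type := EuclideanSpace ℝ (Fin 2)

/-- Euclidean three-space. -/
abbrev E3 : Type := EuclideanSpace ℝ (Fin 3)

/-- `S` is an embedded surface of class `C^{1,1}` without boundary: around each of its points there
is a local parametrization of class `C^1` with locally Lipschitz derivative, which is an immersion
and a homeomorphism onto a relatively open subset of `S`. -/
def IsC11Surface (S : Set E3) : Prop :=
  ∀ p ∈ S, ∃ (U : Set E2) (V : Set E3) (X : E2 → E3),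
    IsOpen U ∧ IsOpen V ∧ p ∈ V ∧
    ContDiffOn ℝ 1 X U ∧ LocallyLipschitzOn U (fderiv ℝ X) ∧
    (∀ q ∈ U, Function.Injective (fderiv ℝ X q)) ∧
    IsEmbedding (U.domRestrict X) ∧ X '' U = V ∩ S

/-- Sphere-like `C^{1,1}`-surfaces: embedded `C^{1,1}`-surfaces homeomorphic to the sphere. -/
def IsSphereLikeC11Surface (S : Set E3) : Prop :=
  IsC11Surface S ∧ Nonempty (S ≃ₜ Metric.sphere (0 : E3) 1)

/-- The inner domain of a closed surface: the union of the bounded components of its complement. -/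
def innerDomain (S : Set E3) : Set E3 :=
  {x | x ∉ S ∧ Bornology.IsBounded (connectedComponentIn Sᶜ x)}

/-- The outer domain of a closed surface: the union of the unbounded components of its
complement. -/
def outerDomain (S : Set E3) : Set E3 :=
  {x | x ∉ S ∧ ¬ Bornology.IsBounded (connectedComponentIn Sᶜ x)}

/-- `ν` is a unit vector, normal to `S` at `p`, and it points from the inner to the outer domain. -/
def IsOuterUnitNormal (S : Set E3) (p ν : E3) : Prop :=
  ‖ν‖ = 1 ∧ (∀ v ∈ tangentConeAt ℝ S p, ⟪ν, v⟫ = 0) ∧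
    ∀ᶠ t : ℝ in 𝓝[>] 0, p + t • ν ∈ outerDomain S ∧ p - t • ν ∈ innerDomain S

open Classical in
/-- The Gauss map: the outer unit normal field. -/
def outerNormal (S : Set E3) (p : E3) : E3 :=
  if h : ∃ ν, IsOuterUnitNormal S p ν then h.choose else 0

/-- The scalar mean curvature `H = (κ₁ + κ₂) / 2`, which is half of the trace over the tangent plane
of the differential of the Gauss map along `S`.  The trace of an endomorphism `A` over the plane
orthogonal to the unit vector `ν` is `tr A - ⟪ν, A ν⟫`.  For a `C^{1,1}`-surface the Gauss map is
Lipschitz, hence it is differentiable along `S` at almost every point. -/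
def meanCurvature (S : Set E3) (p : E3) : ℝ :=
  (LinearMap.trace ℝ E3 (fderivWithin ℝ (outerNormal S) S p : E3 →ₗ[ℝ] E3)
    - ⟪outerNormal S p, fderivWithin ℝ (outerNormal S) S p (outerNormal S p)⟫) / 2

/-- The area: the two-dimensional Hausdorff measure, normalized to be Lebesgue measure on planes. -/
def area (S : Set E3) : ℝ≥0∞ := μHE[2] S

/-- The total mean curvature `∫_S H dA`. -/
def totalMeanCurvature (S : Set E3) : ℝ := ∫ p in S, meanCurvature S p ∂μHE[2]

/-- Abscissa (distance to the axis) of the unit speed curve with tangent angle `θ`. -/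
def profileX (θ : ℝ → ℝ) (s : ℝ) : ℝ := ∫ t in (0 : ℝ)..s, Real.cos (θ t)

/-- Ordinate (height along the axis) of the unit speed curve with tangent angle `θ`. -/
def profileZ (θ : ℝ → ℝ) (s : ℝ) : ℝ := ∫ t in (0 : ℝ)..s, Real.sin (θ t)

/-- Admissible generating maps `θ : [0, L] → ℝ`. -/
structure IsAdmissible (L : ℝ) (θ : ℝ → ℝ) : Prop where
  length_pos : 0 < L
  lipschitz : ∃ K : ℝ≥0, LipschitzOnWith K θ (Icc 0 L)
  angle_zero : θ 0 = 0
  angle_length : θ L = Real.pi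
  profileX_length : profileX θ L = 0
  profileZ_length : 0 < profileZ θ L
  injOn : InjOn (fun s => (profileX θ s, profileZ θ s)) (Ioo 0 L)
  profileX_pos : ∀ s ∈ Ioo 0 L, 0 < profileX θ s

/-- The surface spanned by rotating the curve with tangent angle `θ` about the `z`-axis. -/
def revolutionSurface (L : ℝ) (θ : ℝ → ℝ) : Set E3 :=
  {p | ∃ s ∈ Icc 0 L, ∃ t ∈ Ico 0 (2 * Real.pi),
    p = !₂[profileX θ s * Real.cos t, profileX θ s * Real.sin t, profileZ θ s]}

/-- The class of axisymmetric `C^{1,1}`-surfaces. -/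
def AxisymmetricC11 : Set (Set E3) :=
  {S | ∃ (L : ℝ) (θ : ℝ → ℝ), IsAdmissible L θ ∧ S = revolutionSurface L θ}

/-- `S` is invariant under all rotations about some line, namely the line through `c` with unit
direction `u`.  Two points lie on the same circle about this line if and only if they have the same
height along `u` and the same distance to `c`. -/
def IsRotationallySymmetric (S : Set E3) : Prop :=
  ∃ c u : E3, ‖u‖ = 1 ∧ ∀ x y : E3, ⟪x - c, u⟫ = ⟪y - c, u⟫ → ‖x - c‖ = ‖y - c‖ →
    (x ∈ S ↔ y ∈ S)

/-- The surfaces `T n` approach the surface `S` covered twice: they converge to `S` in Hausdorff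
distance, and their area measures converge weakly to twice the area measure of `S`. -/
def ApproachesDouble (T : ℕ → Set E3) (S : Set E3) : Prop :=
  Tendsto (fun n => Metric.hausdorffDist (T n) S) atTop (𝓝 0) ∧
  ∀ f : E3 → ℝ, Continuous f →
    Tendsto (fun n => ∫ p in T n, f p ∂μHE[2]) atTop (𝓝 (2 * ∫ p in S, f p ∂μHE[2]))

end TotalMeanCurvature

end

/-!
Both halves of the theorem rest on explicit surfaces whose area and total mean curvature can be
computed on finitely many surfaces of revolution.

*Total mean curvature unbounded below.*  Push `N` narrow spikes into a round sphere, along `N`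
directions of the equatorial plane.  In terms of the slope angle `Θ` of its profile
`φ ↦ (x φ, z φ)`, a rotated graph over a disc satisfies `2 H dA = -(x Θ' + z') dφ dt`.
An integration by parts and `|Θ| ≤ π / 2` bound its total mean curvature by `-π` times the height
difference between rim and center, up to `π²` times the radius of the disc
(`integral_meanCurvature_graphPatch_le`).  So a spike of fixed depth contributes a fixed
negative amount, however narrow it is, while its area tends to zero with its width.  With spikes of
width `1 / (8 N)` the area remains bounded as `N → ∞`, so that the scaling to area `A₀` is
harmless, and the total mean curvature tends to `-∞` (`totalMeanCurvature_spikySphere_le`).  The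
surface is a `C²` radial graph, hence a `C^{1,1}` sphere (`IsRadial.isSphereLikeC11Surface`).  It
has no axis of symmetry: such an axis would contain the origin, because the two poles lie on the
circumscribed sphere, and the tips of the spikes, which are the points closest to the origin, lie
in an open half of the equatorial plane but not on a line through the origin
(`not_isRotationallySymmetric_spikySphere`).

*Total mean curvature tending to `0` from above.*  Take the boundary of the `ρ`-neighborhood of a
spherical cap of opening angle `α < π`.  It consists of two concentric spherical caps, on which the
normals point away from each other, and a neck, which is a rotated half circle.  Its generating
curve has a piecewise linear tangent angle (`IsShell.mem_axisymmetricC11`), and its total mean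
curvature is `4 π ρ + π² (R - ρ) sin α > 0` (`IsShell.totalMeanCurvature_shellSurface`).  For
`ρ → 0` and `α → π` this tends to `0` and the surface tends to a sphere covered twice
(`approachesDouble_shellSurface`).

The mean curvature is defined through the connected components of the complement and the
differential of the Gauss map along the surface.  For the zero set of a `C²` function that is
negative inside, positive outside, and regular, the Gauss map is the normalized gradient
(`IsDefiningFunctionAt.outerNormal_eq`), and on a surface of revolution the mean curvature is read
off from the meridian and the parallel (`meanCurvature_cylPoint`).  Hausdorff measure is computed
through the area formula for `C¹` immersions
(`lintegral_normDet_fderiv_eq_euclideanHausdorffMeasure_image`).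
-/

namespace TotalMeanCurvature

open Module

/-! ### The area formula -/

section AreaFormula

theorem euclideanHausdorffMeasure_image_le_of_norm_sub_le {T V : Type*} [NormedAddCommGroup V]
    [MeasurableSpace V] [BorelSpace V] {f g : T → V} {t : Set T}
    {k : ℝ≥0} (h : ∀ x ∈ t, ∀ y ∈ t, ‖f x - f y‖ ≤ k * ‖g x - g y‖) (d : ℕ) :
    μHE[d] (f '' t) ≤ (k : ℝ≥0∞) ^ d * μHE[d] (g '' t) := by
  classical
  rcases isEmpty_or_nonempty T with hT | hT
  · simp [Set.eq_empty_of_isEmpty t]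
  have hsec : ∀ y ∈ g '' t, Function.invFunOn g t y ∈ t ∧ g (Function.invFunOn g t y) = y :=
    fun y hy => ⟨Function.invFunOn_mem hy, Function.invFunOn_eq hy⟩
  have hlip : LipschitzOnWith k (f ∘ Function.invFunOn g t) (g '' t) := by
    refine LipschitzOnWith.of_dist_le_mul fun x hx y hy => ?_
    have := h _ (hsec x hx).1 _ (hsec y hy).1
    rw [(hsec x hx).2, (hsec y hy).2] at this
    simpa [dist_eq_norm] using this
  have himg : f '' t ⊆ (f ∘ Function.invFunOn g t) '' (g '' t) := by
    rintro _ ⟨x, hx, rfl⟩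
    refine ⟨g x, mem_image_of_mem _ hx, ?_⟩
    have h1 := hsec (g x) (mem_image_of_mem _ hx)
    have := h _ h1.1 _ hx
    rw [h1.2, sub_self, norm_zero, mul_zero] at this
    exact sub_eq_zero.1 (norm_le_zero_iff.1 this)
  have h2 := hlip.hausdorffMeasure_image_le (d := d) (by positivity)
  simp only [Measure.euclideanHausdorffMeasure_def, Measure.smul_apply,
    Measure.nnreal_smul_coe_apply]
  rw [ENNReal.rpow_natCast] at h2
  rw [mul_left_comm]
  gcongr
  exact (measure_mono himg).trans h2

variable {U V : Type*} [NormedAddCommGroup U] [InnerProductSpace ℝ U] [FiniteDimensional ℝ U]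
  [NormedAddCommGroup V] [InnerProductSpace ℝ V]

theorem measurable_normDet_fderiv [MeasurableSpace U] [BorelSpace U] {f : U → V}
    (hf : ContDiff ℝ 1 f) :
    Measurable fun x => (fderiv ℝ f x : U →ₗ[ℝ] V).normDet := by
  classical
  have h : (fun x => (fderiv ℝ f x : U →ₗ[ℝ] V).normDet) = fun x =>
      √((Matrix.gram ℝ fun i => fderiv ℝ f x (stdOrthonormalBasis ℝ U i)).det) := by
    ext x
    have := LinearMap.normDet_sq_eq_det_gram (fderiv ℝ f x : U →ₗ[ℝ] V) (stdOrthonormalBasis ℝ U)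
    simp only [ContinuousLinearMap.coe_coe, RCLike.ofReal_real_eq_id, id] at this
    rw [← this, Real.sqrt_sq (LinearMap.normDet_nonneg _)]
  rw [h]
  refine Continuous.measurable ?_
  refine Real.continuous_sqrt.comp (Continuous.matrix_det ?_)
  refine continuous_matrix fun i j => ?_
  simp only [Matrix.gram_apply]
  have := hf.continuous_fderiv (by simp)
  fun_prop

/-- Near a point where a `C¹` map is an immersion, the map and all its nearby differentials are
bi-Lipschitz comparable, with constants close to one, to the differential at that point. -/
theorem eventually_norm_comparable {f : U → V} (hf : ContDiff ℝ 1 f) {x : U}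
    (hx : Function.Injective (fderiv ℝ f x)) {k : ℝ≥0} (hk : 1 < k) :
    ∃ u : Set U, IsOpen u ∧ x ∈ u ∧
      (∀ y ∈ u, ∀ z ∈ u, ‖f y - f z‖ ≤ k * ‖fderiv ℝ f x y - fderiv ℝ f x z‖ ∧
        ‖fderiv ℝ f x y - fderiv ℝ f x z‖ ≤ k * ‖f y - f z‖) ∧
      ∀ y ∈ u, ∀ v, ‖fderiv ℝ f y v‖ ≤ k * ‖fderiv ℝ f x v‖ ∧
        ‖fderiv ℝ f x v‖ ≤ k * ‖fderiv ℝ f y v‖ := by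
  set A := fderiv ℝ f x with hA
  obtain ⟨K, hK0, hK⟩ := (LinearMap.exists_antilipschitzWith (A : U →ₗ[ℝ] V)
    (LinearMap.ker_eq_bot.2 hx))
  have hKn : ∀ v, ‖v‖ ≤ K * ‖A v‖ := fun v => by
    simpa using hK.le_mul_dist v 0
  -- the error `c ‖v‖ ≤ (1 - 1/k) ‖A v‖` is admissible for both inequalities
  have hk0 : (0 : ℝ) < k := lt_trans one_pos hk
  have hk1 : (1 : ℝ) < k := hk
  set e : ℝ := 1 - 1 / k with he
  have he0 : 0 < e := by
    rw [he, sub_pos, div_lt_one hk0]; exact hk1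
  have hek : 1 + e ≤ k := by
    have : (k : ℝ) + 1 / k ≥ 2 := by
      have : (k : ℝ) + 1 / k - 2 = (k - 1) ^ 2 / k := by field_simp; ring
      have h2 : ((k : ℝ) - 1) ^ 2 / k ≥ 0 := by positivity
      linarith
    linarith
  have key : ∀ a b : V, ‖a - b‖ ≤ e * ‖b‖ → ‖a‖ ≤ k * ‖b‖ ∧ ‖b‖ ≤ k * ‖a‖ := by
    intro a b hab
    have h1 : ‖a‖ ≤ ‖a - b‖ + ‖b‖ := by simpa using norm_add_le (a - b) b
    have h2 : ‖b‖ ≤ ‖a - b‖ + ‖a‖ := by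
      have := norm_add_le (b - a) a
      rwa [sub_add_cancel, norm_sub_rev] at this
    refine ⟨by nlinarith [norm_nonneg b], ?_⟩
    have h3 : 1 / (k : ℝ) * ‖b‖ ≤ ‖a‖ := by
      have : 1 / (k : ℝ) * ‖b‖ = ‖b‖ - e * ‖b‖ := by rw [he]; ring
      linarith
    calc ‖b‖ = k * (1 / (k : ℝ) * ‖b‖) := by field_simp
      _ ≤ k * ‖a‖ := by gcongr
  set c : ℝ≥0 := e.toNNReal / K with hc
  have hc0 : 0 < c := div_pos (Real.toNNReal_pos.2 he0) hK0
  have hcK : (c : ℝ) * K = e := by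
    have : (K : ℝ) ≠ 0 := by exact_mod_cast hK0.ne'
    rw [hc, NNReal.coe_div, Real.coe_toNNReal _ he0.le]; field_simp
  have hbd : ∀ v, (c : ℝ) * ‖v‖ ≤ e * ‖A v‖ := fun v => by
    rw [← hcK, mul_assoc]; gcongr; exact hKn v
  have hs : HasStrictFDerivAt f A x := hf.contDiffAt.hasStrictFDerivAt (by simp)
  obtain ⟨u₁, hu₁, happ⟩ := hs.approximates_deriv_on_nhds (c := c) (Or.inr hc0)
  have hcont : ContinuousAt (fderiv ℝ f) x := (hf.continuous_fderiv (by simp)).continuousAt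
  have hu₂ : {y | ‖fderiv ℝ f y - A‖ < c} ∈ 𝓝 x := by
    have := hcont (Metric.ball_mem_nhds (fderiv ℝ f x) (ε := c) hc0)
    simpa [Metric.ball, dist_eq_norm] using this
  obtain ⟨u, hu, huo, hxu⟩ := mem_nhds_iff.1 (inter_mem hu₁ hu₂)
  refine ⟨u, huo, hxu, fun y hy z hz => ?_, fun y hy v => ?_⟩
  · apply key
    rw [← map_sub]
    refine le_trans ?_ (hbd _)
    simpa [map_sub] using happ y (hu hy).1 z (hu hz).1
  · apply key
    refine le_trans ?_ (hbd _)
    rw [← sub_apply]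
    exact (ContinuousLinearMap.le_opNorm _ _).trans (by gcongr; exact (hu hy).2.le)

variable [MeasurableSpace U] [BorelSpace U] [MeasurableSpace V] [BorelSpace V]

theorem normDet_le_of_norm_le {A B : U →ₗ[ℝ] V} {k : ℝ≥0} (h : ∀ v, ‖A v‖ ≤ k * ‖B v‖) :
    ENNReal.ofReal A.normDet ≤ (k : ℝ≥0∞) ^ finrank ℝ U * ENNReal.ofReal B.normDet := by
  have h1 := euclideanHausdorffMeasure_image_le_of_norm_sub_le (f := A) (g := B)
    (t := Metric.ball (0 : U) 1) (k := k)
    (fun x _ y _ => by rw [← map_sub, ← map_sub]; exact h _) (finrank ℝ U)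
  rw [LinearMap.euclideanHausdorffMeasure_image_eq_normDet_mul_volume,
    LinearMap.euclideanHausdorffMeasure_image_eq_normDet_mul_volume, ← mul_assoc] at h1
  exact (ENNReal.mul_le_mul_iff_left (Metric.measure_ball_pos _ _ one_pos).ne'
    measure_ball_lt_top.ne).1 h1

/-- The area formula for an injective `C¹` immersion. -/
theorem lintegral_normDet_fderiv_eq_euclideanHausdorffMeasure_image {f : U → V}
    (hf : ContDiff ℝ 1 f) {s : Set U} (hs : MeasurableSet s) (hinj : InjOn f s)
    (himm : ∀ x ∈ s, Function.Injective (fderiv ℝ f x)) :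
    μHE[finrank ℝ U] (f '' s) =
      ∫⁻ x in s, ENNReal.ofReal (fderiv ℝ f x : U →ₗ[ℝ] V).normDet := by
  set d := finrank ℝ U with hd
  set J : U → ℝ≥0∞ := fun x => ENNReal.ofReal (fderiv ℝ f x : U →ₗ[ℝ] V).normDet with hJ
  rcases s.eq_empty_or_nonempty with rfl | hne
  · simp
  have main : ∀ k : ℝ≥0, 1 < k →
      μHE[d] (f '' s) ≤ ((k : ℝ≥0∞) ^ d * (k : ℝ≥0∞) ^ d) * ∫⁻ x in s, J x ∧
      ∫⁻ x in s, J x ≤ ((k : ℝ≥0∞) ^ d * (k : ℝ≥0∞) ^ d) * μHE[d] (f '' s) := by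
    intro k hk
    choose! u huo hxu h1 h2 using fun x (hx : x ∈ s) => eventually_norm_comparable hf (himm x hx) hk
    obtain ⟨t, hts, htc, hst⟩ := TopologicalSpace.countable_cover_nhdsWithin
      (f := u) (s := s) fun x hx => mem_nhdsWithin_of_mem_nhds ((huo x hx).mem_nhds (hxu x hx))
    have htne : t.Nonempty := by
      obtain ⟨y, hy⟩ := hne
      obtain ⟨x, hx, -⟩ := mem_iUnion₂.1 (hst hy)
      exact ⟨x, hx⟩
    obtain ⟨e, rfl⟩ := htc.exists_eq_range htne
    have hes : ∀ n, e n ∈ s := fun n => hts (mem_range_self n)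
    set D : ℕ → Set U := fun n => s ∩ disjointed (fun n => u (e n)) n with hD
    have hDm : ∀ n, MeasurableSet (D n) := fun n =>
      hs.inter (MeasurableSet.disjointed (fun n => (huo _ (hes n)).measurableSet) n)
    have hDu : ∀ n, D n ⊆ u (e n) := fun n => inter_subset_right.trans (disjointed_subset _ n)
    have hDd : Pairwise (Function.onFun Disjoint D) := fun i j hij =>
      ((disjoint_disjointed (fun n => u (e n))) hij).mono inter_subset_right inter_subset_right
    have hDs : s = ⋃ n, D n := by
      rw [hD, ← inter_iUnion, iUnion_disjointed, eq_comm, inter_eq_left]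
      intro y hy
      obtain ⟨x, ⟨n, rfl⟩, hx⟩ := mem_iUnion₂.1 (hst hy)
      exact mem_iUnion.2 ⟨n, hx⟩
    have hsum1 : μHE[d] (f '' s) = ∑' n, μHE[d] (f '' D n) := by
      conv_lhs => rw [hDs, image_iUnion]
      refine measure_iUnion (fun i j hij => ?_) fun n => ?_
      · exact (hDd hij).image hinj inter_subset_left inter_subset_left
      · exact (hDm n).image_of_continuousOn_injOn hf.continuous.continuousOn
          (hinj.mono inter_subset_left)
    have hsum2 : ∫⁻ x in s, J x = ∑' n, ∫⁻ x in D n, J x := by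
      conv_lhs => rw [hDs]
      exact lintegral_iUnion hDm hDd _
    have hlin : ∀ n, μHE[d] (fderiv ℝ f (e n) '' D n) = J (e n) * volume (D n) := fun n =>
      LinearMap.euclideanHausdorffMeasure_image_eq_normDet_mul_volume
        (fderiv ℝ f (e n) : U →ₗ[ℝ] V) (D n)
    rw [hsum1, hsum2, ← ENNReal.tsum_mul_left, ← ENNReal.tsum_mul_left]
    refine ⟨ENNReal.tsum_le_tsum fun n => ?_, ENNReal.tsum_le_tsum fun n => ?_⟩
    · calc μHE[d] (f '' D n) ≤ (k : ℝ≥0∞) ^ d * μHE[d] (fderiv ℝ f (e n) '' D n) :=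
          euclideanHausdorffMeasure_image_le_of_norm_sub_le
            (fun x hx y hy => (h1 _ (hes n) x (hDu n hx) y (hDu n hy)).1) d
        _ = (k : ℝ≥0∞) ^ d * ∫⁻ x in D n, J (e n) := by rw [hlin, setLIntegral_const]
        _ ≤ (k : ℝ≥0∞) ^ d * ∫⁻ x in D n, (k : ℝ≥0∞) ^ d * J x := by
          refine mul_le_mul_right ?_ _
          refine setLIntegral_mono' (hDm n) fun x hx => ?_
          exact normDet_le_of_norm_le fun v => (h2 _ (hes n) x (hDu n hx) v).2
        _ = _ := by
          rw [lintegral_const_mul' _ _ (by finiteness), mul_assoc]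
    · calc ∫⁻ x in D n, J x ≤ ∫⁻ x in D n, (k : ℝ≥0∞) ^ d * J (e n) := by
            refine setLIntegral_mono' (hDm n) fun x hx => ?_
            exact normDet_le_of_norm_le fun v => (h2 _ (hes n) x (hDu n hx) v).1
        _ = (k : ℝ≥0∞) ^ d * μHE[d] (fderiv ℝ f (e n) '' D n) := by
          rw [setLIntegral_const, hlin, mul_assoc]
        _ ≤ (k : ℝ≥0∞) ^ d * ((k : ℝ≥0∞) ^ d * μHE[d] (f '' D n)) := by
          gcongr
          exact euclideanHausdorffMeasure_image_le_of_norm_sub_le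
            (fun x hx y hy => (h1 _ (hes n) x (hDu n hx) y (hDu n hy)).2) d
        _ = _ := by rw [mul_assoc]
  have hlim : ∀ a : ℝ≥0∞, Tendsto (fun k : ℝ≥0 => ((k : ℝ≥0∞) ^ d * (k : ℝ≥0∞) ^ d) * a) (𝓝[>] 1)
      (𝓝 a) := by
    intro a
    have h1 : Tendsto (fun k : ℝ≥0 => (((k ^ d * k ^ d : ℝ≥0) : ℝ≥0∞))) (𝓝[>] 1) (𝓝 1) := by
      have : Continuous fun k : ℝ≥0 => (((k ^ d * k ^ d : ℝ≥0) : ℝ≥0∞)) := by fun_prop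
      have h2 := this.tendsto 1
      simp only [one_pow, mul_one, ENNReal.coe_one] at h2
      exact h2.mono_left nhdsWithin_le_nhds
    have h3 := ENNReal.Tendsto.mul_const (b := a) h1 (Or.inl one_ne_zero)
    simpa using h3
  have hmem : ∀ᶠ k : ℝ≥0 in 𝓝[>] 1, 1 < k := eventually_mem_nhdsWithin
  exact le_antisymm (ge_of_tendsto (hlim _) (hmem.mono fun k hk => (main k hk).1))
    (ge_of_tendsto (hlim _) (hmem.mono fun k hk => (main k hk).2))

theorem map_withDensity_normDet_fderiv {f : U → V}
    (hf : ContDiff ℝ 1 f) {s : Set U} (hs : MeasurableSet s) (hinj : InjOn f s)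
    (himm : ∀ x ∈ s, Function.Injective (fderiv ℝ f x)) :
    Measure.map f ((volume.restrict s).withDensity
      fun x => ENNReal.ofReal (fderiv ℝ f x : U →ₗ[ℝ] V).normDet) =
      (μHE[finrank ℝ U]).restrict (f '' s) := by
  refine Measure.ext fun t ht => ?_
  have hpre : MeasurableSet (f ⁻¹' t) := hf.continuous.measurable ht
  rw [Measure.map_apply hf.continuous.measurable ht, withDensity_apply _ hpre,
    Measure.restrict_apply ht, Measure.restrict_restrict hpre,
    ← lintegral_normDet_fderiv_eq_euclideanHausdorffMeasure_image hf (hpre.inter hs)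
      (hinj.mono inter_subset_right) (fun x hx => himm x hx.2), image_preimage_inter]

theorem restrict_map_withDensity_normDet_fderiv {f : U → V}
    (hf : ContDiff ℝ 1 f) {s : Set U} (hs : MeasurableSet s) (hinj : InjOn f s)
    (himm : ∀ x ∈ s, Function.Injective (fderiv ℝ f x)) :
    Measure.map (s.domRestrict f) (Measure.comap (↑) ((volume : Measure U).withDensity
      fun x => ENNReal.ofReal (fderiv ℝ f x : U →ₗ[ℝ] V).normDet)) =
      (μHE[finrank ℝ U]).restrict (f '' s) := by
  have : s.domRestrict f = f ∘ ((↑) : s → U) := rfl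
  rw [this, ← Measure.map_map hf.continuous.measurable measurable_subtype_coe,
    map_comap_subtype_coe hs, restrict_withDensity hs]
  exact map_withDensity_normDet_fderiv hf hs hinj himm

theorem integrableOn_image_iff_normDet_fderiv {f : U → V}
    (hf : ContDiff ℝ 1 f) {s : Set U} (hs : MeasurableSet s) (hinj : InjOn f s)
    (himm : ∀ x ∈ s, Function.Injective (fderiv ℝ f x)) (g : V → ℝ) :
    IntegrableOn g (f '' s) μHE[finrank ℝ U] ↔
      IntegrableOn (fun x => (fderiv ℝ f x : U →ₗ[ℝ] V).normDet * g (f x)) s := by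
  have hemb := hf.continuous.continuousOn.measurableEmbedding hs hinj
  rw [IntegrableOn, ← restrict_map_withDensity_normDet_fderiv hf hs hinj himm,
    hemb.integrable_map_iff]
  simp only [Set.domRestrict_eq, ← Function.comp_assoc, ENNReal.ofReal]
  rw [← (MeasurableEmbedding.subtype_coe hs).integrable_map_iff, map_comap_subtype_coe hs,
    restrict_withDensity hs, integrable_withDensity_iff_integrable_coe_smul₀]
  · simp_rw [IntegrableOn, Real.coe_toNNReal _ (LinearMap.normDet_nonneg _), Function.comp_apply,
      smul_eq_mul]
  · exact (measurable_normDet_fderiv hf).real_toNNReal.aemeasurable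

theorem integral_image_eq_normDet_fderiv {f : U → V}
    (hf : ContDiff ℝ 1 f) {s : Set U} (hs : MeasurableSet s) (hinj : InjOn f s)
    (himm : ∀ x ∈ s, Function.Injective (fderiv ℝ f x)) (g : V → ℝ) :
    ∫ y in f '' s, g y ∂μHE[finrank ℝ U] =
      ∫ x in s, (fderiv ℝ f x : U →ₗ[ℝ] V).normDet * g (f x) := by
  have hemb := hf.continuous.continuousOn.measurableEmbedding hs hinj
  rw [← restrict_map_withDensity_normDet_fderiv hf hs hinj himm, hemb.integral_map]
  simp only [Set.domRestrict_apply, ← Function.comp_apply (f := g), ENNReal.ofReal]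
  rw [← (MeasurableEmbedding.subtype_coe hs).integral_map, map_comap_subtype_coe hs,
    setIntegral_withDensity_eq_setIntegral_smul₀
      (measurable_normDet_fderiv hf).real_toNNReal.aemeasurable _ hs]
  congr with x
  rw [NNReal.smul_def, Real.coe_toNNReal _ (LinearMap.normDet_nonneg _), smul_eq_mul,
    Function.comp_apply]

end AreaFormula

/-! ### Inner and outer domains of a zero set -/

theorem eventually_pos_of_hasDerivAt {h : ℝ → ℝ} {c : ℝ} (hd : HasDerivAt h c 0) (h0 : h 0 = 0)
    (hc : 0 < c) : ∀ᶠ t in 𝓝[>] (0 : ℝ), 0 < h t := by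
  have h1 := hasDerivAt_iff_tendsto_slope_zero.1 hd
  have h2 : ∀ᶠ t in 𝓝[≠] (0 : ℝ), 0 < t⁻¹ • (h (0 + t) - h 0) := h1.eventually (lt_mem_nhds hc)
  have h3 : ∀ᶠ t in 𝓝[>] (0 : ℝ), 0 < t⁻¹ • (h (0 + t) - h 0) :=
    h2.filter_mono (nhdsWithin_mono _ fun x hx => ne_of_gt hx)
  filter_upwards [h3, self_mem_nhdsWithin] with t ht (ht0 : 0 < t)
  rw [zero_add, h0, sub_zero, smul_eq_mul] at ht
  exact pos_of_mul_pos_right ht (inv_pos.2 ht0).le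

/-- A path that leaves the region `F < 0` meets the zero set, so the component of a point of this
region stays in it. -/
theorem mem_innerDomain_of_neg {S : Set E3} {F : E3 → ℝ} (hF : Continuous F)
    (hS : ∀ x, x ∈ S ↔ F x = 0) (hb : Bornology.IsBounded {x | F x < 0}) {x : E3} (hx : F x < 0) :
    x ∈ innerDomain S := by
  have hxS : x ∉ S := fun h => hx.ne ((hS x).1 h)
  refine ⟨hxS, hb.subset fun y hy => ?_⟩
  by_contra hy0
  have hy0 : 0 ≤ F y := not_lt.1 hy0
  obtain ⟨z, hz, hz0⟩ := (isPreconnected_connectedComponentIn (x := x) (F := Sᶜ)).intermediate_value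
    (mem_connectedComponentIn hxS) hy hF.continuousOn ⟨hx.le, hy0⟩
  exact connectedComponentIn_subset _ _ hz ((hS z).2 hz0)

theorem mem_outerDomain_of_unbounded {S B : Set E3} (hB : IsPreconnected B) (hBS : B ⊆ Sᶜ)
    (hub : ¬ Bornology.IsBounded B) {x : E3} (hx : x ∈ B) : x ∈ outerDomain S :=
  ⟨hBS hx, fun h => hub (h.subset (hB.subset_connectedComponentIn hx hBS))⟩

theorem mem_outerDomain_of_isPreconnected {S B : Set E3} (hB : IsPreconnected B) (hBS : B ⊆ Sᶜ)
    {x y : E3} (hx : x ∈ B) (hy : y ∈ B) (hyo : y ∈ outerDomain S) : x ∈ outerDomain S := by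
  refine ⟨hBS hx, ?_⟩
  have : connectedComponentIn Sᶜ x = connectedComponentIn Sᶜ y :=
    (connectedComponentIn_eq (hB.subset_connectedComponentIn hx hBS hy))
  rw [this]
  exact hyo.2

/-- A half-line in the complement of `S` lies in the outer domain. -/
theorem mem_outerDomain_of_ray {S : Set E3} {x v : E3} (hv : v ≠ 0)
    (h : ∀ t : ℝ, 0 ≤ t → x + t • v ∉ S) : x ∈ outerDomain S := by
  refine mem_outerDomain_of_unbounded (B := (fun t : ℝ => x + t • v) '' Ici 0)
    (isPreconnected_Ici.image _ (by fun_prop)) ?_ ?_ ⟨0, by simp, by simp⟩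
  · rintro _ ⟨t, ht, rfl⟩
    exact h t ht
  · intro hb
    obtain ⟨R, hR⟩ := hb.exists_norm_le
    have hv' : 0 < ‖v‖ := norm_pos_iff.2 hv
    have h0 : 0 ≤ R := (norm_nonneg _).trans (hR x ⟨0, by simp, by simp⟩)
    have h1 := hR _ ⟨(R + ‖x‖ + 1) / ‖v‖, by simp only [mem_Ici]; positivity, rfl⟩
    have h2 : ‖((R + ‖x‖ + 1) / ‖v‖) • v‖ = R + ‖x‖ + 1 := by
      rw [norm_smul, Real.norm_of_nonneg (by positivity)]
      field_simp
    have h3 := norm_sub_le (x + ((R + ‖x‖ + 1) / ‖v‖) • v) x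
    rw [add_sub_cancel_left, h2] at h3
    linarith

/-- A segment in the complement of `S` with an endpoint in the outer domain lies in it. -/
theorem mem_outerDomain_of_segment {S : Set E3} {x v : E3}
    (h : ∀ t : ℝ, t ∈ Icc (0 : ℝ) 1 → x + t • v ∉ S) (hv : x + v ∈ outerDomain S) :
    x ∈ outerDomain S := by
  refine mem_outerDomain_of_isPreconnected (B := (fun t : ℝ => x + t • v) '' Icc 0 1)
    (isPreconnected_Icc.image _ (by fun_prop)) ?_ ⟨0, by simp, by simp⟩ ⟨1, by simp, by simp⟩ hv
  rintro _ ⟨t, ht, rfl⟩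
  exact h t ht

/-! ### The outer normal of a level set -/

/-- Near the point `p`, the function `G` is negative only in the inner domain of `S`, positive only
in the outer domain, and zero exactly on `S`; its gradient at `p` is `g ≠ 0`. -/
structure IsDefiningFunctionAt (S : Set E3) (G : E3 → ℝ) (p g : E3) : Prop where
  mem : p ∈ S
  hasFDerivAt : HasFDerivAt G (innerSL ℝ g) p
  ne_zero : g ≠ 0
  continuousAt : ∀ᶠ x in 𝓝 p, ContinuousAt G x
  outer : ∀ᶠ x in 𝓝 p, 0 < G x → x ∈ outerDomain S
  inner : ∀ᶠ x in 𝓝 p, G x < 0 → x ∈ innerDomain S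
  zero : ∀ᶠ x in 𝓝 p, G x = 0 ↔ x ∈ S

namespace IsDefiningFunctionAt

variable {S : Set E3} {G : E3 → ℝ} {p g : E3}

theorem apply_eq_zero (h : IsDefiningFunctionAt S G p g) : G p = 0 :=
  h.zero.self_of_nhds.2 h.mem

theorem hasDerivAt_line (h : IsDefiningFunctionAt S G p g) (u : E3) :
    HasDerivAt (fun t : ℝ => G (p + t • u)) ⟪g, u⟫ 0 := by
  have h1 : HasDerivAt (fun t : ℝ => p + t • u) u 0 := by
    simpa using ((hasDerivAt_id (0 : ℝ)).smul_const u).const_add p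
  have h2 := HasFDerivAt.comp_hasDerivAt_of_eq (x := (0 : ℝ)) h.hasFDerivAt h1 (by simp)
  simpa [Function.comp_def] using! h2

theorem inner_eq_zero_of_mem_tangentConeAt (h : IsDefiningFunctionAt S G p g) {v : E3}
    (hv : v ∈ tangentConeAt ℝ S p) : ⟪g, v⟫ = 0 := by
  have h1 : HasFDerivWithinAt G (innerSL ℝ g) S p := h.hasFDerivAt.hasFDerivWithinAt
  have h2 : HasFDerivWithinAt G (0 : E3 →L[ℝ] ℝ) S p := by
    refine (hasFDerivWithinAt_const (0 : ℝ) p S).congr_of_eventuallyEq ?_ h.apply_eq_zero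
    filter_upwards [nhdsWithin_le_nhds h.zero, self_mem_nhdsWithin] with x hx hxS
    exact hx.2 hxS
  simpa using h1.unique_on h2 hv

theorem mem_tangentConeAt (h : IsDefiningFunctionAt S G p g) {v : E3} (hv : ⟪g, v⟫ = 0) :
    v ∈ tangentConeAt ℝ S p := by
  have hg2 : 0 < ⟪g, g⟫ := real_inner_self_pos.2 h.ne_zero
  have key : ∀ ε : ℝ, 0 < ε → ∃ t ∈ Ioo (0 : ℝ) ε, ∃ w ∈ Icc (-ε) ε, p + t • (v + w • g) ∈ S := by
    intro ε hε
    have hp : ∀ᶠ t in 𝓝[>] (0 : ℝ), 0 < G (p + t • (v + ε • g)) := by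
      refine eventually_pos_of_hasDerivAt (h.hasDerivAt_line _) (by simpa using h.apply_eq_zero) ?_
      rw [inner_add_right, hv, inner_smul_right, zero_add]; positivity
    have hn : ∀ᶠ t in 𝓝[>] (0 : ℝ), 0 < -G (p + t • (v + (-ε) • g)) := by
      refine eventually_pos_of_hasDerivAt (h.hasDerivAt_line _).neg
        (by simpa using h.apply_eq_zero) ?_
      rw [inner_add_right, hv, inner_smul_right, zero_add]
      have : 0 < ε * ⟪g, g⟫ := by positivity
      linarith
    obtain ⟨r, hr, hball⟩ := Metric.eventually_nhds_iff_ball.1 (h.continuousAt.and h.zero)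
    have hsmall : ∀ᶠ t in 𝓝[>] (0 : ℝ), t * (‖v‖ + ε * ‖g‖) < r := by
      have : Tendsto (fun t : ℝ => t * (‖v‖ + ε * ‖g‖)) (𝓝 0) (𝓝 (0 * (‖v‖ + ε * ‖g‖))) :=
        (continuous_id.mul continuous_const).tendsto 0
      rw [zero_mul] at this
      exact nhdsWithin_le_nhds (this.eventually (gt_mem_nhds hr))
    have hlt : ∀ᶠ t in 𝓝[>] (0 : ℝ), t ∈ Ioo (0 : ℝ) ε := Ioo_mem_nhdsGT hε
    obtain ⟨t, ⟨hp, hn⟩, hs, ht⟩ := ((hp.and hn).and (hsmall.and hlt)).exists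
    have hmem : ∀ w ∈ Icc (-ε) ε, p + t • (v + w • g) ∈ Metric.ball p r := by
      intro w hw
      rw [mem_ball_iff_norm, add_sub_cancel_left, norm_smul, Real.norm_of_nonneg ht.1.le]
      refine lt_of_le_of_lt ?_ hs
      refine mul_le_mul_of_nonneg_left ?_ ht.1.le
      refine (norm_add_le _ _).trans ?_
      rw [norm_smul]
      gcongr
      exact abs_le.2 hw
    have hc : ContinuousOn (fun w : ℝ => G (p + t • (v + w • g))) (Icc (-ε) ε) := by
      intro w hw
      refine ContinuousAt.continuousWithinAt ?_
      exact ContinuousAt.comp (f := fun w : ℝ => p + t • (v + w • g)) (hball _ (hmem w hw)).1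
        (by fun_prop)
    obtain ⟨w, hw, hw0⟩ := intermediate_value_Icc (by linarith : -ε ≤ ε) hc
      ⟨by linarith, hp.le⟩
    exact ⟨t, ht, w, hw, (hball _ (hmem w hw)).2.1 hw0⟩
  choose t ht w hw hS using fun n : ℕ => key (1 / ((n : ℝ) + 1)) (by positivity)
  have hlim := tendsto_one_div_add_atTop_nhds_zero_nat (𝕜 := ℝ)
  have hw0 : Tendsto w atTop (𝓝 0) := by
    refine squeeze_zero_norm (fun n => ?_) hlim
    exact abs_le.2 (hw n)
  have ht0 : Tendsto t atTop (𝓝 0) :=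
    squeeze_zero (fun n => (ht n).1.le) (fun n => (ht n).2.le) hlim
  have hvw : Tendsto (fun n => v + w n • g) atTop (𝓝 v) := by
    simpa using (hw0.smul_const g).const_add v
  refine mem_tangentConeAt_of_seq atTop (fun n => (t n)⁻¹) (fun n => t n • (v + w n • g)) ?_
    (Eventually.of_forall hS) ?_
  · simpa using ht0.smul hvw
  · refine hvw.congr fun n => ?_
    rw [smul_smul, inv_mul_cancel₀ (ht n).1.ne', one_smul]

/-- The choice of the outer normal in `outerNormal` is determined by a defining function: it has to
be the normalized gradient. -/
theorem outerNormal_eq (h : IsDefiningFunctionAt S G p g) :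
    outerNormal S p = ‖g‖⁻¹ • g := by
  classical
  have hg0 : 0 < ‖g‖ := norm_pos_iff.2 h.ne_zero
  have hline : ∀ u : E3, Tendsto (fun t : ℝ => p + t • u) (𝓝[>] 0) (𝓝 p) := fun u => by
    have : Continuous fun t : ℝ => p + t • u := by fun_prop
    simpa using (this.tendsto 0).mono_left nhdsWithin_le_nhds
  have hex : IsOuterUnitNormal S p (‖g‖⁻¹ • g) := by
    refine ⟨by rw [norm_smul, norm_inv, norm_norm, inv_mul_cancel₀ hg0.ne'], fun v hv => ?_, ?_⟩
    · rw [real_inner_smul_left, h.inner_eq_zero_of_mem_tangentConeAt hv, mul_zero]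
    · have hd : 0 < ⟪g, ‖g‖⁻¹ • g⟫ := by
        rw [inner_smul_right]; exact mul_pos (inv_pos.2 hg0) (real_inner_self_pos.2 h.ne_zero)
      have h1 := eventually_pos_of_hasDerivAt (h.hasDerivAt_line (‖g‖⁻¹ • g))
        (by simpa using h.apply_eq_zero) hd
      have h2 := eventually_pos_of_hasDerivAt (h.hasDerivAt_line (-(‖g‖⁻¹ • g))).neg
        (by simpa using h.apply_eq_zero) (by simpa using hd)
      filter_upwards [h1, h2, (hline (‖g‖⁻¹ • g)).eventually h.outer,
        (hline (-(‖g‖⁻¹ • g))).eventually h.inner] with t a b c d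
      refine ⟨c a, ?_⟩
      rw [sub_eq_add_neg, ← smul_neg]
      exact d (neg_pos.1 b)
  have huniq : ∀ ν, IsOuterUnitNormal S p ν → ν = ‖g‖⁻¹ • g := by
    rintro ν ⟨hν1, hν2, hν3⟩
    set c : ℝ := ⟪g, ν⟫ / ‖g‖ ^ 2 with hc
    have hgc : c * ‖g‖ ^ 2 = ⟪g, ν⟫ := by rw [hc]; field_simp
    have hperp : ⟪g, ν - c • g⟫ = 0 := by
      rw [inner_sub_right, inner_smul_right, real_inner_self_eq_norm_sq, hgc, sub_self]
    have h1 : ⟪ν, ν - c • g⟫ = 0 := hν2 _ (h.mem_tangentConeAt hperp)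
    have h2 : ⟪ν - c • g, ν - c • g⟫ = 0 := by
      rw [inner_sub_left, h1, real_inner_smul_left, hperp]; ring
    have h3 : ν = c • g := sub_eq_zero.1 (inner_self_eq_zero.1 h2)
    have hcn : |c| * ‖g‖ = 1 := by rw [← hν1, h3, norm_smul]; rfl
    have hcpos : 0 < c := by
      by_contra hcn'
      have hc0 : c < 0 := lt_of_le_of_ne (not_lt.1 hcn') fun h0 => by simp [h0] at hcn
      have hd : 0 < -⟪g, ν⟫ := by
        rw [← hgc]; nlinarith [pow_pos hg0 2]
      have h4 := eventually_pos_of_hasDerivAt (h.hasDerivAt_line ν).neg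
        (by simpa using h.apply_eq_zero) hd
      obtain ⟨t, ⟨a, b⟩, d⟩ := ((h4.and ((hline ν).eventually h.inner)).and hν3).exists
      exact d.1.2 (b (neg_pos.1 a)).2
    rw [abs_of_pos hcpos] at hcn
    rw [h3, eq_inv_of_mul_eq_one_left hcn]
  have hE : ∃ ν, IsOuterUnitNormal S p ν := ⟨_, hex⟩
  rw [outerNormal, dif_pos hE]
  exact huniq _ hE.choose_spec

end IsDefiningFunctionAt

/-! ### Mean curvature -/

theorem orthonormal_vec3 {u v w : E3} (huu : ⟪u, u⟫ = 1) (hvv : ⟪v, v⟫ = 1) (hww : ⟪w, w⟫ = 1)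
    (huv : ⟪u, v⟫ = 0) (huw : ⟪u, w⟫ = 0) (hvw : ⟪v, w⟫ = 0) : Orthonormal ℝ ![u, v, w] := by
  have hvu := (real_inner_comm u v).trans huv
  have hwu := (real_inner_comm u w).trans huw
  have hwv := (real_inner_comm v w).trans hvw
  have norm_one : ∀ {x : E3}, ⟪x, x⟫ = 1 → ‖x‖ = 1 := fun h => by
    rw [norm_eq_sqrt_real_inner, h, Real.sqrt_one]
  rw [orthonormal_iff_ite]
  intro i j
  fin_cases i <;> fin_cases j <;>
    simp [norm_one huu, norm_one hvv, norm_one hww, huv, huw, hvw, hvu, hwu, hwv]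

theorem trace_eq_inner_add_of_orthonormal {u v w : E3} (h : Orthonormal ℝ ![u, v, w])
    (A : E3 →ₗ[ℝ] E3) : LinearMap.trace ℝ E3 A = ⟪u, A u⟫ + ⟪v, A v⟫ + ⟪w, A w⟫ := by
  have hspan : ⊤ ≤ Submodule.span ℝ (range ![u, v, w]) := by
    have := (basisOfOrthonormalOfCardEqFinrank h (by simp)).span_eq
    rw [coe_basisOfOrthonormalOfCardEqFinrank] at this
    exact this.ge
  have := LinearMap.trace_eq_sum_inner A (OrthonormalBasis.mk h hspan)
  simpa [Fin.sum_univ_three] using this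

/-- Along the tangent plane the differential of the Gauss map is unique, so that any differential
of it along `S` gives the mean curvature. -/
theorem IsDefiningFunctionAt.meanCurvature_eq {S : Set E3} {G : E3 → ℝ} {p g : E3}
    (h : IsDefiningFunctionAt S G p g) {A : E3 →L[ℝ] E3}
    (hA : HasFDerivWithinAt (outerNormal S) A S p) {u v : E3}
    (ho : Orthonormal ℝ ![u, v, outerNormal S p]) :
    meanCurvature S p = (⟪u, A u⟫ + ⟪v, A v⟫) / 2 := by
  have hd := hA.differentiableWithinAt.hasFDerivWithinAt
  have heq := hd.unique_on hA
  have hperp : ∀ x : E3, ⟪outerNormal S p, x⟫ = 0 → x ∈ tangentConeAt ℝ S p := fun x hx => by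
    refine h.mem_tangentConeAt ?_
    rw [h.outerNormal_eq, real_inner_smul_left] at hx
    exact (mul_eq_zero.1 hx).resolve_left (inv_ne_zero (norm_ne_zero_iff.2 h.ne_zero))
  have hu := heq (hperp u (by simpa using ho.2 (i := 2) (j := 0) (by decide)))
  have hv := heq (hperp v (by simpa using ho.2 (i := 2) (j := 1) (by decide)))
  rw [meanCurvature, trace_eq_inner_add_of_orthonormal ho]
  simp only [ContinuousLinearMap.coe_coe, hu, hv]
  ring

/-- The point with cylindrical coordinates `(x, t, z)` with respect to an orthonormal frame `e` at
`c`, whose axis has direction `e 2`. -/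
noncomputable def cylPoint (e : OrthonormalBasis (Fin 3) ℝ E3) (c : E3) (x z t : ℝ) : E3 :=
  c + ((x * Real.cos t) • e 0 + (x * Real.sin t) • e 1 + z • e 2)

theorem inner_frame (e : OrthonormalBasis (Fin 3) ℝ E3) (a b d a' b' d' : ℝ) :
    ⟪a • e 0 + b • e 1 + d • e 2, a' • e 0 + b' • e 1 + d' • e 2⟫ = a * a' + b * b' + d * d' := by
  have h := e.inner_eq_ite
  simp [inner_add_left, inner_add_right, inner_smul_left, inner_smul_right, h]
  ring

theorem hasDerivAt_cylPoint (e : OrthonormalBasis (Fin 3) ℝ E3) (c : E3) {x z t : ℝ → ℝ}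
    {x' z' t' s : ℝ} (hx : HasDerivAt x x' s) (hz : HasDerivAt z z' s) (ht : HasDerivAt t t' s) :
    HasDerivAt (fun s => cylPoint e c (x s) (z s) (t s))
      ((x' * Real.cos (t s) - x s * Real.sin (t s) * t') • e 0 +
        (x' * Real.sin (t s) + x s * Real.cos (t s) * t') • e 1 + z' • e 2) s := by
  have h1 := (hx.mul ht.cos).smul_const (e 0)
  have h2 := (hx.mul ht.sin).smul_const (e 1)
  have h3 := hz.smul_const (e 2)
  refine (((h1.add h2).add h3).const_add c).congr_deriv ?_
  congr 3 <;> ring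

/-- The mean curvature of a surface of revolution in terms of its profile `(x, z)` and of the
components `(P, Q)` of its outer normal.  The meridian and the parallel through the point have to
lie in the surface near the point. -/
theorem meanCurvature_cylPoint {S : Set E3} {e : OrthonormalBasis (Fin 3) ℝ E3} {c : E3}
    {x z P Q : ℝ → ℝ} {x' z' P' Q' s₀ t₀ : ℝ}
    (hx : HasDerivAt x x' s₀) (hz : HasDerivAt z z' s₀) (hP : HasDerivAt P P' s₀)
    (hQ : HasDerivAt Q Q' s₀) (hx0 : x s₀ ≠ 0) (hv : x' ^ 2 + z' ^ 2 ≠ 0)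
    (hunit : P s₀ ^ 2 + Q s₀ ^ 2 = 1) (hperp : P s₀ * x' + Q s₀ * z' = 0)
    (hmer : ∀ᶠ s in 𝓝 s₀, cylPoint e c (x s) (z s) t₀ ∈ S ∧
      outerNormal S (cylPoint e c (x s) (z s) t₀) = cylPoint e 0 (P s) (Q s) t₀)
    (hpar : ∀ᶠ t in 𝓝 t₀, cylPoint e c (x s₀) (z s₀) t ∈ S ∧
      outerNormal S (cylPoint e c (x s₀) (z s₀) t) = cylPoint e 0 (P s₀) (Q s₀) t)
    (hdiff : DifferentiableWithinAt ℝ (outerNormal S) S (cylPoint e c (x s₀) (z s₀) t₀)) :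
    meanCurvature S (cylPoint e c (x s₀) (z s₀) t₀) =
      ((x' * P' + z' * Q') / (x' ^ 2 + z' ^ 2) + P s₀ / x s₀) / 2 := by
  set p := cylPoint e c (x s₀) (z s₀) t₀ with hp
  set A := fderivWithin ℝ (outerNormal S) S p with hA
  have hAd : HasFDerivWithinAt (outerNormal S) A S p := hdiff.hasFDerivWithinAt
  set C := Real.cos t₀ with hC
  set D := Real.sin t₀ with hD
  have hCD : C ^ 2 + D ^ 2 = 1 := Real.cos_sq_add_sin_sq t₀
  -- the differential of the Gauss map on the two coordinate vectors
  have h1 : A ((x' * C) • e 0 + (x' * D) • e 1 + z' • e 2) =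
      (P' * C) • e 0 + (P' * D) • e 1 + Q' • e 2 := by
    have hγ := hasDerivAt_cylPoint e c hx hz (hasDerivAt_const s₀ t₀)
    have hn := hasDerivAt_cylPoint e 0 hP hQ (hasDerivAt_const s₀ t₀)
    simp only [mul_zero, sub_zero, add_zero] at hγ hn
    refine (hAd.comp_hasDerivAt s₀ hγ (hmer.mono fun s hs => hs.1)).unique ?_
    exact hn.congr_of_eventuallyEq (hmer.mono fun s hs => hs.2)
  have h2 : A ((-(x s₀) * D) • e 0 + (x s₀ * C) • e 1 + (0 : ℝ) • e 2) =
      (-(P s₀) * D) • e 0 + (P s₀ * C) • e 1 + (0 : ℝ) • e 2 := by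
    have hγ := hasDerivAt_cylPoint e c (hasDerivAt_const t₀ (x s₀)) (hasDerivAt_const t₀ (z s₀))
      (hasDerivAt_id t₀)
    have hn := hasDerivAt_cylPoint e 0 (hasDerivAt_const t₀ (P s₀)) (hasDerivAt_const t₀ (Q s₀))
      (hasDerivAt_id t₀)
    simp only [zero_mul, zero_sub, zero_add, mul_one, id, ← neg_mul] at hγ hn
    refine (hAd.comp_hasDerivAt t₀ hγ (hpar.mono fun s hs => hs.1)).unique ?_
    exact hn.congr_of_eventuallyEq (hpar.mono fun s hs => hs.2)
  have hν : outerNormal S p = (P s₀ * C) • e 0 + (P s₀ * D) • e 1 + Q s₀ • e 2 := by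
    rw [hpar.self_of_nhds.2, cylPoint, zero_add]
  set v := √(x' ^ 2 + z' ^ 2) with hvdef
  have hvpos : 0 < x' ^ 2 + z' ^ 2 := lt_of_le_of_ne (by positivity) hv.symm
  have hv2 : v ^ 2 = x' ^ 2 + z' ^ 2 := Real.sq_sqrt hvpos.le
  have hv0 : v ≠ 0 := (Real.sqrt_pos.2 hvpos).ne'
  set u₁ := v⁻¹ • ((x' * C) • e 0 + (x' * D) • e 1 + z' • e 2) with hu₁
  set u₂ := (x s₀)⁻¹ • ((-(x s₀) * D) • e 0 + (x s₀ * C) • e 1 + (0 : ℝ) • e 2) with hu₂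
  have ho : Orthonormal ℝ ![u₁, u₂, outerNormal S p] := by
    have e11 : ⟪u₁, u₁⟫ = 1 := by
      rw [hu₁, real_inner_smul_left, inner_smul_right, inner_frame]
      have : x' * C * (x' * C) + x' * D * (x' * D) + z' * z' = v ^ 2 := by
        rw [hv2]; linear_combination x' ^ 2 * hCD
      rw [this]; field_simp
    have e22 : ⟪u₂, u₂⟫ = 1 := by
      rw [hu₂, real_inner_smul_left, inner_smul_right, inner_frame]
      field_simp
      linear_combination x s₀ ^ 2 * hCD
    have e33 : ⟪outerNormal S p, outerNormal S p⟫ = 1 := by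
      rw [hν, inner_frame]
      linear_combination P s₀ ^ 2 * hCD + hunit
    have e12 : ⟪u₁, u₂⟫ = 0 := by
      rw [hu₁, hu₂, real_inner_smul_left, inner_smul_right, inner_frame]; ring
    have e13 : ⟪u₁, outerNormal S p⟫ = 0 := by
      rw [hu₁, hν, real_inner_smul_left, inner_frame]
      linear_combination v⁻¹ * (x' * P s₀ * hCD + hperp)
    have e23 : ⟪u₂, outerNormal S p⟫ = 0 := by
      rw [hu₂, hν, real_inner_smul_left, inner_frame]; ring
    exact orthonormal_vec3 e11 e22 e33 e12 e13 e23
  rw [meanCurvature, trace_eq_inner_add_of_orthonormal ho]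
  simp only [ContinuousLinearMap.coe_coe, ← hA]
  have i1 : ⟪u₁, A u₁⟫ = (x' * P' + z' * Q') / (x' ^ 2 + z' ^ 2) := by
    rw [hu₁, map_smul, h1, real_inner_smul_left, inner_smul_right, inner_frame, ← hv2]
    field_simp
    linear_combination x' * P' * hCD
  have i2 : ⟪u₂, A u₂⟫ = P s₀ / x s₀ := by
    rw [hu₂, map_smul, h2, real_inner_smul_left, inner_smul_right, inner_frame]
    field_simp
    linear_combination P s₀ * x s₀ * hCD
  rw [i1, i2]
  ring

/-! ### Integration over patches of surfaces of revolution -/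

/-- The patch swept out by the profile `(x, z)` over the parameter set `I` under rotation about the
axis of the frame `e` at `c`. -/
def revolutionPatch (e : OrthonormalBasis (Fin 3) ℝ E3) (c : E3) (x z : ℝ → ℝ) (I : Set ℝ) :
    Set E3 :=
  {p | ∃ s ∈ I, ∃ t ∈ Ico 0 (2 * Real.pi), p = cylPoint e c (x s) (z s) t}

/-- The parametrization of a surface of revolution by the profile parameter and the angle. -/
noncomputable def revolutionMap (e : OrthonormalBasis (Fin 3) ℝ E3) (c : E3) (x z : ℝ → ℝ)
    (q : E2) : E3 :=
  cylPoint e c (x (q 0)) (z (q 0)) (q 1)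

theorem inner_cylPoint_sub (e : OrthonormalBasis (Fin 3) ℝ E3) (c : E3) (x z t : ℝ) :
    ⟪cylPoint e c x z t - c, e 0⟫ = x * Real.cos t ∧
    ⟪cylPoint e c x z t - c, e 1⟫ = x * Real.sin t ∧ ⟪cylPoint e c x z t - c, e 2⟫ = z := by
  have h := e.inner_eq_ite
  simp [cylPoint, inner_add_left, real_inner_smul_left, h]

theorem eq_of_cos_eq_of_sin_eq {t t' : ℝ} (ht : t ∈ Ico 0 (2 * Real.pi))
    (ht' : t' ∈ Ico 0 (2 * Real.pi)) (hc : Real.cos t = Real.cos t')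
    (hs : Real.sin t = Real.sin t') : t = t' := by
  have h : ((t : ℝ) : Real.Angle) = (t' : ℝ) := Real.Angle.cos_sin_inj hc hs
  obtain ⟨n, hn⟩ := Real.Angle.angle_eq_iff_two_pi_dvd_sub.1 h
  have hpi := Real.pi_pos
  have h1 : (n : ℝ) < 1 := by
    by_contra hcon
    nlinarith [ht.1, ht.2, ht'.1, ht'.2, not_lt.1 hcon]
  have h2 : (-1 : ℝ) < n := by
    by_contra hcon
    nlinarith [ht.1, ht.2, ht'.1, ht'.2, not_lt.1 hcon]
  have : n = 0 := by
    have h1' : n < 1 := by exact_mod_cast h1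
    have h2' : -1 < n := by exact_mod_cast h2
    omega
  rw [this] at hn
  simp at hn
  linarith

theorem cylPoint_inj {e : OrthonormalBasis (Fin 3) ℝ E3} {c : E3} {x z t x' z' t' : ℝ}
    (hx : 0 < x) (hx' : 0 < x') (h : cylPoint e c x z t = cylPoint e c x' z' t') :
    x = x' ∧ z = z' ∧ Real.cos t = Real.cos t' ∧ Real.sin t = Real.sin t' := by
  obtain ⟨h0, h1, h2⟩ := inner_cylPoint_sub e c x z t
  obtain ⟨h0', h1', h2'⟩ := inner_cylPoint_sub e c x' z' t'
  rw [h] at h0 h1 h2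
  have hc := h0.symm.trans h0'
  have hs := h1.symm.trans h1'
  have hsq : x ^ 2 = x' ^ 2 := by
    linear_combination (x * Real.cos t + x' * Real.cos t') * hc +
      (x * Real.sin t + x' * Real.sin t') * hs - x ^ 2 * Real.cos_sq_add_sin_sq t +
      x' ^ 2 * Real.cos_sq_add_sin_sq t'
  have hxx : x = x' := by
    rwa [sq_eq_sq₀ hx.le hx'.le] at hsq
  subst hxx
  exact ⟨rfl, h2.symm.trans h2', mul_left_cancel₀ hx.ne' hc, mul_left_cancel₀ hx.ne' hs⟩

section Patch

variable {e : OrthonormalBasis (Fin 3) ℝ E3} {c : E3} {x z : ℝ → ℝ}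

theorem contDiff_revolutionMap (hx : ContDiff ℝ 1 x) (hz : ContDiff ℝ 1 z) :
    ContDiff ℝ 1 (revolutionMap e c x z) := by
  have h0 : ContDiff ℝ 1 fun q : E2 => q 0 := by fun_prop
  have h1 : ContDiff ℝ 1 fun q : E2 => q 1 := by fun_prop
  have hx' := hx.comp h0
  have hz' := hz.comp h0
  unfold revolutionMap cylPoint
  simp only [Function.comp_def] at hx' hz'
  fun_prop

theorem fderiv_revolutionMap (hx : ContDiff ℝ 1 x) (hz : ContDiff ℝ 1 z) (q : E2) :
    fderiv ℝ (revolutionMap e c x z) q (EuclideanSpace.single 0 1) =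
      (deriv x (q 0) * Real.cos (q 1)) • e 0 + (deriv x (q 0) * Real.sin (q 1)) • e 1 +
        deriv z (q 0) • e 2 ∧
    fderiv ℝ (revolutionMap e c x z) q (EuclideanSpace.single 1 1) =
      (-x (q 0) * Real.sin (q 1)) • e 0 + (x (q 0) * Real.cos (q 1)) • e 1 + (0 : ℝ) • e 2 := by
  have hd : DifferentiableAt ℝ (revolutionMap e c x z) q :=
    (contDiff_revolutionMap hx hz).contDiffAt.differentiableAt (by simp)
  have hline : ∀ v : E2, HasDerivAt (fun t : ℝ => q + t • v) v 0 := fun v => by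
    simpa using ((hasDerivAt_id (0 : ℝ)).smul_const v).const_add q
  have hcomp : ∀ v : E2, HasDerivAt (fun t : ℝ => revolutionMap e c x z (q + t • v))
      (fderiv ℝ (revolutionMap e c x z) q v) 0 := fun v =>
    hd.hasFDerivAt.comp_hasDerivAt_of_eq (x := (0 : ℝ)) (hline v) (by simp)
  have hid : HasDerivAt (fun t : ℝ => q 0 + t) 1 0 := (hasDerivAt_id (0 : ℝ)).const_add _
  have hid1 : HasDerivAt (fun t : ℝ => q 1 + t) 1 0 := (hasDerivAt_id (0 : ℝ)).const_add _
  constructor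
  · have hxd : HasDerivAt (fun t => x (q 0 + t)) (deriv x (q 0)) 0 := by
      have : HasDerivAt x (deriv x (q 0)) (q 0 + 0) := by
        rw [add_zero]; exact (hx.differentiable (by simp) _).hasDerivAt
      simpa using! this.comp (0 : ℝ) hid
    have hzd : HasDerivAt (fun t => z (q 0 + t)) (deriv z (q 0)) 0 := by
      have : HasDerivAt z (deriv z (q 0)) (q 0 + 0) := by
        rw [add_zero]; exact (hz.differentiable (by simp) _).hasDerivAt
      simpa using! this.comp (0 : ℝ) hid
    have h2 := hasDerivAt_cylPoint e c hxd hzd (hasDerivAt_const (0 : ℝ) (q 1))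
    refine (hcomp (EuclideanSpace.single 0 1)).unique ?_
    exact (h2.congr_of_eventuallyEq
      (Eventually.of_forall fun t => by simp [revolutionMap])).congr_deriv (by simp)
  · have h2 := hasDerivAt_cylPoint e c (hasDerivAt_const (0 : ℝ) (x (q 0)))
      (hasDerivAt_const (0 : ℝ) (z (q 0))) hid1
    refine (hcomp (EuclideanSpace.single 1 1)).unique ?_
    exact (h2.congr_of_eventuallyEq
      (Eventually.of_forall fun t => by simp [revolutionMap])).congr_deriv (by simp)

theorem normDet_fderiv_revolutionMap (hx : ContDiff ℝ 1 x) (hz : ContDiff ℝ 1 z) (q : E2)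
    (hpos : 0 ≤ x (q 0)) :
    (fderiv ℝ (revolutionMap e c x z) q : E2 →ₗ[ℝ] E3).normDet =
      x (q 0) * √(deriv x (q 0) ^ 2 + deriv z (q 0) ^ 2) := by
  obtain ⟨h0, h1⟩ := fderiv_revolutionMap (e := e) (c := c) hx hz q
  have h := LinearMap.normDet_sq_eq_det_gram (fderiv ℝ (revolutionMap e c x z) q : E2 →ₗ[ℝ] E3)
    (EuclideanSpace.basisFun (Fin 2) ℝ)
  rw [Matrix.det_fin_two] at h
  simp only [Matrix.gram_apply, EuclideanSpace.basisFun_apply, ContinuousLinearMap.coe_coe, h0, h1,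
    inner_frame, RCLike.ofReal_real_eq_id, id] at h
  rw [← sq_eq_sq₀ (LinearMap.normDet_nonneg _) (by positivity), h, mul_pow,
    Real.sq_sqrt (by positivity)]
  have hcs := Real.cos_sq_add_sin_sq (q 1)
  linear_combination (x (q 0) ^ 2 * deriv x (q 0) ^ 2 * (Real.cos (q 1) ^ 2 + Real.sin (q 1) ^ 2 +
    1) + x (q 0) ^ 2 * deriv z (q 0) ^ 2) * hcs

/-- The identification of the Euclidean plane with `ℝ × ℝ`. -/
noncomputable def planeEquiv : E2 ≃ᵐ ℝ × ℝ :=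
  (MeasurableEquiv.toLp 2 (Fin 2 → ℝ)).symm.trans MeasurableEquiv.finTwoArrow

theorem measurePreserving_planeEquiv : MeasurePreserving planeEquiv volume volume :=
  (EuclideanSpace.volume_preserving_symm_measurableEquiv_toLp (Fin 2)).trans
    (volume_preserving_finTwoArrow ℝ)

theorem revolutionPatch_eq_image (I : Set ℝ) :
    revolutionPatch e c x z I =
      revolutionMap e c x z '' (planeEquiv ⁻¹' (I ×ˢ Ico 0 (2 * Real.pi))) := by
  ext p
  constructor
  · rintro ⟨s, hs, t, ht, rfl⟩
    exact ⟨!₂[s, t], ⟨hs, ht⟩, rfl⟩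
  · rintro ⟨q, ⟨hs, ht⟩, rfl⟩
    exact ⟨q 0, hs, q 1, ht, rfl⟩

theorem injOn_revolutionMap {I : Set ℝ} (hpos : ∀ s ∈ I, 0 < x s)
    (hinj : InjOn (fun s => (x s, z s)) I) :
    InjOn (revolutionMap e c x z) (planeEquiv ⁻¹' (I ×ˢ Ico 0 (2 * Real.pi))) := by
  rintro q ⟨hs, ht⟩ q' ⟨hs', ht'⟩ h
  obtain ⟨hx, hz, hc, hsn⟩ := cylPoint_inj (hpos _ hs) (hpos _ hs') h
  have h0 : q 0 = q' 0 := hinj hs hs' (Prod.ext hx hz)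
  have h1 : q 1 = q' 1 := eq_of_cos_eq_of_sin_eq ht ht' hc hsn
  ext i
  fin_cases i
  · exact h0
  · exact h1

theorem measurableSet_revolutionPatch (hx : ContDiff ℝ 1 x) (hz : ContDiff ℝ 1 z) {I : Set ℝ}
    (hI : MeasurableSet I) (hpos : ∀ s ∈ I, 0 < x s) (hinj : InjOn (fun s => (x s, z s)) I) :
    MeasurableSet (revolutionPatch e c x z I) := by
  rw [revolutionPatch_eq_image]
  exact (planeEquiv.measurable (hI.prod measurableSet_Ico)).image_of_continuousOn_injOn
    (contDiff_revolutionMap hx hz).continuous.continuousOn (injOn_revolutionMap hpos hinj)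

/-- Integration over a patch of revolution.  It suffices that the integrand times the area density
agrees with a continuous function in the interior of the parameter interval. -/
theorem integral_revolutionPatch (hx : ContDiff ℝ 1 x) (hz : ContDiff ℝ 1 z) {a b : ℝ}
    (hab : a ≤ b) {I : Set ℝ} (hI : MeasurableSet I) (hI₁ : Ioo a b ⊆ I) (hI₂ : I ⊆ Icc a b)
    (hpos : ∀ s ∈ I, 0 < x s) (hinj : InjOn (fun s => (x s, z s)) I)
    (hspeed : ∀ s ∈ I, deriv x s ^ 2 + deriv z s ^ 2 ≠ 0) {g : E3 → ℝ} {G : ℝ → ℝ → ℝ}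
    (hG : ContinuousOn (Function.uncurry G) (Icc a b ×ˢ Icc 0 (2 * Real.pi)))
    (hgG : ∀ s ∈ Ioo a b, ∀ t ∈ Ico 0 (2 * Real.pi),
      x s * √(deriv x s ^ 2 + deriv z s ^ 2) * g (cylPoint e c (x s) (z s) t) = G s t) :
    IntegrableOn g (revolutionPatch e c x z I) μHE[2] ∧
      ∫ p in revolutionPatch e c x z I, g p ∂μHE[2] =
        ∫ s in a..b, ∫ t in (0 : ℝ)..(2 * Real.pi), G s t := by
  have hf := contDiff_revolutionMap (e := e) (c := c) hx hz
  set D : Set (ℝ × ℝ) := I ×ˢ Ico 0 (2 * Real.pi) with hD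
  set D' : Set (ℝ × ℝ) := Ioo a b ×ˢ Ico 0 (2 * Real.pi) with hD'
  have hDm : MeasurableSet (planeEquiv ⁻¹' D) := planeEquiv.measurable (hI.prod measurableSet_Ico)
  have hinj' := injOn_revolutionMap (e := e) (c := c) hpos hinj
  have himm : ∀ q ∈ planeEquiv ⁻¹' D, Function.Injective (fderiv ℝ (revolutionMap e c x z) q) := by
    rintro q ⟨hs, -⟩
    refine ((LinearMap.normDet_ne_zero_tfae
      (fderiv ℝ (revolutionMap e c x z) q : E2 →ₗ[ℝ] E3)).out 0 4).1 ?_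
    rw [normDet_fderiv_revolutionMap hx hz q (hpos _ hs).le]
    exact mul_ne_zero (hpos _ hs).ne'
      (Real.sqrt_ne_zero'.2 (lt_of_le_of_ne (by positivity) (hspeed _ hs).symm))
  set J : ℝ × ℝ → ℝ := fun q =>
    x q.1 * √(deriv x q.1 ^ 2 + deriv z q.1 ^ 2) * g (cylPoint e c (x q.1) (z q.1) q.2) with hJ
  have hcongr : ∀ q ∈ planeEquiv ⁻¹' D,
      (fderiv ℝ (revolutionMap e c x z) q : E2 →ₗ[ℝ] E3).normDet * g (revolutionMap e c x z q) =
        (J ∘ planeEquiv) q := by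
    rintro q ⟨hs, -⟩
    rw [normDet_fderiv_revolutionMap hx hz q (hpos _ hs).le]
    rfl
  have hae : D =ᵐ[volume] D' := by
    refine Measure.set_prod_ae_eq ?_ (ae_eq_refl _)
    refine (LE.le.eventuallyLE hI₂).trans ?_ |>.antisymm
      (LE.le.eventuallyLE hI₁)
    exact Ioo_ae_eq_Icc.symm.le
  have hGD' : EqOn J (Function.uncurry G) D' := fun q hq => hgG q.1 hq.1 q.2 hq.2
  have hD'm : MeasurableSet D' := measurableSet_Ioo.prod measurableSet_Ico
  have hGint : IntegrableOn (Function.uncurry G) D' := by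
    refine (hG.integrableOn_compact (isCompact_Icc.prod isCompact_Icc)).mono_set ?_
    exact prod_mono Ioo_subset_Icc_self Ico_subset_Icc_self
  have hJint : IntegrableOn J D := by
    rw [integrableOn_congr_set_ae hae, integrableOn_congr_fun hGD' hD'm]
    exact hGint
  have hfin : finrank ℝ E2 = 2 := by simp
  have h1 := integrableOn_image_iff_normDet_fderiv hf hDm hinj' himm g
  have h2 := integral_image_eq_normDet_fderiv hf hDm hinj' himm g
  rw [hfin, ← revolutionPatch_eq_image] at h1 h2
  rw [h1, h2, integrableOn_congr_fun hcongr hDm, setIntegral_congr_fun hDm hcongr]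
  refine ⟨(measurePreserving_planeEquiv.integrableOn_comp_preimage
    planeEquiv.measurableEmbedding).2 hJint, ?_⟩
  have h3 := measurePreserving_planeEquiv.setIntegral_preimage_emb
    planeEquiv.measurableEmbedding J D
  simp only [Function.comp_apply]
  rw [h3, setIntegral_congr_set hae, setIntegral_congr_fun hD'm hGD', Measure.volume_eq_prod,
    setIntegral_prod _ (by rwa [← Measure.volume_eq_prod]), intervalIntegral.integral_of_le hab,
    ← integral_Ioc_eq_integral_Ioo]
  refine setIntegral_congr_fun measurableSet_Ioc fun s _ => ?_
  simp only [Function.uncurry_apply_pair]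
  rw [intervalIntegral.integral_of_le (by positivity), integral_Ioc_eq_integral_Ioo,
    integral_Ico_eq_integral_Ioo]

theorem euclideanHausdorffMeasure_revolutionPatch (hx : ContDiff ℝ 1 x) (hz : ContDiff ℝ 1 z)
    {a b : ℝ} (hab : a ≤ b) {I : Set ℝ} (hI : MeasurableSet I) (hI₁ : Ioo a b ⊆ I)
    (hI₂ : I ⊆ Icc a b) (hpos : ∀ s ∈ I, 0 < x s) (hinj : InjOn (fun s => (x s, z s)) I)
    (hspeed : ∀ s ∈ I, deriv x s ^ 2 + deriv z s ^ 2 ≠ 0) :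
    μHE[2] (revolutionPatch e c x z I) = ENNReal.ofReal
      (2 * Real.pi * ∫ s in a..b, x s * √(deriv x s ^ 2 + deriv z s ^ 2)) := by
  have hx' := hx.continuous_deriv (by simp)
  have hz' := hz.continuous_deriv (by simp)
  have hxc := hx.continuous
  obtain ⟨h1, h2⟩ := integral_revolutionPatch (e := e) (c := c) hx hz hab hI hI₁ hI₂ hpos hinj
    hspeed (g := fun _ => 1) (G := fun s _ => x s * √(deriv x s ^ 2 + deriv z s ^ 2))
    (Continuous.continuousOn (by fun_prop)) (by simp)
  have hfin : μHE[2] (revolutionPatch e c x z I) ≠ ⊤ := by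
    rcases (integrableOn_const_iff (by simp)).1 h1 with h | h
    · simp at h
    · exact h.ne
  rw [setIntegral_const, smul_eq_mul, mul_one] at h2
  rw [← ENNReal.ofReal_toReal hfin]
  congr 1
  rw [← measureReal_def, h2]
  simp only [intervalIntegral.integral_const, sub_zero, smul_eq_mul]
  rw [intervalIntegral.integral_const_mul]

end Patch

/-! ### The Gauss map of a regular `C²` level set -/

/-- Near `p ∈ S` the set `S` is the zero set of the `C²` function `G`, which is regular at `p`,
negative only in the inner domain, and positive only in the outer domain. -/
structure IsRegularLevelSetAt (S : Set E3) (G : E3 → ℝ) (p : E3) : Prop where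
  mem : p ∈ S
  contDiffAt : ContDiffAt ℝ 2 G p
  fderiv_ne_zero : fderiv ℝ G p ≠ 0
  outer : ∀ᶠ x in 𝓝 p, 0 < G x → x ∈ outerDomain S
  inner : ∀ᶠ x in 𝓝 p, G x < 0 → x ∈ innerDomain S
  zero : ∀ᶠ x in 𝓝 p, G x = 0 ↔ x ∈ S

namespace IsRegularLevelSetAt

variable {S : Set E3} {G : E3 → ℝ} {p : E3}

theorem inner_gradient (p v : E3) : ⟪gradient G p, v⟫ = fderiv ℝ G p v := by
  rw [gradient, InnerProductSpace.toDual_symm_apply]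

theorem isDefiningFunctionAt (h : IsRegularLevelSetAt S G p) :
    IsDefiningFunctionAt S G p (gradient G p) where
  mem := h.mem
  hasFDerivAt := by
    have heq : innerSL ℝ (gradient G p) = fderiv ℝ G p :=
      ContinuousLinearMap.ext fun v => inner_gradient p v
    rw [heq]
    exact (h.contDiffAt.differentiableAt (by simp)).hasFDerivAt
  ne_zero := fun h0 => h.fderiv_ne_zero (by
    ext v
    rw [← inner_gradient, h0, inner_zero_left]; rfl)
  continuousAt := by
    filter_upwards [h.contDiffAt.eventually (by simp)] with x hx using hx.continuousAt
  outer := h.outer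
  inner := h.inner
  zero := h.zero

theorem eventually (h : IsRegularLevelSetAt S G p) :
    ∀ᶠ x in 𝓝[S] p, IsRegularLevelSetAt S G x := by
  have hd : ContinuousAt (fderiv ℝ G) p :=
    (h.contDiffAt.fderiv_right (m := 1) (by norm_num)).continuousAt
  filter_upwards [self_mem_nhdsWithin, nhdsWithin_le_nhds (h.contDiffAt.eventually (by simp)),
    nhdsWithin_le_nhds (hd.eventually_ne h.fderiv_ne_zero),
    nhdsWithin_le_nhds h.outer.eventually_nhds, nhdsWithin_le_nhds h.inner.eventually_nhds,
    nhdsWithin_le_nhds h.zero.eventually_nhds] with x h1 h2 h3 h4 h5 h6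
  exact ⟨h1, h2, h3, h4, h5, h6⟩

theorem differentiableWithinAt_outerNormal (h : IsRegularLevelSetAt S G p) :
    DifferentiableWithinAt ℝ (outerNormal S) S p := by
  have hd : DifferentiableAt ℝ (fderiv ℝ G) p :=
    (h.contDiffAt.fderiv_right (m := 1) (by norm_num)).differentiableAt (by simp)
  have hg : DifferentiableAt ℝ (gradient G) p :=
    (InnerProductSpace.toDual ℝ E3).symm.toContinuousLinearEquiv.differentiableAt.comp p hd
  have hN : DifferentiableAt ℝ (fun x => ‖gradient G x‖⁻¹ • gradient G x) p :=
    ((hg.norm ℝ h.isDefiningFunctionAt.ne_zero).inv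
      (norm_ne_zero_iff.2 h.isDefiningFunctionAt.ne_zero)).smul hg
  refine hN.differentiableWithinAt.congr_of_eventuallyEq ?_ h.isDefiningFunctionAt.outerNormal_eq
  filter_upwards [h.eventually] with x hx using hx.isDefiningFunctionAt.outerNormal_eq

/-- The outer normal at a point of a surface of revolution is the unit vector orthogonal to the
meridian and to the parallel on the side of increasing `G`. -/
theorem outerNormal_cylPoint {e : OrthonormalBasis (Fin 3) ℝ E3} {c : E3} {x z : ℝ → ℝ}
    {x' z' P Q s₀ t₀ : ℝ} (h : IsRegularLevelSetAt S G (cylPoint e c (x s₀) (z s₀) t₀))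
    (hx : HasDerivAt x x' s₀) (hz : HasDerivAt z z' s₀) (hx0 : x s₀ ≠ 0)
    (hv : x' ^ 2 + z' ^ 2 ≠ 0) (hunit : P ^ 2 + Q ^ 2 = 1) (hperp : P * x' + Q * z' = 0)
    (hmer : ∀ᶠ s in 𝓝 s₀, cylPoint e c (x s) (z s) t₀ ∈ S)
    (hpar : ∀ᶠ t in 𝓝 t₀, cylPoint e c (x s₀) (z s₀) t ∈ S) {v : E3}
    (hv1 : 0 < fderiv ℝ G (cylPoint e c (x s₀) (z s₀) t₀) v)
    (hv2 : 0 < ⟪cylPoint e 0 P Q t₀, v⟫) :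
    outerNormal S (cylPoint e c (x s₀) (z s₀) t₀) = cylPoint e 0 P Q t₀ := by
  set p := cylPoint e c (x s₀) (z s₀) t₀ with hp
  set g := gradient G p with hg
  set n := cylPoint e 0 P Q t₀ with hn
  have hdef := h.isDefiningFunctionAt
  have hcs := Real.cos_sq_add_sin_sq t₀
  have hzero : ∀ {γ : ℝ → E3} {γ' : E3} {s : ℝ}, HasDerivAt γ γ' s → (∀ᶠ s in 𝓝 s, γ s ∈ S) →
      γ s = p → ⟪g, γ'⟫ = 0 := by
    intro γ γ' s hγ hS hγp
    have h1 := hdef.hasFDerivAt.comp_hasDerivAt_of_eq s hγ hγp.symm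
    have hcont : Tendsto γ (𝓝 s) (𝓝 p) := hγp ▸ hγ.continuousAt
    have h2 : HasDerivAt (G ∘ γ) 0 s := by
      refine (hasDerivAt_const s (0 : ℝ)).congr_of_eventuallyEq ?_
      filter_upwards [hcont.eventually h.zero, hS] with s hs1 hs2 using hs1.2 hs2
    have h3 := h1.unique h2
    rwa [innerSL_apply_apply] at h3
  have hm := hzero (hasDerivAt_cylPoint e c hx hz (hasDerivAt_const s₀ t₀)) hmer rfl
  have hq := hzero (hasDerivAt_cylPoint e c (hasDerivAt_const t₀ (x s₀))
    (hasDerivAt_const t₀ (z s₀)) (hasDerivAt_id t₀)) hpar rfl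
  -- the components of the gradient in the frame
  obtain ⟨a, b, d, hgabd⟩ : ∃ a b d : ℝ, g = a • e 0 + b • e 1 + d • e 2 :=
    ⟨e.repr g 0, e.repr g 1, e.repr g 2, by
      rw [← Fin.sum_univ_three (fun i => e.repr g i • e i), e.sum_repr]⟩
  rw [hgabd, inner_frame] at hm hq
  simp only [mul_zero, sub_zero, add_zero, zero_mul, zero_sub, zero_add, mul_one, id] at hm hq
  set C := Real.cos t₀ with hC
  set D := Real.sin t₀ with hD
  have hq' : b * C = a * D := by
    have : x s₀ * (b * C - a * D) = 0 := by linear_combination hq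
    have := (mul_eq_zero.1 this).resolve_left hx0
    linarith
  set l := a * C + b * D with hl
  have haC : a = l * C := by rw [hl]; linear_combination (-a) * hcs - D * hq'
  have hbD : b = l * D := by rw [hl]; linear_combination (-b) * hcs + C * hq'
  have hm' : l * x' + d * z' = 0 := by rw [hl]; linear_combination hm
  -- `(l, d)` and `(P, Q)` are both orthogonal to `(x', z')`
  set μ := l * P + d * Q with hμ
  have hdet : l * Q - d * P = 0 := by
    have h1 : (x' ^ 2 + z' ^ 2) * (l * Q - d * P) = 0 := by
      linear_combination (Q * x' - P * z') * hm' + (l * z' - d * x') * hperp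
    exact (mul_eq_zero.1 h1).resolve_left hv
  have hlP : l = μ * P := by rw [hμ]; linear_combination (-l) * hunit + Q * hdet
  have hdQ : d = μ * Q := by rw [hμ]; linear_combination (-d) * hunit - P * hdet
  have hgn : g = μ • n := by
    rw [hgabd, hn, cylPoint, zero_add, smul_add, smul_add, smul_smul, smul_smul, smul_smul,
      haC, hbD, hdQ, hlP]
    congr 3 <;> ring
  have hμpos : 0 < μ := by
    rw [← inner_gradient, ← hg, hgn, real_inner_smul_left] at hv1
    exact pos_of_mul_pos_left hv1 hv2.le
  have hnn : ‖n‖ = 1 := by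
    have : ⟪n, n⟫ = 1 := by
      rw [hn, cylPoint, zero_add, inner_frame]
      linear_combination P ^ 2 * hcs + hunit
    rw [norm_eq_sqrt_real_inner, this, Real.sqrt_one]
  rw [hdef.outerNormal_eq, ← hg, hgn, norm_smul, hnn, mul_one, Real.norm_of_nonneg hμpos.le,
    smul_smul, inv_mul_cancel₀ hμpos.ne', one_smul]

end IsRegularLevelSetAt

/-- Outer normal and mean curvature on a piece of a surface of revolution, whose profile `(x, z)`
has the unit normal `(P, Q)` on the side of the outer domain. -/
theorem meanCurvature_of_isRegularLevelSetAt {S : Set E3} {e : OrthonormalBasis (Fin 3) ℝ E3}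
    {c : E3} {x z P Q x' z' P' Q' : ℝ → ℝ} {I : Set ℝ} (hI : IsOpen I)
    (hx : ∀ s ∈ I, HasDerivAt x (x' s) s) (hz : ∀ s ∈ I, HasDerivAt z (z' s) s)
    (hP : ∀ s ∈ I, HasDerivAt P (P' s) s) (hQ : ∀ s ∈ I, HasDerivAt Q (Q' s) s)
    (hx0 : ∀ s ∈ I, x s ≠ 0) (hv : ∀ s ∈ I, x' s ^ 2 + z' s ^ 2 ≠ 0)
    (hunit : ∀ s ∈ I, P s ^ 2 + Q s ^ 2 = 1) (hperp : ∀ s ∈ I, P s * x' s + Q s * z' s = 0)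
    (hreg : ∀ s ∈ I, ∀ t, ∃ G v, IsRegularLevelSetAt S G (cylPoint e c (x s) (z s) t) ∧
      0 < fderiv ℝ G (cylPoint e c (x s) (z s) t) v ∧ 0 < ⟪cylPoint e 0 (P s) (Q s) t, v⟫)
    {s : ℝ} (hs : s ∈ I) (t : ℝ) :
    meanCurvature S (cylPoint e c (x s) (z s) t) =
      ((x' s * P' s + z' s * Q' s) / (x' s ^ 2 + z' s ^ 2) + P s / x s) / 2 := by
  have hmem : ∀ s ∈ I, ∀ t, cylPoint e c (x s) (z s) t ∈ S := fun s hs t => by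
    obtain ⟨G, v, h, -⟩ := hreg s hs t
    exact h.mem
  have hnhds : ∀ s ∈ I, ∀ᶠ s in 𝓝 s, s ∈ I := fun s hs => hI.mem_nhds hs
  have hnormal : ∀ s ∈ I, ∀ t, outerNormal S (cylPoint e c (x s) (z s) t) =
      cylPoint e 0 (P s) (Q s) t := fun s hs t => by
    obtain ⟨G, v, h, h1, h2⟩ := hreg s hs t
    exact h.outerNormal_cylPoint (hx s hs) (hz s hs) (hx0 s hs) (hv s hs) (hunit s hs)
      (hperp s hs) ((hnhds s hs).mono fun s hs => hmem s hs t)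
      (Eventually.of_forall fun t => hmem s hs t) h1 h2
  obtain ⟨G, v, h, -⟩ := hreg s hs t
  exact meanCurvature_cylPoint (hx s hs) (hz s hs) (hP s hs) (hQ s hs) (hx0 s hs) (hv s hs)
    (hunit s hs) (hperp s hs)
    ((hnhds s hs).mono fun s hs => ⟨hmem s hs t, hnormal s hs t⟩)
    (Eventually.of_forall fun t => ⟨hmem s hs t, hnormal s hs t⟩)
    h.differentiableWithinAt_outerNormal

/-! ### Circular arcs rotated about an axis -/

theorem cylPoint_add_smul (e : OrthonormalBasis (Fin 3) ℝ E3) (c : E3) (x z x' z' t τ : ℝ) :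
    cylPoint e c x z t + τ • cylPoint e 0 x' z' t = cylPoint e c (x + τ * x') (z + τ * z') t := by
  simp only [cylPoint, zero_add]
  module

theorem inner_cylPoint_zero (e : OrthonormalBasis (Fin 3) ℝ E3) (x z x' z' t : ℝ) :
    ⟪cylPoint e 0 x z t, cylPoint e 0 x' z' t⟫ = x * x' + z * z' := by
  rw [cylPoint, cylPoint, zero_add, zero_add, inner_frame]
  linear_combination x * x' * Real.cos_sq_add_sin_sq t

theorem norm_cylPoint_sub_sq (e : OrthonormalBasis (Fin 3) ℝ E3) (c : E3) (x z t : ℝ) :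
    ‖cylPoint e c x z t - c‖ ^ 2 = x ^ 2 + z ^ 2 := by
  have : cylPoint e c x z t - c = cylPoint e 0 x z t := by simp [cylPoint]
  rw [this, ← real_inner_self_eq_norm_sq, inner_cylPoint_zero]
  ring

theorem euclideanHausdorffMeasure_two_singleton (p : E3) : μHE[2] ({p} : Set E3) = 0 := by
  have : NullSingletonClass (μH[((2 : ℕ) : ℝ)] : Measure E3) :=
    Measure.nullSingletonClass_hausdorff E3 (by norm_num)
  rw [Measure.euclideanHausdorffMeasure_def, Measure.smul_apply, measure_singleton, smul_zero]

/-- Abscissa of the circle of radius `k` at the tangent angle `φ`, whose center has abscissa `u`. -/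
noncomputable def arcX (u k φ : ℝ) : ℝ := u + k * Real.sin φ

/-- Ordinate of the circle of radius `k` at the tangent angle `φ`, whose center has ordinate `w`. -/
noncomputable def arcZ (w k φ : ℝ) : ℝ := w - k * Real.cos φ

theorem hasDerivAt_arcX (u k φ : ℝ) : HasDerivAt (arcX u k) (k * Real.cos φ) φ :=
  ((Real.hasDerivAt_sin φ).const_mul k).const_add u

theorem hasDerivAt_arcZ (w k φ : ℝ) : HasDerivAt (arcZ w k) (k * Real.sin φ) φ := by
  simpa using! ((Real.hasDerivAt_cos φ).const_mul k).const_sub w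

theorem contDiff_arcX (u k : ℝ) : ContDiff ℝ 1 (arcX u k) := by unfold arcX; fun_prop

theorem contDiff_arcZ (w k : ℝ) : ContDiff ℝ 1 (arcZ w k) := by unfold arcZ; fun_prop

theorem arc_speed_sq (u w k φ : ℝ) :
    deriv (arcX u k) φ ^ 2 + deriv (arcZ w k) φ ^ 2 = k ^ 2 := by
  rw [(hasDerivAt_arcX u k φ).deriv, (hasDerivAt_arcZ w k φ).deriv]
  linear_combination k ^ 2 * Real.cos_sq_add_sin_sq φ

theorem injOn_arc {u w k a b : ℝ} (hk : 0 < k) (hb : b ≤ a + Real.pi) :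
    InjOn (fun φ => (arcX u k φ, arcZ w k φ)) (Icc a b) := by
  intro φ hφ ψ hψ h
  obtain ⟨h1, h2⟩ := Prod.mk.inj h
  simp only [arcX, arcZ, add_right_inj, sub_right_inj] at h1 h2
  have hs := mul_left_cancel₀ hk.ne' h1
  have hc := mul_left_cancel₀ hk.ne' h2
  have : Real.cos (φ - a) = Real.cos (ψ - a) := by
    rw [Real.cos_sub, Real.cos_sub, hs, hc]
  have := Real.injOn_cos ⟨by linarith [hφ.1], by linarith [hφ.2]⟩
    ⟨by linarith [hψ.1], by linarith [hψ.2]⟩ this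
  linarith

section Arc

variable {e : OrthonormalBasis (Fin 3) ℝ E3} {c : E3} {u w k a b : ℝ} {I : Set ℝ}

theorem measurableSet_arcPatch (hk : 0 < k) (hb : b ≤ a + Real.pi) (hI : MeasurableSet I)
    (hI₂ : I ⊆ Icc a b) (hpos : ∀ φ ∈ I, 0 < arcX u k φ) :
    MeasurableSet (revolutionPatch e c (arcX u k) (arcZ w k) I) :=
  measurableSet_revolutionPatch (contDiff_arcX u k) (contDiff_arcZ w k) hI hpos
    ((injOn_arc hk hb).mono hI₂)

theorem integral_arcPatch (hk : 0 < k) (hab : a ≤ b) (hb : b ≤ a + Real.pi) (hI : MeasurableSet I)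
    (hI₁ : Ioo a b ⊆ I) (hI₂ : I ⊆ Icc a b) (hpos : ∀ φ ∈ I, 0 < arcX u k φ) {g : E3 → ℝ}
    {G : ℝ → ℝ → ℝ} (hG : Continuous (Function.uncurry G))
    (hgG : ∀ φ ∈ Ioo a b, ∀ t ∈ Ico 0 (2 * Real.pi),
      k * arcX u k φ * g (cylPoint e c (arcX u k φ) (arcZ w k φ) t) = G φ t) :
    IntegrableOn g (revolutionPatch e c (arcX u k) (arcZ w k) I) μHE[2] ∧
      ∫ p in revolutionPatch e c (arcX u k) (arcZ w k) I, g p ∂μHE[2] =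
        ∫ φ in a..b, ∫ t in (0 : ℝ)..(2 * Real.pi), G φ t := by
  refine integral_revolutionPatch (contDiff_arcX u k) (contDiff_arcZ w k) hab hI hI₁ hI₂ hpos
    ((injOn_arc hk hb).mono hI₂) (fun φ _ => ?_) hG.continuousOn fun φ hφ t ht => ?_
  · rw [arc_speed_sq]; positivity
  · rw [arc_speed_sq, Real.sqrt_sq hk.le, mul_comm (arcX u k φ), hgG φ hφ t ht]

theorem integral_arc_aux (u a b A B : ℝ) :
    ∫ φ in a..b, A * (u + B * Real.sin φ) = A * (u * (b - a) + B * (Real.cos a - Real.cos b)) := by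
  rw [intervalIntegral.integral_const_mul, intervalIntegral.integral_add (by simp)
    (Continuous.intervalIntegrable (by fun_prop) _ _), intervalIntegral.integral_const_mul,
    integral_sin]
  simp
  left
  ring

theorem measure_arcPatch (hk : 0 < k) (hab : a ≤ b) (hb : b ≤ a + Real.pi) (hI : MeasurableSet I)
    (hI₁ : Ioo a b ⊆ I) (hI₂ : I ⊆ Icc a b) (hpos : ∀ φ ∈ I, 0 < arcX u k φ) :
    μHE[2] (revolutionPatch e c (arcX u k) (arcZ w k) I) = ENNReal.ofReal
      (2 * Real.pi * k * (u * (b - a) + k * (Real.cos a - Real.cos b))) := by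
  rw [euclideanHausdorffMeasure_revolutionPatch (contDiff_arcX u k) (contDiff_arcZ w k) hab hI hI₁
    hI₂ hpos ((injOn_arc hk hb).mono hI₂) (fun φ _ => by rw [arc_speed_sq]; positivity)]
  congr 1
  simp_rw [arc_speed_sq, Real.sqrt_sq hk.le]
  have : ∀ φ, arcX u k φ * k = k * (u + k * Real.sin φ) := fun φ => by rw [arcX]; ring
  simp_rw [this]
  rw [integral_arc_aux u]
  ring

/-- The total mean curvature of a rotated circular arc; the sign `ε` tells whether the outer
normal points away from the center of the circle or towards it. -/
theorem integral_meanCurvature_arcPatch {S : Set E3} {ε : ℝ} (hε : ε ^ 2 = 1) (hk : 0 < k)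
    (hab : a ≤ b) (hb : b ≤ a + Real.pi) (hI : MeasurableSet I) (hI₁ : Ioo a b ⊆ I)
    (hI₂ : I ⊆ Icc a b) (hpos : ∀ φ ∈ I, 0 < arcX u k φ)
    (hreg : ∀ φ ∈ Ioo a b, ∀ t, ∃ G v,
      IsRegularLevelSetAt S G (cylPoint e c (arcX u k φ) (arcZ w k φ) t) ∧
      0 < fderiv ℝ G (cylPoint e c (arcX u k φ) (arcZ w k φ) t) v ∧
      0 < ⟪cylPoint e 0 (ε * Real.sin φ) (-ε * Real.cos φ) t, v⟫) :
    IntegrableOn (meanCurvature S) (revolutionPatch e c (arcX u k) (arcZ w k) I) μHE[2] ∧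
      ∫ p in revolutionPatch e c (arcX u k) (arcZ w k) I, meanCurvature S p ∂μHE[2] =
        Real.pi * ε * (u * (b - a) + 2 * k * (Real.cos a - Real.cos b)) := by
  have hH : ∀ φ ∈ Ioo a b, ∀ t, meanCurvature S (cylPoint e c (arcX u k φ) (arcZ w k φ) t) =
      (ε / k + ε * Real.sin φ / arcX u k φ) / 2 := by
    intro φ hφ t
    have hcs := Real.cos_sq_add_sin_sq
    have hpos' : ∀ φ ∈ Ioo a b, 0 < arcX u k φ := fun φ h => hpos φ (hI₁ h)
    rw [meanCurvature_of_isRegularLevelSetAt (P := fun φ => ε * Real.sin φ)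
      (Q := fun φ => -ε * Real.cos φ) (P' := fun φ => ε * Real.cos φ)
      (Q' := fun φ => ε * Real.sin φ) isOpen_Ioo
      (fun φ _ => hasDerivAt_arcX u k φ) (fun φ _ => hasDerivAt_arcZ w k φ)
      (fun φ _ => (Real.hasDerivAt_sin φ).const_mul ε)
      (fun φ _ => by simpa using! (Real.hasDerivAt_cos φ).const_mul (-ε))
      (fun φ h => (hpos' φ h).ne') (fun φ _ => ?_) (fun φ _ => ?_) (fun φ _ => ?_) hreg hφ t]
    · congr 2
      have h1 : (k * Real.cos φ) ^ 2 + (k * Real.sin φ) ^ 2 = k ^ 2 := by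
        linear_combination k ^ 2 * hcs φ
      rw [h1]
      field_simp
      linear_combination ε * hcs φ
    · have h1 : (k * Real.cos φ) ^ 2 + (k * Real.sin φ) ^ 2 = k ^ 2 := by
        linear_combination k ^ 2 * hcs φ
      rw [h1]
      positivity
    · linear_combination ε ^ 2 * hcs φ + hε
    · ring
  obtain ⟨h1, h2⟩ := integral_arcPatch (e := e) (c := c) (w := w) hk hab hb hI hI₁ hI₂ hpos
    (g := meanCurvature S) (G := fun φ _ => ε / 2 * (u + 2 * k * Real.sin φ)) (by fun_prop)
    (fun φ hφ t _ => by
      have := (hpos φ (hI₁ hφ)).ne'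
      rw [hH φ hφ t]
      field_simp
      rw [arcX]
      ring)
  refine ⟨h1, ?_⟩
  rw [h2]
  simp only [intervalIntegral.integral_const, sub_zero, smul_eq_mul]
  rw [intervalIntegral.integral_const_mul, integral_arc_aux u]
  ring

end Arc

theorem cylPoint_zero_left (e : OrthonormalBasis (Fin 3) ℝ E3) (c : E3) (z t t' : ℝ) :
    cylPoint e c 0 z t = cylPoint e c 0 z t' := by
  simp [cylPoint]

theorem arc_sphere_sector (k φ α : ℝ) :
    arcX 0 k φ * Real.cos α + arcZ 0 k φ * Real.sin α = k * Real.sin (φ - α) := by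
  rw [arcX, arcZ, Real.sin_sub]; ring

theorem arc_neck_fst (m σ θ α : ℝ) :
    arcX (m * Real.sin α) σ θ * Real.sin α - arcZ (-m * Real.cos α) σ θ * Real.cos α - m =
      σ * Real.cos (θ - α) := by
  rw [arcX, arcZ, Real.cos_sub]; linear_combination m * Real.sin_sq_add_cos_sq α

theorem arc_neck_sector (m σ θ α : ℝ) :
    arcX (m * Real.sin α) σ θ * Real.cos α + arcZ (-m * Real.cos α) σ θ * Real.sin α =
      σ * Real.sin (θ - α) := by
  rw [arcX, arcZ, Real.sin_sub]; ring

theorem arc_sphere_sq (k φ : ℝ) : arcX 0 k φ ^ 2 + arcZ 0 k φ ^ 2 = k ^ 2 := by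
  rw [arcX, arcZ]; linear_combination k ^ 2 * Real.sin_sq_add_cos_sq φ

/-! ### A shell bounded by two nearly complete concentric spheres -/

/-- The standard frame, whose axis is the `z`-axis. -/
noncomputable abbrev stdFrame : OrthonormalBasis (Fin 3) ℝ E3 := EuclideanSpace.basisFun (Fin 3) ℝ

/-- The common center of the spheres of the shell, at height `R` on the `z`-axis. -/
noncomputable def shellCenter (R : ℝ) : E3 := !₂[0, 0, R]

/-- The distance to the `z`-axis. -/
noncomputable def axisDist (p : E3) : ℝ := √(p 0 ^ 2 + p 1 ^ 2)

theorem cylPoint_std (R x z t : ℝ) :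
    cylPoint stdFrame (shellCenter R) x z t = !₂[x * Real.cos t, x * Real.sin t, R + z] := by
  ext i
  fin_cases i <;> simp [cylPoint, shellCenter, stdFrame]

theorem axisDist_cylPoint {R x z t : ℝ} (hx : 0 ≤ x) :
    axisDist (cylPoint stdFrame (shellCenter R) x z t) = x := by
  rw [cylPoint_std, axisDist]
  simp only [Matrix.cons_val_zero, Matrix.cons_val_one]
  have : (x * Real.cos t) ^ 2 + (x * Real.sin t) ^ 2 = x ^ 2 := by
    linear_combination x ^ 2 * Real.cos_sq_add_sin_sq t
  rw [this, Real.sqrt_sq hx]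

theorem exists_polar (a b : ℝ) : ∃ t ∈ Ico 0 (2 * Real.pi),
    a = √(a ^ 2 + b ^ 2) * Real.cos t ∧ b = √(a ^ 2 + b ^ 2) * Real.sin t := by
  have hper : Function.Periodic (fun t : ℝ => (Real.cos t, Real.sin t)) (2 * Real.pi) := fun t => by
    simp
  obtain ⟨t, ht, h⟩ := hper.exists_mem_Ico₀ (by positivity) (Complex.arg (Complex.mk a b))
  obtain ⟨hc, hs⟩ := Prod.mk.inj h
  have hn : √(a ^ 2 + b ^ 2) = ‖Complex.mk a b‖ := by
    rw [Complex.norm_def, Complex.normSq_apply]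
    congr 1
    ring
  refine ⟨t, ht, ?_⟩
  rw [hn, ← hc, ← hs, Complex.norm_mul_cos_arg, Complex.norm_mul_sin_arg]
  exact ⟨rfl, rfl⟩

theorem exists_eq_cylPoint (R : ℝ) (p : E3) : ∃ t ∈ Ico 0 (2 * Real.pi),
    p = cylPoint stdFrame (shellCenter R) (axisDist p) (p 2 - R) t := by
  obtain ⟨t, ht, hc, hs⟩ := exists_polar (p 0) (p 1)
  refine ⟨t, ht, ?_⟩
  rw [cylPoint_std, axisDist, ← hc, ← hs]
  ext i
  fin_cases i <;> simp

/-- In the meridian half-plane with coordinates `x ≥ 0` and `ζ`, the distance to the arc of radius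
`R - ρ` about the origin which runs from the negative `ζ`-axis through the angle `α`, minus `ρ`. -/
noncomputable def shellProfile (R ρ α x ζ : ℝ) : ℝ :=
  if x * Real.cos α + ζ * Real.sin α ≤ 0 then |√(x ^ 2 + ζ ^ 2) - (R - ρ)| - ρ
  else √((x * Real.sin α - ζ * Real.cos α - (R - ρ)) ^ 2 +
    (x * Real.cos α + ζ * Real.sin α) ^ 2) - ρ

/-- The function whose zero set is the boundary of the shell. -/
noncomputable def shellLevel (R ρ α : ℝ) (p : E3) : ℝ :=
  shellProfile R ρ α (axisDist p) (p 2 - R)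

/-- The boundary of the `ρ`-neighborhood of a spherical cap of radius `R - ρ` and opening
angle `α`. -/
def shellSurface (R ρ α : ℝ) : Set E3 := {p | shellLevel R ρ α p = 0}

theorem shellLevel_cylPoint {R ρ α x z t : ℝ} (hx : 0 ≤ x) :
    shellLevel R ρ α (cylPoint stdFrame (shellCenter R) x z t) = shellProfile R ρ α x z := by
  rw [shellLevel, axisDist_cylPoint hx, cylPoint_std]
  simp

theorem axisDist_nonneg (p : E3) : 0 ≤ axisDist p := Real.sqrt_nonneg _

theorem axisDist_sq (p : E3) : axisDist p ^ 2 = p 0 ^ 2 + p 1 ^ 2 := Real.sq_sqrt (by positivity)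

theorem continuous_axisDist : Continuous axisDist := by unfold axisDist; fun_prop

theorem norm_sub_shellCenter_sq (R : ℝ) (p : E3) :
    ‖p - shellCenter R‖ ^ 2 = axisDist p ^ 2 + (p 2 - R) ^ 2 := by
  rw [axisDist_sq, EuclideanSpace.norm_sq_eq, Fin.sum_univ_three]
  simp [shellCenter]

/-- The geometric constraints on the parameters of the shell: the half width `ρ` is positive, the
inner radius `R - 2 * ρ` is positive, and the hole around the upper pole is open. -/
structure IsShell (R ρ α : ℝ) : Prop where
  rho_pos : 0 < ρ
  lt : 2 * ρ < R
  alpha_gt : Real.pi / 2 < α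
  alpha_lt : α < Real.pi
  hole : ρ < (R - ρ) * Real.sin α

namespace IsShell

variable {R ρ α : ℝ}

theorem sin_pos (h : IsShell R ρ α) : 0 < Real.sin α :=
  Real.sin_pos_of_pos_of_lt_pi (by linarith [h.alpha_gt, Real.pi_pos]) h.alpha_lt

theorem cos_neg (h : IsShell R ρ α) : Real.cos α < 0 :=
  Real.cos_neg_of_pi_div_two_lt_of_lt h.alpha_gt (by linarith [h.alpha_lt, Real.pi_pos])

theorem continuous_shellLevel (h : IsShell R ρ α) : Continuous (shellLevel R ρ α) := by
  unfold shellLevel shellProfile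
  have hc := continuous_axisDist
  refine Continuous.if_le (by fun_prop) (by fun_prop) (by fun_prop) (by fun_prop) fun p hp => ?_
  have hs := h.sin_pos
  set x := axisDist p
  set ζ := p 2 - R
  rw [hp, zero_pow two_ne_zero, add_zero, Real.sqrt_sq_eq_abs]
  congr 3
  have hw : 0 ≤ x * Real.sin α - ζ * Real.cos α := by
    have h1 : (x * Real.sin α - ζ * Real.cos α) * Real.sin α = x := by
      linear_combination x * Real.sin_sq_add_cos_sq α - Real.cos α * hp
    by_contra hneg
    have : x < 0 := by rw [← h1]; exact mul_neg_of_neg_of_pos (not_le.1 hneg) hs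
    exact absurd this (not_lt.2 (axisDist_nonneg p))
  rw [← Real.sqrt_sq hw]
  congr 1
  linear_combination (-(x ^ 2) - ζ ^ 2) * Real.sin_sq_add_cos_sq α +
    (x * Real.cos α + ζ * Real.sin α) * hp

theorem abs_sqrt_sub_le (h : IsShell R ρ α) {x ζ : ℝ} (hF : shellProfile R ρ α x ζ ≤ 0) :
    |√(x ^ 2 + ζ ^ 2) - (R - ρ)| ≤ ρ := by
  unfold shellProfile at hF
  split_ifs at hF with hw
  · linarith
  · have h1 : √((x * Real.sin α - ζ * Real.cos α - (R - ρ)) ^ 2 +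
      (x * Real.cos α + ζ * Real.sin α) ^ 2) ≤ ρ := by linarith
    refine le_trans ?_ h1
    rw [← Real.sqrt_sq_eq_abs]
    refine Real.sqrt_le_sqrt ?_
    set r := √(x ^ 2 + ζ ^ 2) with hr
    have hr2 : r ^ 2 = x ^ 2 + ζ ^ 2 := Real.sq_sqrt (by positivity)
    have hw1 : x * Real.sin α - ζ * Real.cos α ≤ r := by
      refine Real.le_sqrt_of_sq_le ?_
      nlinarith [Real.sin_sq_add_cos_sq α, sq_nonneg (x * Real.cos α + ζ * Real.sin α)]
    have hm : 0 ≤ R - ρ := by linarith [h.rho_pos, h.lt]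
    have := mul_le_mul_of_nonneg_left hw1 hm
    nlinarith [Real.sin_sq_add_cos_sq α, sq_nonneg (x * Real.cos α + ζ * Real.sin α)]

theorem norm_sub_mem_Icc (h : IsShell R ρ α) {p : E3} (hp : shellLevel R ρ α p ≤ 0) :
    ‖p - shellCenter R‖ ∈ Icc (R - 2 * ρ) R := by
  have h1 := h.abs_sqrt_sub_le hp
  rw [← norm_sub_shellCenter_sq, Real.sqrt_sq (norm_nonneg _), abs_le] at h1
  exact ⟨by linarith, by linarith⟩

theorem mem_innerDomain (h : IsShell R ρ α) {p : E3} (hp : shellLevel R ρ α p < 0) :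
    p ∈ innerDomain (shellSurface R ρ α) := by
  refine mem_innerDomain_of_neg h.continuous_shellLevel (fun x => Iff.rfl) ?_ hp
  refine (Metric.isBounded_closedBall (x := shellCenter R) (r := R)).subset fun q hq => ?_
  rw [mem_closedBall_iff_norm]
  exact (h.norm_sub_mem_Icc (le_of_lt hq)).2

/-- The upper half of the axis passes through the hole. -/
theorem mem_outerDomain_axis (h : IsShell R ρ α) {z : ℝ} (hz : 0 ≤ z) (t : ℝ) :
    cylPoint stdFrame (shellCenter R) 0 z t ∈ outerDomain (shellSurface R ρ α) := by
  refine mem_outerDomain_of_ray (v := cylPoint stdFrame 0 0 1 t) ?_ fun τ hτ => ?_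
  · intro h0
    have := norm_cylPoint_sub_sq stdFrame 0 0 1 t
    simp [h0] at this
  · rw [cylPoint_add_smul, shellSurface, mem_ofPred_eq, shellLevel_cylPoint (by simp)]
    refine ne_of_gt ?_
    have hm : 0 < R - ρ := by linarith [h.rho_pos, h.lt]
    unfold shellProfile
    split_ifs with hw
    · have : z + τ * 1 ≤ 0 := by
        by_contra hpos
        have := mul_pos (not_le.1 hpos) h.sin_pos
        simp only [mul_zero, add_zero, zero_mul, zero_add] at hw
        linarith
      have hz0 : z + τ * 1 = 0 := le_antisymm this (by linarith)
      rw [hz0]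
      simp only [mul_zero, add_zero, ne_eq, OfNat.ofNat_ne_zero, not_false_eq_true, zero_pow,
        Real.sqrt_zero, zero_sub, abs_neg, abs_of_pos hm]
      linarith [h.lt]
    · rw [sub_pos]
      refine lt_of_lt_of_le h.hole (Real.le_sqrt_of_sq_le ?_)
      rw [← sub_nonneg]
      refine (sq_nonneg (z + τ * 1 + (R - ρ) * Real.cos α)).trans_eq ?_
      linear_combination ((R - ρ) ^ 2 - (z + τ * 1) ^ 2) * Real.sin_sq_add_cos_sq α

theorem mem_outerDomain (h : IsShell R ρ α) {p : E3} (hp : 0 < shellLevel R ρ α p) :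
    p ∈ outerDomain (shellSurface R ρ α) := by
  obtain ⟨t, -, hpt⟩ := exists_eq_cylPoint R p
  have hx := axisDist_nonneg p
  rw [shellLevel] at hp
  rw [hpt]
  set x := axisDist p
  set ζ := p 2 - R
  have hm : 0 < R - ρ := by linarith [h.rho_pos, h.lt]
  by_cases hw : x * Real.cos α + ζ * Real.sin α ≤ 0
  · have hval : ∀ s : ℝ, 0 ≤ s → shellProfile R ρ α (s * x) (s * ζ) =
        |s * √(x ^ 2 + ζ ^ 2) - (R - ρ)| - ρ := by
      intro s hs
      have h1 : s * x * Real.cos α + s * ζ * Real.sin α ≤ 0 := by nlinarith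
      rw [shellProfile, if_pos h1]
      congr 3
      have : (s * x) ^ 2 + (s * ζ) ^ 2 = s ^ 2 * (x ^ 2 + ζ ^ 2) := by ring
      rw [this, Real.sqrt_mul (sq_nonneg s), Real.sqrt_sq hs]
    have hr0 : 0 ≤ √(x ^ 2 + ζ ^ 2) := Real.sqrt_nonneg _
    rw [shellProfile, if_pos hw] at hp
    rcases lt_abs.1 (by linarith : ρ < |√(x ^ 2 + ζ ^ 2) - (R - ρ)|) with h1 | h1
    · refine mem_outerDomain_of_ray (v := cylPoint stdFrame 0 x ζ t) ?_ fun τ hτ => ?_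
      · intro h0
        have := norm_cylPoint_sub_sq stdFrame 0 x ζ t
        simp only [h0, sub_self, norm_zero, ne_eq, OfNat.ofNat_ne_zero, not_false_eq_true,
          zero_pow] at this
        rw [← this, Real.sqrt_zero] at h1
        linarith [h.rho_pos]
      · rw [cylPoint_add_smul, shellSurface, mem_ofPred_eq, shellLevel_cylPoint (by positivity)]
        have e1 : x + τ * x = (1 + τ) * x := by ring
        have e2 : ζ + τ * ζ = (1 + τ) * ζ := by ring
        rw [e1, e2, hval _ (by positivity)]
        refine ne_of_gt ?_
        have : ρ < (1 + τ) * √(x ^ 2 + ζ ^ 2) - (R - ρ) := by nlinarith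
        linarith [le_abs_self ((1 + τ) * √(x ^ 2 + ζ ^ 2) - (R - ρ))]
    · refine mem_outerDomain_of_segment (v := cylPoint stdFrame 0 (-x) (-ζ) t) (fun τ hτ => ?_) ?_
      · rw [cylPoint_add_smul, shellSurface, mem_ofPred_eq]
        have e1 : x + τ * -x = (1 - τ) * x := by ring
        have e2 : ζ + τ * -ζ = (1 - τ) * ζ := by ring
        have hτ' : 0 ≤ 1 - τ := by linarith [hτ.2]
        rw [e1, e2, shellLevel_cylPoint (by positivity), hval _ hτ']
        refine ne_of_gt ?_
        have : ρ < -((1 - τ) * √(x ^ 2 + ζ ^ 2) - (R - ρ)) := by nlinarith [hτ.1]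
        linarith [neg_le_abs ((1 - τ) * √(x ^ 2 + ζ ^ 2) - (R - ρ))]
      · have := h.mem_outerDomain_axis le_rfl t
        have e0 := cylPoint_add_smul stdFrame (shellCenter R) x ζ (-x) (-ζ) t 1
        rw [one_smul] at e0
        rw [e0]
        convert this using 2 <;> ring
  · have hw' : 0 < x * Real.cos α + ζ * Real.sin α := not_le.1 hw
    rw [shellProfile, if_neg hw] at hp
    -- move towards the axis, perpendicularly to the ray through the end of the arc
    have hc := h.cos_neg
    set κ : ℝ := x * Real.sin α / (-Real.cos α) with hκ
    have hκ0 : 0 ≤ κ := div_nonneg (mul_nonneg hx h.sin_pos.le) (by linarith)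
    have hκc : κ * Real.cos α = -(x * Real.sin α) := by
      rw [hκ]
      have : Real.cos α ≠ 0 := hc.ne
      field_simp
    refine mem_outerDomain_of_segment (v := cylPoint stdFrame 0 (-x) κ t) (fun τ hτ => ?_) ?_
    · have hx' : 0 ≤ x + τ * -x := by nlinarith [hτ.2]
      rw [cylPoint_add_smul, shellSurface, mem_ofPred_eq, shellLevel_cylPoint hx']
      have h2 : x * Real.cos α + ζ * Real.sin α ≤
          (x + τ * -x) * Real.cos α + (ζ + τ * κ) * Real.sin α := by
        have h3 : 0 ≤ τ * (κ * Real.sin α) := mul_nonneg hτ.1 (mul_nonneg hκ0 h.sin_pos.le)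
        have h4 : 0 ≤ τ * x * -Real.cos α :=
          mul_nonneg (mul_nonneg hτ.1 hx) (by linarith)
        nlinarith
      rw [shellProfile, if_neg (by linarith)]
      refine ne_of_gt (lt_of_lt_of_le hp ?_)
      have e1 : (x + τ * -x) * Real.sin α - (ζ + τ * κ) * Real.cos α =
          x * Real.sin α - ζ * Real.cos α := by linear_combination (-τ) * hκc
      rw [e1]
      gcongr
    · have e0 := cylPoint_add_smul stdFrame (shellCenter R) x ζ (-x) κ t 1
      rw [one_smul] at e0
      rw [e0]
      have h5 : 0 ≤ ζ + 1 * κ := by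
        have h6 : ζ * Real.sin α + κ * Real.sin α > 0 := by
          have : 0 ≤ κ * Real.sin α := mul_nonneg hκ0 h.sin_pos.le
          nlinarith [mul_nonneg hx (neg_nonneg.2 hc.le)]
        have : 0 < (ζ + κ) * Real.sin α := by linarith
        linarith [pos_of_mul_pos_left this h.sin_pos.le]
      have := h.mem_outerDomain_axis h5 t
      convert this using 2
      ring

end IsShell

/-! ### The boundary of the shell as a union of patches -/

theorem exists_angle_of_sq_add_sq {x ζ r : ℝ} (hr : 0 < r) (hx : 0 ≤ x)
    (h : x ^ 2 + ζ ^ 2 = r ^ 2) :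
    ∃ φ ∈ Icc 0 Real.pi, x = r * Real.sin φ ∧ ζ = -r * Real.cos φ := by
  refine ⟨Real.arccos (-ζ / r), ⟨Real.arccos_nonneg _, Real.arccos_le_pi _⟩, ?_, ?_⟩
  · rw [Real.sin_arccos]
    have : 1 - (-ζ / r) ^ 2 = (x / r) ^ 2 := by
      field_simp
      linarith
    rw [this, Real.sqrt_sq (by positivity)]
    field_simp
  · have habs : |ζ| ≤ r := abs_le_of_sq_le_sq (by nlinarith [sq_nonneg x]) hr.le
    rw [abs_le] at habs
    rw [Real.cos_arccos]
    · field_simp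
    · rw [le_div_iff₀ hr]; linarith
    · rw [div_le_iff₀ hr]; linarith

theorem fderiv_pos_of_hasDerivAt {G : E3 → ℝ} {p v : E3} {d : ℝ} (hG : DifferentiableAt ℝ G p)
    (h : HasDerivAt (fun τ : ℝ => G (p + τ • v)) d 0) (hd : 0 < d) : 0 < fderiv ℝ G p v := by
  have hline : HasDerivAt (fun τ : ℝ => p + τ • v) v 0 := by
    simpa using ((hasDerivAt_id (0 : ℝ)).smul_const v).const_add p
  have h1 := hG.hasFDerivAt.comp_hasDerivAt_of_eq (0 : ℝ) hline (by simp)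
  rwa [← h.unique h1]

/-- The spheres of the shell without their upper caps, as rotated circular arcs. -/
noncomputable def spherePatch (R k α : ℝ) : Set E3 :=
  revolutionPatch stdFrame (shellCenter R) (arcX 0 k) (arcZ 0 k) (Ioc 0 α)

/-- The neck that joins the two spheres of the shell, as a rotated half circle. -/
noncomputable def neckPatch (R ρ α : ℝ) : Set E3 :=
  revolutionPatch stdFrame (shellCenter R) (arcX ((R - ρ) * Real.sin α) ρ)
    (arcZ (-(R - ρ) * Real.cos α) ρ) (Ioo α (α + Real.pi))

/-- The lower poles of the two spheres. -/
noncomputable def shellPoles (R ρ : ℝ) : Set E3 :=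
  {cylPoint stdFrame (shellCenter R) 0 (-R) 0, cylPoint stdFrame (shellCenter R) 0 (-(R - 2 * ρ)) 0}

namespace IsShell

variable {R ρ α : ℝ}

theorem arcX_sphere_nonneg (h : IsShell R ρ α) {k φ : ℝ} (hk : 0 < k) (hφ : φ ∈ Icc 0 α) :
    0 ≤ arcX 0 k φ := by
  rw [arcX, zero_add]
  exact mul_nonneg hk.le (Real.sin_nonneg_of_nonneg_of_le_pi hφ.1 (hφ.2.trans h.alpha_lt.le))

theorem arcX_sphere_pos (h : IsShell R ρ α) {k φ : ℝ} (hk : 0 < k) (hφ : φ ∈ Ioc 0 α) :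
    0 < arcX 0 k φ := by
  rw [arcX, zero_add]
  exact mul_pos hk (Real.sin_pos_of_pos_of_lt_pi hφ.1 (hφ.2.trans_lt h.alpha_lt))

theorem arcX_neck_pos (h : IsShell R ρ α) (θ : ℝ) : 0 < arcX ((R - ρ) * Real.sin α) ρ θ := by
  rw [arcX]
  nlinarith [h.hole, Real.neg_one_le_sin θ, h.rho_pos]

theorem inner_pos (h : IsShell R ρ α) : 0 < R - 2 * ρ := by linarith [h.lt]

theorem pos (h : IsShell R ρ α) : 0 < R := by linarith [h.lt, h.rho_pos]

theorem shellProfile_sphere (h : IsShell R ρ α) {k φ : ℝ} (hk : 0 < k) (hφ : φ ∈ Icc 0 α) :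
    shellProfile R ρ α (arcX 0 k φ) (arcZ 0 k φ) = |k - (R - ρ)| - ρ := by
  have h1 : k * Real.sin (φ - α) ≤ 0 :=
    mul_nonpos_of_nonneg_of_nonpos hk.le (Real.sin_nonpos_of_nonpos_of_neg_pi_le
      (by linarith [hφ.2]) (by linarith [hφ.1, h.alpha_lt]))
  rw [shellProfile, arc_sphere_sector, if_pos h1]
  have h2 : arcX 0 k φ ^ 2 + arcZ 0 k φ ^ 2 = k ^ 2 := by
    rw [arcX, arcZ]; linear_combination k ^ 2 * Real.sin_sq_add_cos_sq φ
  rw [h2, Real.sqrt_sq hk.le]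

theorem shellProfile_neck {σ θ : ℝ} (hσ : 0 < σ) (hθ : θ ∈ Ioo α (α + Real.pi)) :
    shellProfile R ρ α (arcX ((R - ρ) * Real.sin α) σ θ) (arcZ (-(R - ρ) * Real.cos α) σ θ) =
      σ - ρ := by
  have h1 : 0 < σ * Real.sin (θ - α) :=
    mul_pos hσ (Real.sin_pos_of_pos_of_lt_pi (by linarith [hθ.1]) (by linarith [hθ.2]))
  rw [shellProfile, arc_neck_sector, if_neg (not_le.2 h1), arc_neck_fst]
  have h2 : (σ * Real.cos (θ - α)) ^ 2 + (σ * Real.sin (θ - α)) ^ 2 = σ ^ 2 := by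
    linear_combination σ ^ 2 * Real.sin_sq_add_cos_sq (θ - α)
  rw [h2, Real.sqrt_sq hσ.le]

/-- The zero set of the profile in a meridian half plane consists of the outer arc, the inner arc
and the half circle that joins their ends. -/
theorem shellProfile_eq_zero_iff (h : IsShell R ρ α) {x ζ : ℝ} (hx : 0 ≤ x) :
    shellProfile R ρ α x ζ = 0 ↔
      (∃ φ ∈ Icc 0 α, x = arcX 0 R φ ∧ ζ = arcZ 0 R φ) ∨
      (∃ φ ∈ Icc 0 α, x = arcX 0 (R - 2 * ρ) φ ∧ ζ = arcZ 0 (R - 2 * ρ) φ) ∨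
      ∃ θ ∈ Ioo α (α + Real.pi), x = arcX ((R - ρ) * Real.sin α) ρ θ ∧
        ζ = arcZ (-(R - ρ) * Real.cos α) ρ θ := by
  have hρ := h.rho_pos
  constructor
  · intro h0
    by_cases hw : x * Real.cos α + ζ * Real.sin α ≤ 0
    · rw [shellProfile, if_pos hw] at h0
      have key : ∀ k, 0 < k → √(x ^ 2 + ζ ^ 2) = k →
          ∃ φ ∈ Icc 0 α, x = arcX 0 k φ ∧ ζ = arcZ 0 k φ := by
        intro k hk hr
        have hk2 : x ^ 2 + ζ ^ 2 = k ^ 2 := by rw [← hr, Real.sq_sqrt (by positivity)]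
        obtain ⟨φ, hφ, hxφ, hζφ⟩ := exists_angle_of_sq_add_sq hk hx hk2
        have e1 : x = arcX 0 k φ := by rw [arcX, hxφ]; ring
        have e2 : ζ = arcZ 0 k φ := by rw [arcZ, hζφ]; ring
        refine ⟨φ, ⟨hφ.1, ?_⟩, e1, e2⟩
        by_contra hlt
        rw [e1, e2, arc_sphere_sector] at hw
        have : 0 < Real.sin (φ - α) := Real.sin_pos_of_pos_of_lt_pi (by linarith [not_le.1 hlt])
          (by linarith [hφ.2, h.alpha_gt, Real.pi_pos])
        nlinarith
      rcases (abs_eq hρ.le).1 (by linarith : |√(x ^ 2 + ζ ^ 2) - (R - ρ)| = ρ) with h1 | h1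
      · exact Or.inl (key R h.pos (by linarith))
      · exact Or.inr (Or.inl (key (R - 2 * ρ) h.inner_pos (by linarith)))
    · rw [shellProfile, if_neg hw] at h0
      set A := x * Real.sin α - ζ * Real.cos α - (R - ρ) with hA
      set B := x * Real.cos α + ζ * Real.sin α with hB
      have hB0 : 0 < B := not_le.1 hw
      have h1 : A ^ 2 + B ^ 2 = ρ ^ 2 := by
        have : √(A ^ 2 + B ^ 2) = ρ := by linarith
        rw [← this, Real.sq_sqrt (by positivity)]
      obtain ⟨ψ, hψ, hBψ, hAψ⟩ := exists_angle_of_sq_add_sq hρ hB0.le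
        (by linarith : B ^ 2 + (-A) ^ 2 = ρ ^ 2)
      have hAψ' : A = ρ * Real.cos ψ := by linarith
      have hs : Real.sin ψ ≠ 0 := fun hs0 => by rw [hs0] at hBψ; linarith
      have hψ0 : ψ ≠ 0 := fun h0 => hs (by rw [h0, Real.sin_zero])
      have hψ1 : ψ ≠ Real.pi := fun h0 => hs (by rw [h0, Real.sin_pi])
      have hψ' : 0 < ψ ∧ ψ < Real.pi := ⟨lt_of_le_of_ne hψ.1 hψ0.symm, lt_of_le_of_ne hψ.2 hψ1⟩
      refine Or.inr (Or.inr ⟨α + ψ, ⟨by linarith, by linarith⟩, ?_, ?_⟩)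
      · rw [arcX, Real.sin_add]
        linear_combination Real.sin α * hAψ' + Real.cos α * hBψ + (-Real.sin α) * hA -
          Real.cos α * hB - x * Real.sin_sq_add_cos_sq α
      · rw [arcZ, Real.cos_add]
        linear_combination (-Real.cos α) * hAψ' + Real.sin α * hBψ + Real.cos α * hA -
          Real.sin α * hB - ζ * Real.sin_sq_add_cos_sq α
  · rintro (⟨φ, hφ, rfl, rfl⟩ | ⟨φ, hφ, rfl, rfl⟩ | ⟨θ, hθ, rfl, rfl⟩)
    · rw [h.shellProfile_sphere h.pos hφ, sub_sub_cancel, abs_of_pos hρ, sub_self]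
    · rw [h.shellProfile_sphere h.inner_pos hφ]
      have : R - 2 * ρ - (R - ρ) = -ρ := by ring
      rw [this, abs_neg, abs_of_pos hρ, sub_self]
    · rw [shellProfile_neck hρ hθ, sub_self]

theorem mem_shellSurface_cylPoint {x ζ t : ℝ} (hx : 0 ≤ x) :
    cylPoint stdFrame (shellCenter R) x ζ t ∈ shellSurface R ρ α ↔ shellProfile R ρ α x ζ = 0 := by
  rw [shellSurface, mem_ofPred_eq, shellLevel_cylPoint hx]

theorem shellSurface_eq (h : IsShell R ρ α) : shellSurface R ρ α =
    shellPoles R ρ ∪ (spherePatch R R α ∪ (spherePatch R (R - 2 * ρ) α ∪ neckPatch R ρ α)) := by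
  have hα : 0 < α := by linarith [h.alpha_gt, Real.pi_pos]
  have hIcc : ∀ φ ∈ Icc 0 α, φ = 0 ∨ φ ∈ Ioc 0 α := fun φ hφ => by
    rcases hφ.1.eq_or_lt with h0 | h0
    · exact Or.inl h0.symm
    · exact Or.inr ⟨h0, hφ.2⟩
  ext p
  constructor
  · intro hp
    obtain ⟨t, ht, hpt⟩ := exists_eq_cylPoint R p
    have hp0 : shellProfile R ρ α (axisDist p) (p 2 - R) = 0 := hp
    rcases (h.shellProfile_eq_zero_iff (axisDist_nonneg p)).1 hp0 with
      ⟨φ, hφ, hx, hz⟩ | ⟨φ, hφ, hx, hz⟩ | ⟨φ, hφ, hx, hz⟩ <;> rw [hx, hz] at hpt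
    · rcases hIcc φ hφ with rfl | hφ'
      · refine Or.inl (Or.inl ?_)
        rw [hpt, arcX, arcZ, Real.sin_zero, Real.cos_zero, mul_zero, mul_one, zero_add, zero_sub,
          cylPoint_zero_left _ _ _ t 0]
      · exact Or.inr (Or.inl ⟨φ, hφ', t, ht, hpt⟩)
    · rcases hIcc φ hφ with rfl | hφ'
      · refine Or.inl (Or.inr ?_)
        rw [hpt, arcX, arcZ, Real.sin_zero, Real.cos_zero, mul_zero, mul_one, zero_add, zero_sub,
          cylPoint_zero_left _ _ _ t 0]
        rfl
      · exact Or.inr (Or.inr (Or.inl ⟨φ, hφ', t, ht, hpt⟩))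
    · exact Or.inr (Or.inr (Or.inr ⟨φ, hφ, t, ht, hpt⟩))
  · have h0 : (0 : ℝ) ∈ Icc 0 α := ⟨le_rfl, hα.le⟩
    have key : ∀ k, 0 < k → cylPoint stdFrame (shellCenter R) 0 (-k) 0 =
        cylPoint stdFrame (shellCenter R) (arcX 0 k 0) (arcZ 0 k 0) 0 := fun k hk => by
      simp [arcX, arcZ]
    rintro ((hp | hp) | ⟨φ, hφ, t, ht, rfl⟩ | ⟨φ, hφ, t, ht, rfl⟩ | ⟨φ, hφ, t, ht, rfl⟩)
    · rw [hp, key R h.pos, mem_shellSurface_cylPoint (h.arcX_sphere_nonneg h.pos h0),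
        h.shellProfile_eq_zero_iff (h.arcX_sphere_nonneg h.pos h0)]
      exact Or.inl ⟨0, h0, rfl, rfl⟩
    · rw [mem_singleton_iff.1 hp, key _ h.inner_pos,
        mem_shellSurface_cylPoint (h.arcX_sphere_nonneg h.inner_pos h0),
        h.shellProfile_eq_zero_iff (h.arcX_sphere_nonneg h.inner_pos h0)]
      exact Or.inr (Or.inl ⟨0, h0, rfl, rfl⟩)
    · rw [mem_shellSurface_cylPoint (h.arcX_sphere_pos h.pos hφ).le,
        h.shellProfile_eq_zero_iff (h.arcX_sphere_pos h.pos hφ).le]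
      exact Or.inl ⟨φ, Ioc_subset_Icc_self hφ, rfl, rfl⟩
    · rw [mem_shellSurface_cylPoint (h.arcX_sphere_pos h.inner_pos hφ).le,
        h.shellProfile_eq_zero_iff (h.arcX_sphere_pos h.inner_pos hφ).le]
      exact Or.inr (Or.inl ⟨φ, Ioc_subset_Icc_self hφ, rfl, rfl⟩)
    · rw [mem_shellSurface_cylPoint (h.arcX_neck_pos φ).le,
        h.shellProfile_eq_zero_iff (h.arcX_neck_pos φ).le]
      exact Or.inr (Or.inr ⟨φ, hφ, rfl, rfl⟩)

/-! ### The outer normal -/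

/-- If the level function is a difference `a - b` of nonnegative functions near a point, then
`a ^ 2 - b ^ 2` may serve as a local defining function. -/
theorem isRegularLevelSetAt (h : IsShell R ρ α) {G : E3 → ℝ} {p v : E3}
    (hp : p ∈ shellSurface R ρ α) (hG : ContDiffAt ℝ 2 G p) (hv : 0 < fderiv ℝ G p v)
    (hsign : ∀ᶠ q in 𝓝 p, ∃ a b : ℝ, 0 ≤ a ∧ 0 ≤ b ∧ G q = a ^ 2 - b ^ 2 ∧
      shellLevel R ρ α q = a - b) : IsRegularLevelSetAt (shellSurface R ρ α) G p where
  mem := hp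
  contDiffAt := hG
  fderiv_ne_zero h0 := by simp [h0] at hv
  outer := by
    filter_upwards [hsign] with q ⟨a, b, ha, hb, hGq, hF⟩ hpos
    refine h.mem_outerDomain ?_
    rw [hGq, sub_pos, sq_lt_sq₀ hb ha] at hpos
    rw [hF]; linarith
  inner := by
    filter_upwards [hsign] with q ⟨a, b, ha, hb, hGq, hF⟩ hneg
    refine h.mem_innerDomain ?_
    rw [hGq, sub_neg, sq_lt_sq₀ ha hb] at hneg
    rw [hF]; linarith
  zero := by
    filter_upwards [hsign] with q ⟨a, b, ha, hb, hGq, hF⟩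
    rw [hGq, sub_eq_zero, sq_eq_sq₀ ha hb, shellSurface, mem_ofPred_eq, hF, sub_eq_zero]

/-- The sign `ε` tells the outer sphere from the inner one.  The outer normal of the shell points
towards the common center on the latter. -/
theorem isRegularLevelSetAt_sphere (h : IsShell R ρ α) {k ε φ : ℝ} (hk : 0 < k)
    (hεk : ε = 1 ∧ k = R ∨ ε = -1 ∧ k = R - 2 * ρ) (hφ : φ ∈ Ioo 0 α) (t : ℝ) :
    ∃ G v, IsRegularLevelSetAt (shellSurface R ρ α) G
        (cylPoint stdFrame (shellCenter R) (arcX 0 k φ) (arcZ 0 k φ) t) ∧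
      0 < fderiv ℝ G (cylPoint stdFrame (shellCenter R) (arcX 0 k φ) (arcZ 0 k φ) t) v ∧
      0 < ⟪cylPoint stdFrame 0 (ε * Real.sin φ) (-ε * Real.cos φ) t, v⟫ := by
  set p := cylPoint stdFrame (shellCenter R) (arcX 0 k φ) (arcZ 0 k φ) t with hp
  set n := cylPoint stdFrame 0 (ε * Real.sin φ) (-ε * Real.cos φ) t with hn
  have hε : ε ^ 2 = 1 := by rcases hεk with ⟨h1, -⟩ | ⟨h1, -⟩ <;> rw [h1] <;> norm_num
  have hcs := Real.sin_sq_add_cos_sq φ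
  have hx := h.arcX_sphere_nonneg hk (Ioo_subset_Icc_self hφ)
  set G : E3 → ℝ := fun q => ε * (‖q - shellCenter R‖ ^ 2 - k ^ 2) with hGdef
  have hG : ContDiff ℝ 2 G :=
    contDiff_const.mul (((contDiff_id.sub contDiff_const).norm_sq ℝ).sub contDiff_const)
  have hline : ∀ τ : ℝ, G (p + τ • n) = ε * ((k + ε * τ) ^ 2 - k ^ 2) := fun τ => by
    simp only [hGdef, hp, hn]
    rw [cylPoint_add_smul, norm_cylPoint_sub_sq, arcX, arcZ]
    congr 1
    linear_combination (k + ε * τ) ^ 2 * hcs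
  have hv : 0 < fderiv ℝ G p n := by
    refine fderiv_pos_of_hasDerivAt (d := 2 * k) (hG.contDiffAt.differentiableAt (by simp)) ?_
      (by positivity)
    simp_rw [hline]
    have h1 := ((((hasDerivAt_id (0 : ℝ)).const_mul ε).const_add k).pow 2).sub_const (k ^ 2)
      |>.const_mul ε
    refine h1.congr_deriv ?_
    simp
    linear_combination 2 * k * hε
  have hmem : p ∈ shellSurface R ρ α := by
    rw [hp, mem_shellSurface_cylPoint hx, h.shellProfile_eq_zero_iff hx]
    rcases hεk with ⟨-, rfl⟩ | ⟨-, rfl⟩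
    · exact Or.inl ⟨φ, Ioo_subset_Icc_self hφ, rfl, rfl⟩
    · exact Or.inr (Or.inl ⟨φ, Ioo_subset_Icc_self hφ, rfl, rfl⟩)
  refine ⟨G, n, h.isRegularLevelSetAt hmem hG.contDiffAt hv ?_, hv, ?_⟩
  · have hsec : ∀ᶠ q : E3 in 𝓝 p, axisDist q * Real.cos α + (q 2 - R) * Real.sin α < 0 := by
      have hc : Continuous fun q : E3 => axisDist q * Real.cos α + (q 2 - R) * Real.sin α := by
        have := continuous_axisDist
        fun_prop
      refine hc.continuousAt.eventually (gt_mem_nhds ?_)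
      beta_reduce
      have e1 : axisDist p = arcX 0 k φ := axisDist_cylPoint hx
      have e2 : p 2 - R = arcZ 0 k φ := by rw [hp, cylPoint_std]; simp
      rw [e1, e2, arc_sphere_sector]
      exact mul_neg_of_pos_of_neg hk (Real.sin_neg_of_neg_of_neg_pi_lt (by linarith [hφ.2])
        (by linarith [hφ.1, h.alpha_lt]))
    have hnorm : ‖p - shellCenter R‖ = k := by
      rw [← sq_eq_sq₀ (norm_nonneg _) hk.le, hp, norm_cylPoint_sub_sq, arcX, arcZ]
      linear_combination k ^ 2 * hcs
    have hside : ∀ᶠ q : E3 in 𝓝 p, 0 < ε * (‖q - shellCenter R‖ - (R - ρ)) := by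
      have hc : Continuous fun q : E3 => ε * (‖q - shellCenter R‖ - (R - ρ)) := by fun_prop
      refine hc.continuousAt.eventually (lt_mem_nhds ?_)
      beta_reduce
      rw [hnorm]
      have := h.rho_pos
      rcases hεk with ⟨rfl, rfl⟩ | ⟨rfl, rfl⟩ <;> linarith
    filter_upwards [hsec, hside] with q hq1 hq2
    have hF : shellLevel R ρ α q = |‖q - shellCenter R‖ - (R - ρ)| - ρ := by
      rw [shellLevel, shellProfile, if_pos hq1.le, ← norm_sub_shellCenter_sq,
        Real.sqrt_sq (norm_nonneg _)]
    rw [hF]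
    rcases hεk with ⟨rfl, rfl⟩ | ⟨rfl, rfl⟩
    · refine ⟨‖q - shellCenter k‖, k, norm_nonneg _, hk.le, by simp [hGdef], ?_⟩
      rw [abs_of_pos (by linarith)]
      ring
    · refine ⟨R - 2 * ρ, ‖q - shellCenter R‖, hk.le, norm_nonneg _, by simp [hGdef], ?_⟩
      rw [abs_of_neg (by linarith)]
      ring
  · rw [hn, inner_cylPoint_zero]
    have : ε * Real.sin φ * (ε * Real.sin φ) + -ε * Real.cos φ * (-ε * Real.cos φ) = 1 := by
      linear_combination ε ^ 2 * hcs + hε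
    rw [this]
    exact one_pos

theorem isRegularLevelSetAt_neck (h : IsShell R ρ α) {θ : ℝ} (hθ : θ ∈ Ioo α (α + Real.pi))
    (t : ℝ) :
    ∃ G v, IsRegularLevelSetAt (shellSurface R ρ α) G
        (cylPoint stdFrame (shellCenter R) (arcX ((R - ρ) * Real.sin α) ρ θ)
          (arcZ (-(R - ρ) * Real.cos α) ρ θ) t) ∧
      0 < fderiv ℝ G (cylPoint stdFrame (shellCenter R) (arcX ((R - ρ) * Real.sin α) ρ θ)
          (arcZ (-(R - ρ) * Real.cos α) ρ θ) t) v ∧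
      0 < ⟪cylPoint stdFrame 0 (1 * Real.sin θ) (-1 * Real.cos θ) t, v⟫ := by
  set p := cylPoint stdFrame (shellCenter R) (arcX ((R - ρ) * Real.sin α) ρ θ)
    (arcZ (-(R - ρ) * Real.cos α) ρ θ) t with hp
  set n := cylPoint stdFrame 0 (1 * Real.sin θ) (-1 * Real.cos θ) t with hn
  have hρ := h.rho_pos
  have hx := h.arcX_neck_pos θ
  have e1 : axisDist p = arcX ((R - ρ) * Real.sin α) ρ θ := axisDist_cylPoint hx.le
  have e2 : p 2 - R = arcZ (-(R - ρ) * Real.cos α) ρ θ := by rw [hp, cylPoint_std]; simp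
  set W : E3 → ℝ := fun q => (axisDist q * Real.sin α - (q 2 - R) * Real.cos α - (R - ρ)) ^ 2 +
    (axisDist q * Real.cos α + (q 2 - R) * Real.sin α) ^ 2 with hW
  set G : E3 → ℝ := fun q => W q - ρ ^ 2 with hGdef
  have hax : ContDiffAt ℝ 2 axisDist p := by
    have h0 : ContDiffAt ℝ 2 (fun q : E3 => q 0 ^ 2 + q 1 ^ 2) p := by fun_prop
    refine h0.sqrt ?_
    rw [← axisDist_sq, e1]
    positivity
  have hG : ContDiffAt ℝ 2 G p := by
    have h2 : ContDiffAt ℝ 2 (fun q : E3 => q 2) p := by fun_prop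
    simp only [hGdef, hW]
    fun_prop
  have hcyl : ∀ σ : ℝ, 0 ≤ arcX ((R - ρ) * Real.sin α) σ θ →
      G (cylPoint stdFrame (shellCenter R) (arcX ((R - ρ) * Real.sin α) σ θ)
        (arcZ (-(R - ρ) * Real.cos α) σ θ) t) = σ ^ 2 - ρ ^ 2 := by
    intro σ hσ
    have e2' : (cylPoint stdFrame (shellCenter R) (arcX ((R - ρ) * Real.sin α) σ θ)
        (arcZ (-(R - ρ) * Real.cos α) σ θ) t) 2 - R = arcZ (-(R - ρ) * Real.cos α) σ θ := by
      rw [cylPoint_std]; simp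
    simp only [hGdef, hW]
    rw [axisDist_cylPoint hσ, e2', arc_neck_fst, arc_neck_sector]
    linear_combination σ ^ 2 * Real.sin_sq_add_cos_sq (θ - α)
  have hline : ∀ᶠ τ : ℝ in 𝓝 0, G (p + τ • n) = (ρ + τ) ^ 2 - ρ ^ 2 := by
    have hc : Continuous fun τ : ℝ => arcX ((R - ρ) * Real.sin α) (ρ + τ) θ := by
      unfold arcX; fun_prop
    have hpos : ∀ᶠ τ : ℝ in 𝓝 0, 0 < arcX ((R - ρ) * Real.sin α) (ρ + τ) θ :=
      hc.continuousAt.eventually (lt_mem_nhds (by simpa using hx))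
    filter_upwards [hpos] with τ hτ
    rw [hp, hn, cylPoint_add_smul, ← hcyl _ hτ.le]
    simp only [arcX, arcZ]
    congr 2 <;> ring
  have hv : 0 < fderiv ℝ G p n := by
    refine fderiv_pos_of_hasDerivAt (d := 2 * ρ) (hG.differentiableAt (by simp)) ?_
      (by positivity)
    have h1 := (((hasDerivAt_id (0 : ℝ)).const_add ρ).pow 2).sub_const (ρ ^ 2)
    refine (h1.congr_of_eventuallyEq hline).congr_deriv ?_
    simp
  have hmem : p ∈ shellSurface R ρ α := by
    rw [hp, mem_shellSurface_cylPoint hx.le, h.shellProfile_eq_zero_iff hx.le]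
    exact Or.inr (Or.inr ⟨θ, hθ, rfl, rfl⟩)
  refine ⟨G, n, h.isRegularLevelSetAt hmem hG hv ?_, hv, ?_⟩
  · have hsec : ∀ᶠ q : E3 in 𝓝 p, 0 < axisDist q * Real.cos α + (q 2 - R) * Real.sin α := by
      have hc : Continuous fun q : E3 => axisDist q * Real.cos α + (q 2 - R) * Real.sin α := by
        have := continuous_axisDist
        fun_prop
      refine hc.continuousAt.eventually (lt_mem_nhds ?_)
      beta_reduce
      rw [e1, e2, arc_neck_sector]
      exact mul_pos hρ (Real.sin_pos_of_pos_of_lt_pi (by linarith [hθ.1]) (by linarith [hθ.2]))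
    filter_upwards [hsec] with q hq
    refine ⟨√(W q), ρ, Real.sqrt_nonneg _, hρ.le, ?_, ?_⟩
    · rw [Real.sq_sqrt (by positivity)]
    · rw [shellLevel, shellProfile, if_neg (not_le.2 hq)]
  · rw [hn, inner_cylPoint_zero]
    have : 1 * Real.sin θ * (1 * Real.sin θ) + -1 * Real.cos θ * (-1 * Real.cos θ) = 1 := by
      linear_combination Real.sin_sq_add_cos_sq θ
    rw [this]
    exact one_pos

/-! ### Integration over the boundary of the shell -/

theorem norm_sub_of_mem_spherePatch {k : ℝ} {p : E3} (hp : p ∈ spherePatch R k α) :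
    ‖p - shellCenter R‖ ^ 2 = k ^ 2 := by
  obtain ⟨φ, -, t, -, rfl⟩ := hp
  rw [norm_cylPoint_sub_sq, arcX, arcZ]
  linear_combination k ^ 2 * Real.sin_sq_add_cos_sq φ

theorem norm_sub_of_mem_neckPatch (h : IsShell R ρ α) {p : E3} (hp : p ∈ neckPatch R ρ α) :
    (R - 2 * ρ) ^ 2 < ‖p - shellCenter R‖ ^ 2 ∧ ‖p - shellCenter R‖ ^ 2 < R ^ 2 := by
  obtain ⟨θ, hθ, t, -, rfl⟩ := hp
  have hρ := h.rho_pos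
  have hm : 0 < R - ρ := by linarith [h.lt]
  have e : arcX ((R - ρ) * Real.sin α) ρ θ ^ 2 + arcZ (-(R - ρ) * Real.cos α) ρ θ ^ 2 =
      (R - ρ) ^ 2 + ρ ^ 2 + 2 * (R - ρ) * ρ * Real.cos (θ - α) := by
    rw [arcX, arcZ, Real.cos_sub]
    linear_combination (R - ρ) ^ 2 * Real.sin_sq_add_cos_sq α +
      ρ ^ 2 * Real.sin_sq_add_cos_sq θ
  have hc1 : Real.cos (θ - α) < 1 := by
    have := Real.strictAntiOn_cos (a := 0) (b := θ - α) ⟨le_rfl, Real.pi_pos.le⟩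
      ⟨by linarith [hθ.1], by linarith [hθ.2]⟩ (by linarith [hθ.1])
    rwa [Real.cos_zero] at this
  have hc2 : -1 < Real.cos (θ - α) := by
    have := Real.strictAntiOn_cos (a := θ - α) (b := Real.pi) 
      ⟨by linarith [hθ.1], by linarith [hθ.2]⟩ ⟨Real.pi_pos.le, le_rfl⟩ (by linarith [hθ.2])
    rwa [Real.cos_pi] at this
  have hmρ : 0 < (R - ρ) * ρ := mul_pos hm hρ
  rw [norm_cylPoint_sub_sq, e]
  constructor <;> nlinarith

theorem measurableSet_spherePatch (h : IsShell R ρ α) {k : ℝ} (hk : 0 < k) :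
    MeasurableSet (spherePatch R k α) :=
  measurableSet_arcPatch hk (by linarith [h.alpha_lt]) measurableSet_Ioc Ioc_subset_Icc_self
    fun _ hφ => h.arcX_sphere_pos hk hφ

theorem measurableSet_neckPatch (h : IsShell R ρ α) : MeasurableSet (neckPatch R ρ α) :=
  measurableSet_arcPatch h.rho_pos le_rfl measurableSet_Ioo Ioo_subset_Icc_self
    fun θ _ => h.arcX_neck_pos θ

theorem ae_eq_patches (h : IsShell R ρ α) : shellSurface R ρ α =ᵐ[μHE[2]]
    (spherePatch R R α ∪ (spherePatch R (R - 2 * ρ) α ∪ neckPatch R ρ α) : Set E3) := by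
  rw [h.shellSurface_eq]
  refine union_ae_eq_right_of_ae_eq_empty ?_
  rw [ae_eq_empty, shellPoles, insert_eq]
  exact measure_union_null (euclideanHausdorffMeasure_two_singleton _)
    (euclideanHausdorffMeasure_two_singleton _)

theorem disjoint_inner (h : IsShell R ρ α) :
    Disjoint (spherePatch R (R - 2 * ρ) α) (neckPatch R ρ α) := by
  rw [Set.disjoint_left]
  intro p h1 h2
  have := (h.norm_sub_of_mem_neckPatch h2).1
  rw [norm_sub_of_mem_spherePatch h1] at this
  exact lt_irrefl _ this

theorem disjoint_outer (h : IsShell R ρ α) :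
    Disjoint (spherePatch R R α) (spherePatch R (R - 2 * ρ) α ∪ neckPatch R ρ α) := by
  rw [Set.disjoint_left]
  rintro p h1 (h2 | h2)
  · have h3 := norm_sub_of_mem_spherePatch h2
    rw [norm_sub_of_mem_spherePatch h1, sq_eq_sq₀ h.pos.le h.inner_pos.le] at h3
    linarith [h.rho_pos]
  · have := (h.norm_sub_of_mem_neckPatch h2).2
    rw [norm_sub_of_mem_spherePatch h1] at this
    exact lt_irrefl _ this

theorem integral_shellSurface (h : IsShell R ρ α) {g : E3 → ℝ}
    (h1 : IntegrableOn g (spherePatch R R α) μHE[2])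
    (h2 : IntegrableOn g (spherePatch R (R - 2 * ρ) α) μHE[2])
    (h3 : IntegrableOn g (neckPatch R ρ α) μHE[2]) :
    IntegrableOn g (shellSurface R ρ α) μHE[2] ∧
      ∫ p in shellSurface R ρ α, g p ∂μHE[2] = ∫ p in spherePatch R R α, g p ∂μHE[2] +
        (∫ p in spherePatch R (R - 2 * ρ) α, g p ∂μHE[2] +
          ∫ p in neckPatch R ρ α, g p ∂μHE[2]) := by
  refine ⟨(integrableOn_congr_set_ae h.ae_eq_patches).2 (h1.union (h2.union h3)), ?_⟩
  rw [setIntegral_congr_set h.ae_eq_patches,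
    setIntegral_union h.disjoint_outer
      ((h.measurableSet_spherePatch h.inner_pos).union h.measurableSet_neckPatch) h1 (h2.union h3),
    setIntegral_union h.disjoint_inner h.measurableSet_neckPatch h2 h3]

theorem area_spherePatch (h : IsShell R ρ α) {k : ℝ} (hk : 0 < k) :
    μHE[2] (spherePatch R k α) = ENNReal.ofReal (2 * Real.pi * k ^ 2 * (1 - Real.cos α)) := by
  have hα : 0 ≤ α := by linarith [h.alpha_gt, Real.pi_pos]
  rw [spherePatch, measure_arcPatch hk hα (by linarith [h.alpha_lt]) measurableSet_Ioc
    Ioo_subset_Ioc_self Ioc_subset_Icc_self fun _ hφ => h.arcX_sphere_pos hk hφ]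
  congr 1
  rw [Real.cos_zero]
  ring

theorem area_neckPatch (h : IsShell R ρ α) :
    μHE[2] (neckPatch R ρ α) = ENNReal.ofReal
      (2 * Real.pi * ρ * ((R - ρ) * Real.sin α * Real.pi + 2 * ρ * Real.cos α)) := by
  rw [neckPatch, measure_arcPatch h.rho_pos (by linarith [Real.pi_pos]) le_rfl measurableSet_Ioo
    subset_rfl Ioo_subset_Icc_self fun θ _ => h.arcX_neck_pos θ]
  congr 1
  rw [Real.cos_add_pi]
  ring

theorem neck_area_nonneg (h : IsShell R ρ α) :
    0 ≤ 2 * Real.pi * ρ * ((R - ρ) * Real.sin α * Real.pi + 2 * ρ * Real.cos α) := by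
  have hρ := h.rho_pos
  have hpi := Real.pi_gt_three
  have : 0 ≤ (R - ρ) * Real.sin α * Real.pi + 2 * ρ * Real.cos α := by
    nlinarith [h.hole, Real.neg_one_le_cos α]
  positivity

theorem area_shellSurface (h : IsShell R ρ α) :
    area (shellSurface R ρ α) = ENNReal.ofReal
      (2 * Real.pi * (R ^ 2 + (R - 2 * ρ) ^ 2) * (1 - Real.cos α) +
        2 * Real.pi * ρ * ((R - ρ) * Real.sin α * Real.pi + 2 * ρ * Real.cos α)) := by
  have hc : 0 ≤ 1 - Real.cos α := by linarith [Real.cos_le_one α]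
  rw [area, measure_congr h.ae_eq_patches, measure_union h.disjoint_outer
    ((h.measurableSet_spherePatch h.inner_pos).union h.measurableSet_neckPatch),
    measure_union h.disjoint_inner h.measurableSet_neckPatch, h.area_spherePatch h.pos,
    h.area_spherePatch h.inner_pos, h.area_neckPatch,
    ← ENNReal.ofReal_add (by have := h.inner_pos; positivity) h.neck_area_nonneg,
    ← ENNReal.ofReal_add (by have := h.pos; positivity)
      (add_nonneg (by have := h.inner_pos; positivity) h.neck_area_nonneg)]
  congr 1
  ring

/-- The leading terms `2 π R (1 - cos α)` and `-2 π (R - 2 ρ) (1 - cos α)` of the two caps cancel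
up to order `ρ`. -/
theorem totalMeanCurvature_shellSurface (h : IsShell R ρ α) :
    IntegrableOn (meanCurvature (shellSurface R ρ α)) (shellSurface R ρ α) μHE[2] ∧
      totalMeanCurvature (shellSurface R ρ α) =
        4 * Real.pi * ρ + Real.pi ^ 2 * (R - ρ) * Real.sin α := by
  have hα : 0 ≤ α := by linarith [h.alpha_gt, Real.pi_pos]
  obtain ⟨a1, b1⟩ := integral_meanCurvature_arcPatch (e := stdFrame) (c := shellCenter R) (w := 0)
    (S := shellSurface R ρ α) (ε := 1) (by norm_num) h.pos hα (by linarith [h.alpha_lt])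
    measurableSet_Ioc Ioo_subset_Ioc_self Ioc_subset_Icc_self
    (fun _ hφ => h.arcX_sphere_pos h.pos hφ)
    (fun φ hφ t => h.isRegularLevelSetAt_sphere h.pos (Or.inl ⟨rfl, rfl⟩) hφ t)
  obtain ⟨a2, b2⟩ := integral_meanCurvature_arcPatch (e := stdFrame) (c := shellCenter R) (w := 0)
    (S := shellSurface R ρ α) (ε := -1) (by norm_num) h.inner_pos hα (by linarith [h.alpha_lt])
    measurableSet_Ioc Ioo_subset_Ioc_self Ioc_subset_Icc_self
    (fun _ hφ => h.arcX_sphere_pos h.inner_pos hφ)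
    (fun φ hφ t => h.isRegularLevelSetAt_sphere h.inner_pos (Or.inr ⟨rfl, rfl⟩) hφ t)
  obtain ⟨a3, b3⟩ := integral_meanCurvature_arcPatch (e := stdFrame) (c := shellCenter R)
    (S := shellSurface R ρ α) (ε := 1) (by norm_num) h.rho_pos (by linarith [Real.pi_pos]) le_rfl
    measurableSet_Ioo subset_rfl Ioo_subset_Icc_self
    (fun θ _ => h.arcX_neck_pos θ) (fun θ hθ t => h.isRegularLevelSetAt_neck hθ t)
  obtain ⟨a, b⟩ := h.integral_shellSurface a1 a2 a3
  refine ⟨a, ?_⟩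
  rw [totalMeanCurvature, b, spherePatch, spherePatch, neckPatch, b1, b2, b3, Real.cos_add_pi,
    Real.cos_zero]
  ring

end IsShell

/-! ### The generating curve of the shell -/

section

variable {R ρ α : ℝ}

theorem integral_cos_sin_of_affine {θ : ℝ → ℝ} {a s θ₀ κ : ℝ} (has : a ≤ s) (hκ : κ ≠ 0)
    (hθ : ∀ t ∈ Icc a s, θ t = θ₀ + κ * (t - a)) :
    ∫ t in a..s, Real.cos (θ t) = (Real.sin (θ s) - Real.sin θ₀) / κ ∧
      ∫ t in a..s, Real.sin (θ t) = (Real.cos θ₀ - Real.cos (θ s)) / κ := by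
  have hlin : ∀ t, HasDerivAt (fun t => θ₀ + κ * (t - a)) κ t := fun t => by
    simpa using (((hasDerivAt_id t).sub_const a).const_mul κ).const_add θ₀
  rw [hθ s ⟨has, le_rfl⟩]
  constructor
  · rw [intervalIntegral.integral_congr (g := fun t => Real.cos (θ₀ + κ * (t - a)))
      fun t ht => by rw [uIcc_of_le has] at ht; simp only [hθ t ht]]
    rw [intervalIntegral.integral_eq_sub_of_hasDerivAt
      (f := fun t => Real.sin (θ₀ + κ * (t - a)) / κ)
      (fun t _ => ((hlin t).sin.div_const κ).congr_deriv (by field_simp))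
      (Continuous.intervalIntegrable (by fun_prop) _ _)]
    simp [sub_div]
  · rw [intervalIntegral.integral_congr (g := fun t => Real.sin (θ₀ + κ * (t - a)))
      fun t ht => by rw [uIcc_of_le has] at ht; simp only [hθ t ht]]
    rw [intervalIntegral.integral_eq_sub_of_hasDerivAt
      (f := fun t => -Real.cos (θ₀ + κ * (t - a)) / κ)
      (fun t _ => (((hlin t).cos.neg).div_const κ).congr_deriv (by field_simp))
      (Continuous.intervalIntegrable (by fun_prop) _ _)]
    simp only [sub_self, mul_zero, add_zero]
    ring

/-- Length of the generating curve of the shell. -/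
noncomputable def shellLength (R ρ α : ℝ) : ℝ := R * α + ρ * Real.pi + (R - 2 * ρ) * α

/-- Tangent angle of the generating curve of the shell.  It increases with slope `R⁻¹` along the
outer arc and with slope `ρ⁻¹` along the neck, and decreases with slope `(R - 2 * ρ)⁻¹` along the
inner arc. -/
noncomputable def shellAngle (R ρ α s : ℝ) : ℝ :=
  R⁻¹ * min s (R * α) + ρ⁻¹ * (min (max s (R * α)) (R * α + ρ * Real.pi) - R * α) -
    (R - 2 * ρ)⁻¹ * (max s (R * α + ρ * Real.pi) - (R * α + ρ * Real.pi))

theorem continuous_shellAngle (R ρ α : ℝ) : Continuous (shellAngle R ρ α) := by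
  unfold shellAngle; fun_prop

theorem lipschitzWith_shellAngle (R ρ α : ℝ) : ∃ K : ℝ≥0, LipschitzWith K (shellAngle R ρ α) := by
  have h1 := (lipschitzWith_smul R⁻¹).comp (LipschitzWith.id.min_const (R * α))
  have h2 := (lipschitzWith_smul ρ⁻¹).comp
    (((LipschitzWith.id.max_const (R * α)).min_const (R * α + ρ * Real.pi)).sub
      (LipschitzWith.const (R * α)))
  have h3 := (lipschitzWith_smul (R - 2 * ρ)⁻¹).comp
    ((LipschitzWith.id.max_const (R * α + ρ * Real.pi)).sub
      (LipschitzWith.const (R * α + ρ * Real.pi)))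
  exact ⟨_, (h1.add h2).sub h3⟩

theorem profile_add {θ : ℝ → ℝ} (hθ : Continuous θ) (a s : ℝ) :
    profileX θ s = profileX θ a + ∫ t in a..s, Real.cos (θ t) ∧
      profileZ θ s = profileZ θ a + ∫ t in a..s, Real.sin (θ t) := by
  constructor
  · exact (intervalIntegral.integral_add_adjacent_intervals
      (Continuous.intervalIntegrable (by fun_prop) _ _)
      (Continuous.intervalIntegrable (by fun_prop) _ _)).symm
  · exact (intervalIntegral.integral_add_adjacent_intervals
      (Continuous.intervalIntegrable (by fun_prop) _ _)
      (Continuous.intervalIntegrable (by fun_prop) _ _)).symm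

namespace IsShell

theorem alpha_pos (h : IsShell R ρ α) : 0 < α := by linarith [h.alpha_gt, Real.pi_pos]

theorem shellAngle_outer (h : IsShell R ρ α) {φ : ℝ} (hφ : φ ≤ α) :
    shellAngle R ρ α (R * φ) = φ := by
  have hR := h.pos
  have h1 : R * φ ≤ R * α := by gcongr
  have h2 : 0 ≤ ρ * Real.pi := mul_nonneg h.rho_pos.le Real.pi_pos.le
  rw [shellAngle, min_eq_left h1, max_eq_right h1, min_eq_left (by linarith),
    max_eq_right (by linarith)]
  field_simp
  ring

theorem shellAngle_neck (h : IsShell R ρ α) {φ : ℝ} (hφ : φ ∈ Icc α (α + Real.pi)) :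
    shellAngle R ρ α (R * α + ρ * (φ - α)) = φ := by
  have hR := h.pos
  have hρ := h.rho_pos
  have h1 : 0 ≤ ρ * (φ - α) := mul_nonneg hρ.le (by linarith [hφ.1])
  have h2 : ρ * (φ - α) ≤ ρ * Real.pi := by gcongr; linarith [hφ.2]
  rw [shellAngle, min_eq_right (by linarith), max_eq_left (by linarith), min_eq_left (by linarith),
    max_eq_right (by linarith)]
  field_simp
  ring

theorem shellAngle_inner (h : IsShell R ρ α) {φ : ℝ} (hφ : φ ≤ α) :
    shellAngle R ρ α (R * α + ρ * Real.pi + (R - 2 * ρ) * (α - φ)) = φ + Real.pi := by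
  have hR := h.pos
  have hρ := h.rho_pos
  have hR' := h.inner_pos
  have h1 : 0 ≤ ρ * Real.pi := mul_nonneg hρ.le Real.pi_pos.le
  have h2 : 0 ≤ (R - 2 * ρ) * (α - φ) := mul_nonneg hR'.le (by linarith)
  rw [shellAngle, min_eq_right (by linarith), max_eq_left (by linarith), min_eq_right (by linarith),
    max_eq_left (by linarith), add_sub_cancel_left, add_sub_cancel_left,
    inv_mul_cancel_left₀ hR'.ne']
  field_simp
  ring

theorem profile_outer (h : IsShell R ρ α) {φ : ℝ} (hφ : φ ∈ Icc 0 α) :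
    profileX (shellAngle R ρ α) (R * φ) = arcX 0 R φ ∧
      profileZ (shellAngle R ρ α) (R * φ) = R + arcZ 0 R φ := by
  have hR := h.pos
  obtain ⟨h1, h2⟩ := integral_cos_sin_of_affine (θ := shellAngle R ρ α) (a := 0) (s := R * φ)
    (θ₀ := 0) (κ := R⁻¹) (mul_nonneg hR.le hφ.1) (by positivity) fun t ht => by
      have e : t = R * (R⁻¹ * t) := by field_simp
      rw [e, h.shellAngle_outer]
      · field_simp
        ring
      · rw [inv_mul_le_iff₀ hR]
        exact ht.2.trans (by gcongr; exact hφ.2)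
  rw [h.shellAngle_outer hφ.2] at h1 h2
  rw [profileX, profileZ, h1, h2, arcX, arcZ]
  simp only [Real.sin_zero, Real.cos_zero, div_inv_eq_mul]
  constructor <;> ring

theorem profile_neck (h : IsShell R ρ α) {φ : ℝ} (hφ : φ ∈ Icc α (α + Real.pi)) :
    profileX (shellAngle R ρ α) (R * α + ρ * (φ - α)) = arcX ((R - ρ) * Real.sin α) ρ φ ∧
      profileZ (shellAngle R ρ α) (R * α + ρ * (φ - α)) =
        R + arcZ (-(R - ρ) * Real.cos α) ρ φ := by
  have hρ := h.rho_pos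
  obtain ⟨h1, h2⟩ := integral_cos_sin_of_affine (θ := shellAngle R ρ α) (a := R * α)
    (s := R * α + ρ * (φ - α)) (θ₀ := α) (κ := ρ⁻¹)
    (by nlinarith [hφ.1]) (by positivity) fun t ht => by
      have e : t = R * α + ρ * ((α + ρ⁻¹ * (t - R * α)) - α) := by field_simp; ring
      conv_lhs => rw [e]
      rw [h.shellAngle_neck]
      have h3 : 0 ≤ ρ⁻¹ * (t - R * α) := mul_nonneg (by positivity) (by linarith [ht.1])
      refine ⟨by linarith, ?_⟩
      have h4 : ρ⁻¹ * (t - R * α) ≤ φ - α := by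
        rw [inv_mul_le_iff₀ hρ]
        linarith [ht.2]
      linarith [hφ.2]
  rw [h.shellAngle_neck hφ] at h1 h2
  obtain ⟨h3, h4⟩ := profile_add (continuous_shellAngle R ρ α) (R * α) (R * α + ρ * (φ - α))
  obtain ⟨h5, h6⟩ := h.profile_outer ⟨h.alpha_pos.le, le_refl α⟩
  rw [h3, h4, h1, h2, h5, h6]
  simp only [arcX, arcZ, div_inv_eq_mul]
  constructor <;> ring

theorem profile_inner (h : IsShell R ρ α) {φ : ℝ} (hφ : φ ≤ α) :
    profileX (shellAngle R ρ α) (R * α + ρ * Real.pi + (R - 2 * ρ) * (α - φ)) =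
        arcX 0 (R - 2 * ρ) φ ∧
      profileZ (shellAngle R ρ α) (R * α + ρ * Real.pi + (R - 2 * ρ) * (α - φ)) =
        R + arcZ 0 (R - 2 * ρ) φ := by
  have hR' := h.inner_pos
  have hπ := Real.pi_pos
  obtain ⟨h1, h2⟩ := integral_cos_sin_of_affine (θ := shellAngle R ρ α) (a := R * α + ρ * Real.pi)
    (s := R * α + ρ * Real.pi + (R - 2 * ρ) * (α - φ)) (θ₀ := α + Real.pi) (κ := -(R - 2 * ρ)⁻¹)
    (by nlinarith) (by simpa using hR'.ne') fun t ht => by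
      have e : t = R * α + ρ * Real.pi + (R - 2 * ρ) *
          (α - (α - (R - 2 * ρ)⁻¹ * (t - (R * α + ρ * Real.pi)))) := by
        rw [sub_sub_cancel, mul_inv_cancel_left₀ hR'.ne']; ring
      conv_lhs => rw [e]
      rw [h.shellAngle_inner]
      · ring
      · have h3 : 0 ≤ (R - 2 * ρ)⁻¹ * (t - (R * α + ρ * Real.pi)) :=
          mul_nonneg (by positivity) (by linarith [ht.1])
        linarith
  rw [h.shellAngle_inner hφ] at h1 h2
  obtain ⟨h3, h4⟩ := profile_add (continuous_shellAngle R ρ α) (R * α + ρ * Real.pi)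
    (R * α + ρ * Real.pi + (R - 2 * ρ) * (α - φ))
  obtain ⟨h5, h6⟩ := h.profile_neck (φ := α + Real.pi) ⟨by linarith, le_rfl⟩
  rw [add_sub_cancel_left] at h5 h6
  rw [h3, h4, h1, h2, h5, h6]
  simp only [arcX, arcZ, Real.sin_add_pi, Real.cos_add_pi, div_neg, div_inv_eq_mul]
  constructor <;> ring

/-- The parameter interval splits into the outer arc, the neck and the inner arc. -/
theorem exists_arc (h : IsShell R ρ α) {s : ℝ} (hs : s ∈ Icc 0 (shellLength R ρ α)) :
    (∃ φ ∈ Icc 0 α, s = R * φ) ∨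
    (∃ φ ∈ Icc 0 α, s = R * α + ρ * Real.pi + (R - 2 * ρ) * (α - φ)) ∨
    ∃ φ ∈ Ioo α (α + Real.pi), s = R * α + ρ * (φ - α) := by
  have hR := h.pos
  have hρ := h.rho_pos
  have hR' := h.inner_pos
  rw [shellLength] at hs
  rcases le_or_gt s (R * α) with h1 | h1
  · refine Or.inl ⟨R⁻¹ * s, ⟨mul_nonneg (by positivity) hs.1, ?_⟩, by field_simp⟩
    rwa [inv_mul_le_iff₀ hR]
  · rcases lt_or_ge s (R * α + ρ * Real.pi) with h2 | h2
    · refine Or.inr (Or.inr ⟨α + ρ⁻¹ * (s - R * α), ⟨?_, ?_⟩, by field_simp; ring⟩)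
      · have : 0 < ρ⁻¹ * (s - R * α) := mul_pos (by positivity) (by linarith)
        linarith
      · have : ρ⁻¹ * (s - R * α) < Real.pi := by
          rw [inv_mul_lt_iff₀ hρ]; linarith
        linarith
    · refine Or.inr (Or.inl ⟨α - (R - 2 * ρ)⁻¹ * (s - (R * α + ρ * Real.pi)), ⟨?_, ?_⟩,
        by rw [sub_sub_cancel, mul_inv_cancel_left₀ hR'.ne']; ring⟩)
      · have : (R - 2 * ρ)⁻¹ * (s - (R * α + ρ * Real.pi)) ≤ α := by
          rw [inv_mul_le_iff₀ hR']; linarith [hs.2]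
        linarith
      · have : 0 ≤ (R - 2 * ρ)⁻¹ * (s - (R * α + ρ * Real.pi)) :=
          mul_nonneg (by positivity) (by linarith)
        linarith

theorem arc_neck_sq (h : IsShell R ρ α) {θ : ℝ} (hθ : θ ∈ Ioo α (α + Real.pi)) :
    arcX ((R - ρ) * Real.sin α) ρ θ ^ 2 + arcZ (-(R - ρ) * Real.cos α) ρ θ ^ 2 ∈
      Ioo ((R - 2 * ρ) ^ 2) (R ^ 2) := by
  have h1 := h.norm_sub_of_mem_neckPatch
    (p := cylPoint stdFrame (shellCenter R) (arcX ((R - ρ) * Real.sin α) ρ θ)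
      (arcZ (-(R - ρ) * Real.cos α) ρ θ) 0) ⟨θ, hθ, 0, ⟨le_rfl, by positivity⟩, rfl⟩
  rwa [norm_cylPoint_sub_sq] at h1

theorem injOn_profile (h : IsShell R ρ α) :
    InjOn (fun s => (profileX (shellAngle R ρ α) s, profileZ (shellAngle R ρ α) s))
      (Icc 0 (shellLength R ρ α)) := by
  have hR := h.pos
  have hρ := h.rho_pos
  have hR' := h.inner_pos
  have hlt : (R - 2 * ρ) ^ 2 < R ^ 2 := by nlinarith
  have hα := h.alpha_lt
  have hsph : ∀ k > 0, ∀ φ ∈ Icc 0 α, ∀ ψ ∈ Icc 0 α, arcX 0 k φ = arcX 0 k ψ →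
      arcZ 0 k φ = arcZ 0 k ψ → φ = ψ := fun k hk φ hφ ψ hψ h1 h2 =>
    injOn_arc hk (by linarith) hφ hψ (Prod.ext h1 h2)
  intro s hs s' hs' heq
  obtain ⟨e1, e2⟩ := Prod.mk.inj heq
  rcases h.exists_arc hs with ⟨φ, hφ, rfl⟩ | ⟨φ, hφ, rfl⟩ | ⟨φ, hφ, rfl⟩ <;>
  rcases h.exists_arc hs' with ⟨ψ, hψ, rfl⟩ | ⟨ψ, hψ, rfl⟩ | ⟨ψ, hψ, rfl⟩
  · rw [(h.profile_outer hφ).1, (h.profile_outer hψ).1] at e1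
    rw [(h.profile_outer hφ).2, (h.profile_outer hψ).2, add_right_inj] at e2
    rw [hsph R hR φ hφ ψ hψ e1 e2]
  · rw [(h.profile_outer hφ).1, (h.profile_inner hψ.2).1] at e1
    rw [(h.profile_outer hφ).2, (h.profile_inner hψ.2).2, add_right_inj] at e2
    have := arc_sphere_sq R φ
    rw [e1, e2, arc_sphere_sq] at this
    linarith
  · rw [(h.profile_outer hφ).1, (h.profile_neck (Ioo_subset_Icc_self hψ)).1] at e1
    rw [(h.profile_outer hφ).2, (h.profile_neck (Ioo_subset_Icc_self hψ)).2, add_right_inj] at e2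
    have := (h.arc_neck_sq hψ).2
    rw [← e1, ← e2, arc_sphere_sq] at this
    linarith
  · rw [(h.profile_inner hφ.2).1, (h.profile_outer hψ).1] at e1
    rw [(h.profile_inner hφ.2).2, (h.profile_outer hψ).2, add_right_inj] at e2
    have := arc_sphere_sq R ψ
    rw [← e1, ← e2, arc_sphere_sq] at this
    linarith
  · rw [(h.profile_inner hφ.2).1, (h.profile_inner hψ.2).1] at e1
    rw [(h.profile_inner hφ.2).2, (h.profile_inner hψ.2).2, add_right_inj] at e2
    rw [hsph _ hR' φ hφ ψ hψ e1 e2]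
  · rw [(h.profile_inner hφ.2).1, (h.profile_neck (Ioo_subset_Icc_self hψ)).1] at e1
    rw [(h.profile_inner hφ.2).2, (h.profile_neck (Ioo_subset_Icc_self hψ)).2,
      add_right_inj] at e2
    have := (h.arc_neck_sq hψ).1
    rw [← e1, ← e2, arc_sphere_sq] at this
    linarith
  · rw [(h.profile_neck (Ioo_subset_Icc_self hφ)).1, (h.profile_outer hψ).1] at e1
    rw [(h.profile_neck (Ioo_subset_Icc_self hφ)).2, (h.profile_outer hψ).2, add_right_inj] at e2
    have := (h.arc_neck_sq hφ).2
    rw [e1, e2, arc_sphere_sq] at this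
    linarith
  · rw [(h.profile_neck (Ioo_subset_Icc_self hφ)).1, (h.profile_inner hψ.2).1] at e1
    rw [(h.profile_neck (Ioo_subset_Icc_self hφ)).2, (h.profile_inner hψ.2).2,
      add_right_inj] at e2
    have := (h.arc_neck_sq hφ).1
    rw [e1, e2, arc_sphere_sq] at this
    linarith
  · rw [(h.profile_neck (Ioo_subset_Icc_self hφ)).1,
      (h.profile_neck (Ioo_subset_Icc_self hψ)).1] at e1
    rw [(h.profile_neck (Ioo_subset_Icc_self hφ)).2,
      (h.profile_neck (Ioo_subset_Icc_self hψ)).2, add_right_inj] at e2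
    rw [injOn_arc hρ le_rfl (Ioo_subset_Icc_self hφ) (Ioo_subset_Icc_self hψ) (Prod.ext e1 e2)]

theorem profile_length (h : IsShell R ρ α) :
    profileX (shellAngle R ρ α) (shellLength R ρ α) = 0 ∧
      profileZ (shellAngle R ρ α) (shellLength R ρ α) = 2 * ρ := by
  have := h.profile_inner h.alpha_pos.le
  rw [sub_zero] at this
  rw [shellLength, this.1, this.2]
  simp [arcX, arcZ]

theorem isAdmissible (h : IsShell R ρ α) : IsAdmissible (shellLength R ρ α) (shellAngle R ρ α) where
  length_pos := by
    have := h.pos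
    have := h.rho_pos
    have := h.inner_pos
    have := h.alpha_pos
    have := Real.pi_pos
    unfold shellLength
    positivity
  lipschitz := (lipschitzWith_shellAngle R ρ α).imp fun K hK => hK.lipschitzOnWith
  angle_zero := by simpa using h.shellAngle_outer h.alpha_pos.le
  angle_length := by simpa [shellLength] using h.shellAngle_inner h.alpha_pos.le
  profileX_length := h.profile_length.1
  profileZ_length := by
    rw [h.profile_length.2]
    linarith [h.rho_pos]
  injOn := h.injOn_profile.mono Ioo_subset_Icc_self
  profileX_pos s hs := by
    rcases h.exists_arc (Ioo_subset_Icc_self hs) with ⟨φ, hφ, rfl⟩ | ⟨φ, hφ, rfl⟩ | ⟨φ, hφ, rfl⟩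
    · rw [(h.profile_outer hφ).1]
      exact h.arcX_sphere_pos h.pos ⟨pos_of_mul_pos_right hs.1 h.pos.le, hφ.2⟩
    · rw [(h.profile_inner hφ.2).1]
      refine h.arcX_sphere_pos h.inner_pos ⟨?_, hφ.2⟩
      have := hs.2
      rw [shellLength] at this
      nlinarith [h.inner_pos]
    · rw [(h.profile_neck (Ioo_subset_Icc_self hφ)).1]
      exact h.arcX_neck_pos φ

theorem shellSurface_eq_revolutionSurface (h : IsShell R ρ α) :
    shellSurface R ρ α = revolutionSurface (shellLength R ρ α) (shellAngle R ρ α) := by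
  have hR := h.pos
  have hρ := h.rho_pos
  have hR' := h.inner_pos
  have hα := h.alpha_pos
  have hπ := Real.pi_pos
  ext p
  constructor
  · intro hp
    obtain ⟨t, ht, hpt⟩ := exists_eq_cylPoint R p
    have hx := axisDist_nonneg p
    rw [hpt, mem_shellSurface_cylPoint hx, h.shellProfile_eq_zero_iff hx] at hp
    rw [cylPoint_std] at hpt
    rcases hp with ⟨φ, hφ, e1, e2⟩ | ⟨φ, hφ, e1, e2⟩ | ⟨φ, hφ, e1, e2⟩
    · refine ⟨R * φ, ⟨mul_nonneg hR.le hφ.1, ?_⟩, t, ht, ?_⟩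
      · have : R * φ ≤ R * α := by gcongr; exact hφ.2
        unfold shellLength
        nlinarith
      · rw [(h.profile_outer hφ).1, (h.profile_outer hφ).2, ← e1, ← e2]
        exact hpt
    · refine ⟨R * α + ρ * Real.pi + (R - 2 * ρ) * (α - φ), ⟨?_, ?_⟩, t, ht, ?_⟩
      · have : 0 ≤ (R - 2 * ρ) * (α - φ) := mul_nonneg hR'.le (by linarith [hφ.2])
        positivity
      · unfold shellLength
        gcongr
        linarith [hφ.1]
      · rw [(h.profile_inner hφ.2).1, (h.profile_inner hφ.2).2, ← e1, ← e2]
        exact hpt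
    · have hφ' := Ioo_subset_Icc_self hφ
      refine ⟨R * α + ρ * (φ - α), ⟨?_, ?_⟩, t, ht, ?_⟩
      · have : 0 ≤ ρ * (φ - α) := mul_nonneg hρ.le (by linarith [hφ.1])
        positivity
      · have : ρ * (φ - α) ≤ ρ * Real.pi := by gcongr; linarith [hφ.2]
        unfold shellLength
        nlinarith
      · rw [(h.profile_neck hφ').1, (h.profile_neck hφ').2, ← e1, ← e2]
        exact hpt
  · rintro ⟨s, hs, t, ht, rfl⟩
    rcases h.exists_arc hs with ⟨φ, hφ, rfl⟩ | ⟨φ, hφ, rfl⟩ | ⟨φ, hφ, rfl⟩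
    · rw [(h.profile_outer hφ).1, (h.profile_outer hφ).2, ← cylPoint_std,
        mem_shellSurface_cylPoint (h.arcX_sphere_nonneg hR hφ),
        h.shellProfile_eq_zero_iff (h.arcX_sphere_nonneg hR hφ)]
      exact Or.inl ⟨φ, hφ, rfl, rfl⟩
    · rw [(h.profile_inner hφ.2).1, (h.profile_inner hφ.2).2, ← cylPoint_std,
        mem_shellSurface_cylPoint (h.arcX_sphere_nonneg hR' hφ),
        h.shellProfile_eq_zero_iff (h.arcX_sphere_nonneg hR' hφ)]
      exact Or.inr (Or.inl ⟨φ, hφ, rfl, rfl⟩)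
    · rw [(h.profile_neck (Ioo_subset_Icc_self hφ)).1, (h.profile_neck (Ioo_subset_Icc_self hφ)).2,
        ← cylPoint_std, mem_shellSurface_cylPoint (h.arcX_neck_pos φ).le,
        h.shellProfile_eq_zero_iff (h.arcX_neck_pos φ).le]
      exact Or.inr (Or.inr ⟨φ, hφ, rfl, rfl⟩)

theorem mem_axisymmetricC11 (h : IsShell R ρ α) : shellSurface R ρ α ∈ AxisymmetricC11 :=
  ⟨_, _, h.isAdmissible, h.shellSurface_eq_revolutionSurface⟩

end IsShell

end

/-! ### Convergence to the double sphere -/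

section

variable {R ρ α : ℝ}

theorem sphere_ae_eq_patch {k : ℝ} (hk : 0 < k) (R : ℝ) :
    Metric.sphere (shellCenter R) k =ᵐ[μHE[2]]
      revolutionPatch stdFrame (shellCenter R) (arcX 0 k) (arcZ 0 k) (Ioo 0 Real.pi) := by
  have h : Metric.sphere (shellCenter R) k =
      {cylPoint stdFrame (shellCenter R) 0 (-k) 0, cylPoint stdFrame (shellCenter R) 0 k 0} ∪
      revolutionPatch stdFrame (shellCenter R) (arcX 0 k) (arcZ 0 k) (Ioo 0 Real.pi) := by
    ext p
    rw [mem_sphere_iff_norm, ← sq_eq_sq₀ (norm_nonneg _) hk.le]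
    constructor
    · intro hp
      obtain ⟨t, ht, hpt⟩ := exists_eq_cylPoint R p
      rw [norm_sub_shellCenter_sq] at hp
      obtain ⟨φ, hφ, e1, e2⟩ := exists_angle_of_sq_add_sq hk (axisDist_nonneg p) hp
      rw [hpt, e1, e2]
      rcases hφ.1.eq_or_lt with rfl | h0
      · left; left
        simpa using cylPoint_zero_left _ _ _ _ _
      rcases hφ.2.eq_or_lt with rfl | h1
      · left; right
        simpa using cylPoint_zero_left _ _ _ _ _
      · exact Or.inr ⟨φ, ⟨h0, h1⟩, t, ht, by simp [arcX, arcZ]⟩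
    · rintro ((rfl | rfl) | ⟨φ, -, t, -, rfl⟩)
      · rw [norm_cylPoint_sub_sq]; ring
      · rw [norm_cylPoint_sub_sq]; ring
      · rw [norm_cylPoint_sub_sq, arc_sphere_sq]
  rw [h]
  refine union_ae_eq_right_of_ae_eq_empty ?_
  rw [ae_eq_empty, insert_eq]
  exact measure_union_null (euclideanHausdorffMeasure_two_singleton _)
    (euclideanHausdorffMeasure_two_singleton _)

/-- The integral of `f` over a rotated circular arc, in coordinates. -/
noncomputable def arcIntegral (f : E3 → ℝ) (R u w k b : ℝ) : ℝ :=
  ∫ φ in (0 : ℝ)..b, ∫ t in (0 : ℝ)..(2 * Real.pi),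
    k * arcX u k φ * f (cylPoint stdFrame (shellCenter R) (arcX u k φ) (arcZ w k φ) t)

theorem continuous_arcIntegrand {X : Type*} [TopologicalSpace X] {f : E3 → ℝ} (hf : Continuous f)
    {R u w k φ t : X → ℝ} (hR : Continuous R) (hu : Continuous u) (hw : Continuous w)
    (hk : Continuous k) (hφ : Continuous φ) (ht : Continuous t) :
    Continuous fun x => k x * arcX (u x) (k x) (φ x) * f (cylPoint stdFrame (shellCenter (R x))
      (arcX (u x) (k x) (φ x)) (arcZ (w x) (k x) (φ x)) (t x)) := by
  simp_rw [cylPoint_std]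
  unfold arcX arcZ
  have : Continuous fun x : X => !₂[(u x + k x * Real.sin (φ x)) * Real.cos (t x),
      (u x + k x * Real.sin (φ x)) * Real.sin (t x), R x + (w x - k x * Real.cos (φ x))] := by
    refine (PiLp.continuous_toLp 2 _).comp (continuous_pi fun i => ?_)
    fin_cases i <;> simp <;> fun_prop
  exact (by fun_prop : Continuous fun x => k x * (u x + k x * Real.sin (φ x))).mul (hf.comp this)

theorem continuous_arcIntegral {X : Type*} [TopologicalSpace X] {f : E3 → ℝ} (hf : Continuous f)
    {R u w k b : X → ℝ} (hR : Continuous R) (hu : Continuous u) (hw : Continuous w)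
    (hk : Continuous k) (hb : Continuous b) :
    Continuous fun x => arcIntegral f (R x) (u x) (w x) (k x) (b x) := by
  unfold arcIntegral
  refine intervalIntegral.continuous_parametric_intervalIntegral_of_continuous
    (f := fun x φ => ∫ t in (0 : ℝ)..(2 * Real.pi), k x * arcX (u x) (k x) φ *
      f (cylPoint stdFrame (shellCenter (R x)) (arcX (u x) (k x) φ) (arcZ (w x) (k x) φ) t)) ?_ hb
  refine intervalIntegral.continuous_parametric_intervalIntegral_of_continuous'
    (X := X × ℝ) (f := fun y t => k y.1 * arcX (u y.1) (k y.1) y.2 *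
      f (cylPoint stdFrame (shellCenter (R y.1)) (arcX (u y.1) (k y.1) y.2)
        (arcZ (w y.1) (k y.1) y.2) t)) ?_ 0 (2 * Real.pi)
  exact continuous_arcIntegrand (X := (X × ℝ) × ℝ) hf (hR.comp (by fun_prop))
    (hu.comp (by fun_prop)) (hw.comp (by fun_prop)) (hk.comp (by fun_prop)) (by fun_prop)
    (by fun_prop)

theorem integral_arcPatch_continuous {f : E3 → ℝ} (hf : Continuous f) {R u w k a b : ℝ}
    {I : Set ℝ} (hk : 0 < k) (hab : a ≤ b) (hb : b ≤ a + Real.pi) (hI : MeasurableSet I)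
    (hI₁ : Ioo a b ⊆ I) (hI₂ : I ⊆ Icc a b) (hpos : ∀ φ ∈ I, 0 < arcX u k φ) :
    IntegrableOn f (revolutionPatch stdFrame (shellCenter R) (arcX u k) (arcZ w k) I) μHE[2] ∧
      ∫ p in revolutionPatch stdFrame (shellCenter R) (arcX u k) (arcZ w k) I, f p ∂μHE[2] =
        arcIntegral f R u w k b - arcIntegral f R u w k a := by
  have hc : Continuous (Function.uncurry fun φ t : ℝ => k * arcX u k φ *
      f (cylPoint stdFrame (shellCenter R) (arcX u k φ) (arcZ w k φ) t)) :=
    continuous_arcIntegrand (X := ℝ × ℝ) hf continuous_const continuous_const continuous_const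
      continuous_const continuous_fst continuous_snd
  have h := integral_arcPatch (e := stdFrame) (c := shellCenter R) (w := w) hk hab hb hI hI₁ hI₂
    hpos hc fun _ _ _ _ => rfl
  refine ⟨h.1, ?_⟩
  rw [h.2, arcIntegral, arcIntegral]
  have hc' : Continuous fun φ : ℝ => ∫ t in (0 : ℝ)..(2 * Real.pi), k * arcX u k φ *
      f (cylPoint stdFrame (shellCenter R) (arcX u k φ) (arcZ w k φ) t) :=
    intervalIntegral.continuous_parametric_intervalIntegral_of_continuous' hc _ _
  exact (intervalIntegral.integral_interval_sub_left (hc'.intervalIntegrable _ _)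
    (hc'.intervalIntegrable _ _)).symm

/-- The integral of `f` over the shell, in coordinates. -/
noncomputable def shellIntegral (f : E3 → ℝ) (R ρ α : ℝ) : ℝ :=
  arcIntegral f R 0 0 R α + (arcIntegral f R 0 0 (R - 2 * ρ) α +
    (arcIntegral f R ((R - ρ) * Real.sin α) (-(R - ρ) * Real.cos α) ρ (α + Real.pi) -
      arcIntegral f R ((R - ρ) * Real.sin α) (-(R - ρ) * Real.cos α) ρ α))

theorem arcIntegral_zero_right (f : E3 → ℝ) (R u w k : ℝ) : arcIntegral f R u w k 0 = 0 :=
  intervalIntegral.integral_same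

theorem arcIntegral_zero_radius (f : E3 → ℝ) (R u w b : ℝ) : arcIntegral f R u w 0 b = 0 := by
  simp [arcIntegral]

theorem continuous_shellIntegral {f : E3 → ℝ} (hf : Continuous f) :
    Continuous fun q : ℝ × ℝ × ℝ => shellIntegral f q.1 q.2.1 q.2.2 := by
  unfold shellIntegral
  refine (continuous_arcIntegral hf ?_ ?_ ?_ ?_ ?_).add
    ((continuous_arcIntegral hf ?_ ?_ ?_ ?_ ?_).add
    ((continuous_arcIntegral hf ?_ ?_ ?_ ?_ ?_).sub (continuous_arcIntegral hf ?_ ?_ ?_ ?_ ?_))) <;>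
  fun_prop

theorem integral_sphere_eq {f : E3 → ℝ} (hf : Continuous f) (hR : 0 < R) :
    ∫ p in Metric.sphere (shellCenter R) R, f p ∂μHE[2] = arcIntegral f R 0 0 R Real.pi := by
  rw [setIntegral_congr_set (sphere_ae_eq_patch hR R),
    (integral_arcPatch_continuous hf hR Real.pi_pos.le (by simp) measurableSet_Ioo subset_rfl
      Ioo_subset_Icc_self fun φ hφ => ?_).2, arcIntegral_zero_right, sub_zero]
  rw [arcX, zero_add]
  exact mul_pos hR (Real.sin_pos_of_mem_Ioo hφ)

/-- In the limit `ρ → 0`, `α → π` the neck has no area and both spheres are covered. -/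
theorem shellIntegral_limit {f : E3 → ℝ} (hf : Continuous f) (hR : 0 < R) :
    shellIntegral f R 0 Real.pi = 2 * ∫ p in Metric.sphere (shellCenter R) R, f p ∂μHE[2] := by
  rw [integral_sphere_eq hf hR, shellIntegral]
  simp only [arcIntegral_zero_radius, mul_zero, sub_zero]
  ring

theorem IsShell.integral_continuous (h : IsShell R ρ α) {f : E3 → ℝ} (hf : Continuous f) :
    ∫ p in shellSurface R ρ α, f p ∂μHE[2] = shellIntegral f R ρ α := by
  have hα := h.alpha_pos.le
  have hα' : α ≤ 0 + Real.pi := by linarith [h.alpha_lt]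
  have h1 := integral_arcPatch_continuous hf (R := R) (w := 0) h.pos hα hα' measurableSet_Ioc
    Ioo_subset_Ioc_self Ioc_subset_Icc_self fun φ hφ => h.arcX_sphere_pos h.pos hφ
  have h2 := integral_arcPatch_continuous hf (R := R) (w := 0) h.inner_pos hα hα' measurableSet_Ioc
    Ioo_subset_Ioc_self Ioc_subset_Icc_self fun φ hφ => h.arcX_sphere_pos h.inner_pos hφ
  have h3 := integral_arcPatch_continuous hf (R := R) (w := -(R - ρ) * Real.cos α) (a := α)
    h.rho_pos
    (by linarith [Real.pi_pos]) le_rfl measurableSet_Ioo subset_rfl Ioo_subset_Icc_self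
    fun φ _ => h.arcX_neck_pos φ
  rw [(h.integral_shellSurface h1.1 h2.1 h3.1).2, spherePatch, spherePatch, neckPatch,
    h1.2, h2.2, h3.2, shellIntegral]
  simp only [arcIntegral_zero_right, sub_zero]

theorem exists_mem_sphere_dist_le {c : E3} {r : ℝ} (hr : 0 ≤ r) (p : E3) :
    ∃ q ∈ Metric.sphere c r, dist p q ≤ |‖p - c‖ - r| := by
  by_cases hp : p = c
  · obtain ⟨q, hq⟩ := (NormedSpace.sphere_nonempty (x := c) (r := r)).2 hr
    refine ⟨q, hq, ?_⟩
    rw [hp, dist_comm, hq]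
    simp [abs_of_nonneg hr]
  · have h0 : 0 < ‖p - c‖ := norm_pos_iff.2 (sub_ne_zero.2 hp)
    refine ⟨c + (r / ‖p - c‖) • (p - c), ?_, ?_⟩
    · rw [mem_sphere_iff_norm, add_sub_cancel_left, norm_smul, Real.norm_of_nonneg (by positivity)]
      field_simp
    · have e : p - (c + (r / ‖p - c‖) • (p - c)) = ((‖p - c‖ - r) / ‖p - c‖) • (p - c) := by
        rw [sub_div, div_self h0.ne']
        module
      rw [dist_eq_norm, e, norm_smul, Real.norm_eq_abs, abs_div, abs_of_pos h0]
      field_simp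
      exact le_rfl

theorem dist_cylPoint_shellCenter_le (R R' x x' z z' t : ℝ) :
    dist (cylPoint stdFrame (shellCenter R) x z t) (cylPoint stdFrame (shellCenter R') x' z' t) ≤
      |x - x'| + |R + z - (R' + z')| := by
  rw [cylPoint_std, cylPoint_std, EuclideanSpace.dist_eq, Fin.sum_univ_three]
  refine Real.sqrt_le_iff.2 ⟨by positivity, ?_⟩
  simp only [Real.dist_eq, sq_abs, Matrix.cons_val_zero, Matrix.cons_val_one, Matrix.cons_val]
  have h1 := sq_abs (x - x')
  have h2 := sq_abs (R + z - (R' + z'))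
  have h3 : 0 ≤ |x - x'| * |R + z - (R' + z')| := by positivity
  have h4 := Real.cos_sq_add_sin_sq t
  have : (x * Real.cos t - x' * Real.cos t) ^ 2 + (x * Real.sin t - x' * Real.sin t) ^ 2 =
      (x - x') ^ 2 := by linear_combination (x - x') ^ 2 * h4
  nlinarith

theorem IsShell.hausdorffDist_le (h : IsShell R ρ α) {R₀ : ℝ} (hR₀ : 0 < R₀) :
    Metric.hausdorffDist (shellSurface R ρ α) (Metric.sphere (shellCenter R₀) R₀) ≤
      3 * |R - R₀| + 2 * ρ + 2 * R₀ * (Real.pi - α) := by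
  have hρ := h.rho_pos
  have hα := h.alpha_lt
  have habs := abs_nonneg (R - R₀)
  have hlast : 0 ≤ 2 * R₀ * (Real.pi - α) := by
    have : 0 < Real.pi - α := by linarith
    positivity
  refine Metric.hausdorffDist_le_of_mem_dist (by linarith) (fun p hp => ?_) fun q hq => ?_
  · obtain ⟨q, hq, hpq⟩ := exists_mem_sphere_dist_le (c := shellCenter R₀) hR₀.le p
    refine ⟨q, hq, hpq.trans ?_⟩
    obtain ⟨h1, h2⟩ := h.norm_sub_mem_Icc (p := p) (le_of_eq hp)
    have h3 : |‖p - shellCenter R₀‖ - ‖p - shellCenter R‖| ≤ |R - R₀| := by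
      refine (abs_norm_sub_norm_le _ _).trans ?_
      have : p - shellCenter R₀ - (p - shellCenter R) = shellCenter (R - R₀) := by
        ext i
        fin_cases i <;> simp [shellCenter]
      rw [this, EuclideanSpace.norm_eq, Fin.sum_univ_three]
      simp [shellCenter, Real.sqrt_sq_eq_abs]
    have h4 := abs_le.1 h3
    have h5 := abs_le.1 (le_refl |R - R₀|)
    rw [abs_le]
    constructor <;> linarith [h4.1, h4.2, h5.1, h5.2]
  · obtain ⟨t, ht, hqt⟩ := exists_eq_cylPoint R₀ q
    rw [mem_sphere_iff_norm, ← sq_eq_sq₀ (norm_nonneg _) hR₀.le, norm_sub_shellCenter_sq] at hq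
    obtain ⟨φ, hφ, e1, e2⟩ := exists_angle_of_sq_add_sq hR₀ (axisDist_nonneg q) hq
    have hψ : min φ α ∈ Icc 0 α := ⟨le_min hφ.1 h.alpha_pos.le, min_le_right _ _⟩
    refine ⟨cylPoint stdFrame (shellCenter R) (arcX 0 R (min φ α)) (arcZ 0 R (min φ α)) t, ?_, ?_⟩
    · have h0 := h.arcX_sphere_nonneg h.pos hψ
      rw [mem_shellSurface_cylPoint h0, h.shellProfile_eq_zero_iff h0]
      exact Or.inl ⟨_, hψ, rfl, rfl⟩
    · rw [hqt, e1, e2]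
      refine (dist_cylPoint_shellCenter_le _ _ _ _ _ _ _).trans ?_
      have h1 : |φ - min φ α| ≤ Real.pi - α := by
        rcases le_total φ α with h2 | h2
        · rw [min_eq_left h2, sub_self, abs_zero]; linarith
        · rw [min_eq_right h2, abs_of_nonneg (by linarith)]; linarith [hφ.2]
      have hs := (Real.abs_sin_sub_sin_le φ (min φ α)).trans h1
      have hc := (Real.abs_cos_sub_cos_le φ (min φ α)).trans h1
      have f1 : |R₀ * Real.sin φ - arcX 0 R (min φ α)| ≤ R₀ * (Real.pi - α) + |R - R₀| := by
        have : R₀ * Real.sin φ - arcX 0 R (min φ α) =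
            R₀ * (Real.sin φ - Real.sin (min φ α)) + -(R - R₀) * Real.sin (min φ α) := by
          rw [arcX]; ring
        rw [this]
        refine (abs_add_le _ _).trans ?_
        rw [abs_mul, abs_mul, abs_of_pos hR₀, abs_neg]
        gcongr
        exact mul_le_of_le_one_right habs (Real.abs_sin_le_one _)
      have f2 : |R₀ + -R₀ * Real.cos φ - (R + arcZ 0 R (min φ α))| ≤
          R₀ * (Real.pi - α) + (|R - R₀| + |R - R₀|) := by
        have : R₀ + -R₀ * Real.cos φ - (R + arcZ 0 R (min φ α)) =
            -R₀ * (Real.cos φ - Real.cos (min φ α)) +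
              ((R - R₀) * Real.cos (min φ α) + -(R - R₀)) := by
          rw [arcZ]; ring
        rw [this]
        refine (abs_add_le _ _).trans (add_le_add ?_ ((abs_add_le _ _).trans ?_))
        · rw [abs_mul, abs_neg, abs_of_pos hR₀]
          gcongr
        · rw [abs_mul, abs_neg]
          gcongr
          exact mul_le_of_le_one_right habs (Real.abs_cos_le_one _)
      linarith

/-- The integral of a continuous function over the shell is continuous in the parameters, down to
`ρ = 0` and `α = π`, where both caps have become full spheres and the neck contributes nothing. -/
theorem approachesDouble_shellSurface {R ρ α : ℕ → ℝ} {R₀ : ℝ} (hR₀ : 0 < R₀)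
    (h : ∀ n, IsShell (R n) (ρ n) (α n)) (hR : Tendsto R atTop (𝓝 R₀))
    (hρ : Tendsto ρ atTop (𝓝 0)) (hα : Tendsto α atTop (𝓝 Real.pi)) :
    ApproachesDouble (fun n => shellSurface (R n) (ρ n) (α n))
      (Metric.sphere (shellCenter R₀) R₀) := by
  refine ⟨?_, fun f hf => ?_⟩
  · refine squeeze_zero (fun n => Metric.hausdorffDist_nonneg)
      (fun n => (h n).hausdorffDist_le hR₀) ?_
    have : Tendsto (fun n => 3 * |R n - R₀| + 2 * ρ n + 2 * R₀ * (Real.pi - α n)) atTop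
        (𝓝 (3 * |R₀ - R₀| + 2 * 0 + 2 * R₀ * (Real.pi - Real.pi))) :=
      (((hR.sub_const R₀).abs.const_mul 3).add (hρ.const_mul 2)).add
        ((hα.const_sub Real.pi).const_mul (2 * R₀))
    simpa using this
  · simp_rw [fun n => (h n).integral_continuous hf]
    rw [← shellIntegral_limit hf hR₀]
    have hq : Tendsto (fun n => (R n, ρ n, α n)) atTop (𝓝 (R₀, 0, Real.pi)) :=
      hR.prodMk_nhds (hρ.prodMk_nhds hα)
    have hI := continuous_shellIntegral hf
    generalize hF : (fun q : ℝ × ℝ × ℝ => shellIntegral f q.1 q.2.1 q.2.2) = F at hI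
    have e : ∀ a b c, shellIntegral f a b c = F (a, b, c) := fun a b c => by rw [← hF]
    simp_rw [e]
    exact (hI.tendsto _).comp hq

/-- The area of the shell of outer radius `1` with opening angle `ε` and half width
`sin ε / 4`. -/
noncomputable def unitShellArea (ε : ℝ) : ℝ :=
  2 * Real.pi * (1 ^ 2 + (1 - 2 * (Real.sin ε / 4)) ^ 2) * (1 - Real.cos (Real.pi - ε)) +
    2 * Real.pi * (Real.sin ε / 4) * ((1 - Real.sin ε / 4) * Real.sin (Real.pi - ε) * Real.pi +
      2 * (Real.sin ε / 4) * Real.cos (Real.pi - ε))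

theorem isShell_of_opening {lam ε : ℝ} (hl : 0 < lam) (h0 : 0 < ε) (h1 : ε ≤ 1) :
    IsShell lam (lam * (Real.sin ε / 4)) (Real.pi - ε) := by
  have hs : 0 < Real.sin ε := Real.sin_pos_of_pos_of_le_one h0 h1
  have hs1 := Real.sin_le_one ε
  have hπ := Real.pi_gt_three
  have hls : 0 < lam * Real.sin ε := mul_pos hl hs
  refine ⟨by positivity, by nlinarith, by linarith, by linarith, ?_⟩
  rw [Real.sin_pi_sub]
  nlinarith

theorem unitShellArea_pos {ε : ℝ} (h0 : 0 < ε) (h1 : ε ≤ 1) : 0 < unitShellArea ε := by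
  have h := isShell_of_opening one_pos h0 h1
  have h2 := h.neck_area_nonneg
  rw [one_mul] at h2
  have h3 : 0 < 1 - Real.cos (Real.pi - ε) := by linarith [h.cos_neg]
  rw [unitShellArea]
  refine add_pos_of_pos_of_nonneg ?_ h2
  have := Real.pi_pos
  positivity

theorem exists_doubleSphere_sequence (A₀ : ℝ) (hA₀ : 0 < A₀) :
    ∃ T : ℕ → Set E3,
      (∀ n, T n ∈ AxisymmetricC11 ∧
        area (T n) = ENNReal.ofReal A₀ ∧
        IntegrableOn (meanCurvature (T n)) (T n) μHE[2]) ∧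
      (∃ c : E3, ApproachesDouble T (Metric.sphere c √(A₀ / (8 * Real.pi)))) ∧
      Tendsto (fun n => totalMeanCurvature (T n)) atTop (𝓝[>] 0) := by
  set ε : ℕ → ℝ := fun n => 1 / ((n : ℝ) + 1) with hε
  have hε0 : ∀ n, 0 < ε n := fun n => by positivity
  have hε1 : ∀ n, ε n ≤ 1 := fun n => by
    rw [hε]; simp only; rw [div_le_one (by positivity)]; linarith [(Nat.cast_nonneg n : (0:ℝ) ≤ n)]
  have hεlim : Tendsto ε atTop (𝓝 0) := tendsto_one_div_add_atTop_nhds_zero_nat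
  set lam : ℕ → ℝ := fun n => √(A₀ / unitShellArea (ε n)) with hlam
  have hlpos : ∀ n, 0 < lam n := fun n =>
    Real.sqrt_pos.2 (div_pos hA₀ (unitShellArea_pos (hε0 n) (hε1 n)))
  have hshell := fun n => isShell_of_opening (hlpos n) (hε0 n) (hε1 n)
  have hπ := Real.pi_pos
  have ha : unitShellArea 0 = 8 * Real.pi := by simp [unitShellArea]; ring
  have hac : Continuous unitShellArea := by unfold unitShellArea; fun_prop
  have hllim : Tendsto lam atTop (𝓝 √(A₀ / (8 * Real.pi))) := by
    have := (hac.tendsto 0).comp hεlim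
    rw [ha] at this
    exact (Real.continuous_sqrt.tendsto _).comp (tendsto_const_nhds.div this (by positivity))
  have hslim : Tendsto (fun n => Real.sin (ε n)) atTop (𝓝 0) := by
    simpa [Function.comp_def] using (Real.continuous_sin.tendsto 0).comp hεlim
  have hρlim : Tendsto (fun n => lam n * (Real.sin (ε n) / 4)) atTop (𝓝 0) := by
    simpa using hllim.mul (hslim.div_const 4)
  have hαlim : Tendsto (fun n => Real.pi - ε n) atTop (𝓝 Real.pi) := by
    simpa using hεlim.const_sub Real.pi
  refine ⟨fun n => shellSurface (lam n) (lam n * (Real.sin (ε n) / 4)) (Real.pi - ε n),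
    fun n => ⟨(hshell n).mem_axisymmetricC11, ?_, (hshell n).totalMeanCurvature_shellSurface.1⟩,
    ⟨_, approachesDouble_shellSurface (by positivity) hshell hllim hρlim hαlim⟩, ?_⟩
  · rw [(hshell n).area_shellSurface]
    congr 1
    have hl : lam n ^ 2 = A₀ / unitShellArea (ε n) :=
      Real.sq_sqrt (div_nonneg hA₀.le (unitShellArea_pos (hε0 n) (hε1 n)).le)
    have : lam n ^ 2 * unitShellArea (ε n) = A₀ := by
      rw [hl, div_mul_cancel₀ _ (unitShellArea_pos (hε0 n) (hε1 n)).ne']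
    rw [← this, unitShellArea]
    ring
  · rw [tendsto_nhdsWithin_iff]
    simp_rw [fun n => (hshell n).totalMeanCurvature_shellSurface.2, Real.sin_pi_sub]
    constructor
    · have := (hρlim.const_mul (4 * Real.pi)).add
        (((hllim.sub hρlim).const_mul (Real.pi ^ 2)).mul hslim)
      simpa using this
    · refine Eventually.of_forall fun n => ?_
      have h1 := (hshell n).rho_pos
      have h2 := (hshell n).lt
      have h3 := (hshell n).sin_pos
      rw [Real.sin_pi_sub] at h3
      have h4 : 0 < lam n - lam n * (Real.sin (ε n) / 4) := by linarith
      rw [mem_Ioi]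
      positivity

end

/-! ### Total mean curvature of a rotated graph -/

section GraphPatch

variable {e : OrthonormalBasis (Fin 3) ℝ E3} {c : E3} {x z : ℝ → ℝ} {δ : ℝ}

/-- The slope angle of the profile `(x, z)`, where `x` is increasing. -/
noncomputable def slopeAngle (x z : ℝ → ℝ) (φ : ℝ) : ℝ := Real.arctan (deriv z φ / deriv x φ)

/-- The derivative of the slope angle. -/
noncomputable def slopeRate (x z : ℝ → ℝ) (φ : ℝ) : ℝ :=
  (deriv (deriv z) φ * deriv x φ - deriv z φ * deriv (deriv x) φ) /
    (deriv x φ ^ 2 + deriv z φ ^ 2)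

theorem hasDerivAt_deriv_of_contDiff {f : ℝ → ℝ} (hf : ContDiff ℝ 2 f) (φ : ℝ) :
    HasDerivAt f (deriv f φ) φ ∧ HasDerivAt (deriv f) (deriv (deriv f) φ) φ ∧
      Continuous (deriv (deriv f)) ∧ Continuous (deriv f) := by
  have h1 : ContDiff ℝ 1 (deriv f) := hf.deriv' (n := 1)
  exact ⟨(hf.differentiable (by simp) φ).hasDerivAt, (h1.differentiable (by simp) φ).hasDerivAt,
    h1.continuous_deriv (by simp), h1.continuous⟩

theorem hasDerivAt_slopeAngle (hx : ContDiff ℝ 2 x) (hz : ContDiff ℝ 2 z) {φ : ℝ}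
    (hφ : 0 < deriv x φ) : HasDerivAt (slopeAngle x z) (slopeRate x z φ) φ := by
  have h := ((hasDerivAt_deriv_of_contDiff hz φ).2.1.div (hasDerivAt_deriv_of_contDiff hx φ).2.1
    hφ.ne').arctan
  refine h.congr_deriv ?_
  rw [slopeRate]
  have : deriv x φ ^ 2 + deriv z φ ^ 2 ≠ 0 := by positivity
  have h2 : 1 + (deriv z φ / deriv x φ) ^ 2 ≠ 0 := by positivity
  simp only [Pi.div_apply]
  field_simp

theorem sqrt_speed_mul_slopeAngle {φ : ℝ} (hφ : 0 < deriv x φ) :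
    √(deriv x φ ^ 2 + deriv z φ ^ 2) * Real.cos (slopeAngle x z φ) = deriv x φ ∧
      √(deriv x φ ^ 2 + deriv z φ ^ 2) * Real.sin (slopeAngle x z φ) = deriv z φ := by
  set w := √(deriv x φ ^ 2 + deriv z φ ^ 2) with hw
  have hw2 : w ^ 2 = deriv x φ ^ 2 + deriv z φ ^ 2 := Real.sq_sqrt (by positivity)
  have hwpos : 0 < w := Real.sqrt_pos.2 (by positivity)
  have hc : 0 < Real.cos (slopeAngle x z φ) := Real.cos_arctan_pos _
  have ht : Real.sin (slopeAngle x z φ) / Real.cos (slopeAngle x z φ) = deriv z φ / deriv x φ := by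
    rw [← Real.tan_eq_sin_div_cos, slopeAngle, Real.tan_arctan]
  have hs : Real.sin (slopeAngle x z φ) * deriv x φ = deriv z φ * Real.cos (slopeAngle x z φ) :=
    (div_eq_div_iff hc.ne' hφ.ne').1 ht
  have h1 : w * Real.cos (slopeAngle x z φ) = deriv x φ := by
    have hcs := Real.sin_sq_add_cos_sq (slopeAngle x z φ)
    rw [← sq_eq_sq₀ (by positivity) hφ.le, mul_pow, hw2]
    linear_combination deriv x φ ^ 2 * hcs -
      (Real.sin (slopeAngle x z φ) * deriv x φ + deriv z φ * Real.cos (slopeAngle x z φ)) * hs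
  refine ⟨h1, ?_⟩
  have : (w * Real.sin (slopeAngle x z φ) - deriv z φ) * Real.cos (slopeAngle x z φ) = 0 := by
    linear_combination Real.sin (slopeAngle x z φ) * h1 + hs
  linarith [(mul_eq_zero.1 this).resolve_right hc.ne']

theorem strictMonoOn_of_deriv (hx : ContDiff ℝ 2 x) (hx' : ∀ φ ∈ Icc 0 δ, 0 < deriv x φ) :
    StrictMonoOn x (Icc 0 δ) :=
  strictMonoOn_of_deriv_pos (convex_Icc 0 δ) hx.continuous.continuousOn fun φ hφ =>
    hx' φ (interior_subset hφ)

theorem pos_of_mem_Ioc (hx : ContDiff ℝ 2 x) (hx0 : x 0 = 0)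
    (hx' : ∀ φ ∈ Icc 0 δ, 0 < deriv x φ) {φ : ℝ} (hφ : φ ∈ Ioc 0 δ) : 0 < x φ := by
  rw [← hx0]
  exact strictMonoOn_of_deriv hx hx' ⟨le_rfl, hφ.1.le.trans hφ.2⟩ ⟨hφ.1.le, hφ.2⟩ hφ.1

theorem injOn_graph (hx : ContDiff ℝ 2 x) (hx' : ∀ φ ∈ Icc 0 δ, 0 < deriv x φ) :
    InjOn (fun φ => (x φ, z φ)) (Ioc 0 δ) := fun _ hφ _ hψ h =>
  (strictMonoOn_of_deriv hx hx').injOn (Ioc_subset_Icc_self hφ) (Ioc_subset_Icc_self hψ)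
    (Prod.mk.inj h).1

/-- The total mean curvature of a rotated graph over a disc, with the outer normal upwards, is
controlled by the height difference between center and rim, up to the radius of the disc.  In terms
of the slope angle `Θ`, one has `2 H dA = -(x Θ' + z') dφ dt`, and `x Θ'` is integrated by parts. -/
theorem integral_meanCurvature_graphPatch_le {S : Set E3} (hδ : 0 < δ) (hx : ContDiff ℝ 2 x)
    (hz : ContDiff ℝ 2 z) (hx0 : x 0 = 0) (hx' : ∀ φ ∈ Icc 0 δ, 0 < deriv x φ)
    (hreg : ∀ φ ∈ Ioo 0 δ, ∀ t, ∃ G v, IsRegularLevelSetAt S G (cylPoint e c (x φ) (z φ) t) ∧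
      0 < fderiv ℝ G (cylPoint e c (x φ) (z φ) t) v ∧
      0 < ⟪cylPoint e 0 (-deriv z φ) (deriv x φ) t, v⟫) :
    IntegrableOn (meanCurvature S) (revolutionPatch e c x z (Ioc 0 δ)) μHE[2] ∧
      ∫ p in revolutionPatch e c x z (Ioc 0 δ), meanCurvature S p ∂μHE[2] ≤
        -Real.pi * (z δ - z 0 - Real.pi * x δ) := by
  have hpos : ∀ φ ∈ Ioc 0 δ, 0 < x φ := fun φ hφ => pos_of_mem_Ioc hx hx0 hx' hφ
  have hx1 := fun φ => (hasDerivAt_deriv_of_contDiff hx φ).1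
  have hz1 := fun φ => (hasDerivAt_deriv_of_contDiff hz φ).1
  have hI : ∀ φ ∈ Ioo 0 δ, φ ∈ Icc 0 δ := fun φ hφ => Ioo_subset_Icc_self hφ
  have hspeed : ∀ φ ∈ Icc 0 δ, deriv x φ ^ 2 + deriv z φ ^ 2 ≠ 0 := fun φ hφ => by
    have := hx' φ hφ
    positivity
  have hH : ∀ φ ∈ Ioo 0 δ, ∀ t, x φ * √(deriv x φ ^ 2 + deriv z φ ^ 2) *
      meanCurvature S (cylPoint e c (x φ) (z φ) t) = -(x φ * slopeRate x z φ + deriv z φ) / 2 := by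
    intro φ hφ t
    rw [meanCurvature_of_isRegularLevelSetAt (P := fun φ => -Real.sin (slopeAngle x z φ))
      (Q := fun φ => Real.cos (slopeAngle x z φ))
      (P' := fun φ => -(Real.cos (slopeAngle x z φ) * slopeRate x z φ))
      (Q' := fun φ => -Real.sin (slopeAngle x z φ) * slopeRate x z φ) isOpen_Ioo
      (fun φ _ => hx1 φ) (fun φ _ => hz1 φ)
      (fun φ h => ((hasDerivAt_slopeAngle hx hz (hx' φ (hI φ h))).sin).neg)
      (fun φ h => (hasDerivAt_slopeAngle hx hz (hx' φ (hI φ h))).cos)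
      (fun φ h => (hpos φ (Ioo_subset_Ioc_self h)).ne') (fun φ h => hspeed φ (hI φ h))
      (fun φ _ => by linear_combination Real.sin_sq_add_cos_sq (slopeAngle x z φ))
      (fun φ h => ?_) (fun φ h t => ?_) hφ t]
    · have hw : 0 < √(deriv x φ ^ 2 + deriv z φ ^ 2) := by
        have := hx' φ (hI φ hφ)
        positivity
      have hw2 : √(deriv x φ ^ 2 + deriv z φ ^ 2) ^ 2 = deriv x φ ^ 2 + deriv z φ ^ 2 :=
        Real.sq_sqrt (by positivity)
      obtain ⟨h1, h2⟩ := sqrt_speed_mul_slopeAngle (z := z) (hx' φ (hI φ hφ))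
      have hcs := Real.sin_sq_add_cos_sq (slopeAngle x z φ)
      have hp := hpos φ (Ioo_subset_Ioc_self hφ)
      generalize √(deriv x φ ^ 2 + deriv z φ ^ 2) = w at *
      rw [← hw2, ← h1, ← h2]
      field_simp
      linear_combination (-(slopeRate x z φ) * x φ) * hcs
    · obtain ⟨h1, h2⟩ := sqrt_speed_mul_slopeAngle (z := z) (hx' φ (hI φ h))
      linear_combination Real.sin (slopeAngle x z φ) * h1 - Real.cos (slopeAngle x z φ) * h2
    · obtain ⟨G, v, hG, h1, h2⟩ := hreg φ h t
      refine ⟨G, v, hG, h1, ?_⟩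
      obtain ⟨h3, h4⟩ := sqrt_speed_mul_slopeAngle (z := z) (hx' φ (hI φ h))
      have e1 : cylPoint e 0 (-deriv z φ) (deriv x φ) t = √(deriv x φ ^ 2 + deriv z φ ^ 2) •
          cylPoint e 0 (-Real.sin (slopeAngle x z φ)) (Real.cos (slopeAngle x z φ)) t := by
        generalize √(deriv x φ ^ 2 + deriv z φ ^ 2) = w at *
        rw [← h3, ← h4]
        simp only [cylPoint]
        module
      rw [e1, real_inner_smul_left] at h2
      exact pos_of_mul_pos_right h2 (Real.sqrt_nonneg _)
  have hrate : ContinuousOn (slopeRate x z) (Icc 0 δ) := by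
    have h1 := hasDerivAt_deriv_of_contDiff hx 0
    have h2 := hasDerivAt_deriv_of_contDiff hz 0
    refine ContinuousOn.div ?_ ?_ hspeed
    · exact ((h2.2.2.1.mul h1.2.2.2).sub (h2.2.2.2.mul h1.2.2.1)).continuousOn
    · exact ((h1.2.2.2.pow 2).add (h2.2.2.2.pow 2)).continuousOn
  have hxc := hx.continuous
  have hx'c := (hasDerivAt_deriv_of_contDiff hx 0).2.2.2
  have hz'c := (hasDerivAt_deriv_of_contDiff hz 0).2.2.2
  have hf : ContinuousOn (fun φ => x φ * slopeRate x z φ + deriv z φ) (Icc 0 δ) :=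
    (hxc.continuousOn.mul hrate).add hz'c.continuousOn
  obtain ⟨h1, h2⟩ := integral_revolutionPatch (e := e) (c := c) (I := Ioc 0 δ)
    (g := meanCurvature S) (G := fun φ _ => -(x φ * slopeRate x z φ + deriv z φ) / 2)
    (hx.of_le (by norm_num)) (hz.of_le (by norm_num)) hδ.le measurableSet_Ioc
    Ioo_subset_Ioc_self Ioc_subset_Icc_self hpos (injOn_graph hx hx')
    (fun φ hφ => hspeed φ (Ioc_subset_Icc_self hφ))
    ((hf.comp continuousOn_fst fun q hq => hq.1).neg.div_const 2) fun φ hφ t _ => hH φ hφ t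
  refine ⟨h1, ?_⟩
  rw [h2]
  simp only [intervalIntegral.integral_const, sub_zero, smul_eq_mul]
  have e1 : ∀ φ, 2 * Real.pi * (-(x φ * slopeRate x z φ + deriv z φ) / 2) =
      -Real.pi * (x φ * slopeRate x z φ + deriv z φ) := fun φ => by ring
  simp_rw [e1]
  rw [intervalIntegral.integral_const_mul]
  refine mul_le_mul_of_nonpos_left ?_ (by linarith [Real.pi_pos])
  have hΘ : ContinuousOn (slopeAngle x z) (Icc 0 δ) := fun φ hφ =>
    (hasDerivAt_slopeAngle hx hz (hx' φ hφ)).continuousAt.continuousWithinAt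
  have hint : IntervalIntegrable (fun φ => deriv x φ * slopeAngle x z φ + x φ * slopeRate x z φ +
      deriv z φ - Real.pi / 2 * deriv x φ) volume 0 δ := by
    refine ContinuousOn.intervalIntegrable ?_
    rw [uIcc_of_le hδ.le]
    exact (((hx'c.continuousOn.mul hΘ).add (hxc.continuousOn.mul hrate)).add
      hz'c.continuousOn).sub (continuousOn_const.mul hx'c.continuousOn)
  have hW : ∫ φ in (0 : ℝ)..δ, (deriv x φ * slopeAngle x z φ + x φ * slopeRate x z φ +
      deriv z φ - Real.pi / 2 * deriv x φ) =
      (x δ * slopeAngle x z δ + z δ - Real.pi / 2 * x δ) -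
      (x 0 * slopeAngle x z 0 + z 0 - Real.pi / 2 * x 0) :=
    intervalIntegral.integral_eq_sub_of_hasDerivAt
      (f := fun φ => x φ * slopeAngle x z φ + z φ - Real.pi / 2 * x φ) (fun φ hφ => by
        rw [uIcc_of_le hδ.le] at hφ
        exact (((hx1 φ).mul (hasDerivAt_slopeAngle hx hz (hx' φ hφ))).add (hz1 φ)).sub
          ((hx1 φ).const_mul _)) hint
  have hmono : ∫ φ in (0 : ℝ)..δ, (deriv x φ * slopeAngle x z φ + x φ * slopeRate x z φ +
      deriv z φ - Real.pi / 2 * deriv x φ) ≤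
      ∫ φ in (0 : ℝ)..δ, (x φ * slopeRate x z φ + deriv z φ) := by
    refine intervalIntegral.integral_mono_on hδ.le hint (ContinuousOn.intervalIntegrable ?_)
      fun φ hφ => ?_
    · rwa [uIcc_of_le hδ.le]
    · have := Real.arctan_lt_pi_div_two (deriv z φ / deriv x φ)
      have h3 : deriv x φ * slopeAngle x z φ ≤ deriv x φ * (Real.pi / 2) :=
        mul_le_mul_of_nonneg_left this.le (hx' φ hφ).le
      linarith
  refine le_trans ?_ hmono
  rw [hW, hx0]
  have h3 : x δ * -(Real.pi / 2) ≤ x δ * slopeAngle x z δ :=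
    mul_le_mul_of_nonneg_left (Real.neg_pi_div_two_lt_arctan _).le (hpos δ ⟨hδ, le_rfl⟩).le
  linarith

/-- The area of a rotated graph over a disc. -/
theorem measure_graphPatch (hδ : 0 < δ) (hx : ContDiff ℝ 2 x)
    (hz : ContDiff ℝ 2 z) (hx0 : x 0 = 0) (hx' : ∀ φ ∈ Icc 0 δ, 0 < deriv x φ) :
    MeasurableSet (revolutionPatch e c x z (Ioc 0 δ)) ∧
    0 < μHE[2] (revolutionPatch e c x z (Ioc 0 δ)) ∧
    μHE[2] (revolutionPatch e c x z (Ioc 0 δ)) =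
      ENNReal.ofReal (2 * Real.pi * ∫ φ in (0 : ℝ)..δ, x φ * √(deriv x φ ^ 2 + deriv z φ ^ 2)) := by
  have hpos : ∀ φ ∈ Ioc 0 δ, 0 < x φ := fun φ hφ => pos_of_mem_Ioc hx hx0 hx' hφ
  have hspeed : ∀ φ ∈ Ioc 0 δ, 0 < deriv x φ ^ 2 + deriv z φ ^ 2 := fun φ hφ => by
    have := hx' φ (Ioc_subset_Icc_self hφ)
    positivity
  have hx'c := (hasDerivAt_deriv_of_contDiff hx 0).2.2.2
  have hz'c := (hasDerivAt_deriv_of_contDiff hz 0).2.2.2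
  have hc : Continuous fun φ => x φ * √(deriv x φ ^ 2 + deriv z φ ^ 2) :=
    hx.continuous.mul ((hx'c.pow 2).add (hz'c.pow 2)).sqrt
  refine ⟨measurableSet_revolutionPatch (hx.of_le (by norm_num)) (hz.of_le (by norm_num))
    measurableSet_Ioc hpos (injOn_graph hx hx'), ?_⟩
  rw [euclideanHausdorffMeasure_revolutionPatch (hx.of_le (by norm_num)) (hz.of_le (by norm_num))
    hδ.le measurableSet_Ioc Ioo_subset_Ioc_self Ioc_subset_Icc_self hpos (injOn_graph hx hx')
    fun φ hφ => (hspeed φ hφ).ne']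
  refine ⟨?_, rfl⟩
  rw [ENNReal.ofReal_pos]
  refine mul_pos (by positivity) (intervalIntegral.intervalIntegral_pos_of_pos_on
    (hc.intervalIntegrable _ _) (fun φ hφ => ?_) hδ)
  exact mul_pos (hpos φ (Ioo_subset_Ioc_self hφ))
    (Real.sqrt_pos.2 (hspeed φ (Ioo_subset_Ioc_self hφ)))

end GraphPatch

/-! ### Radial graphs over the sphere -/

/-- `r` is a positive function, bounded away from `0` and `∞`, which is positively homogeneous of
degree `0` and of class `C²` away from the origin. -/
structure IsRadial (r : E3 → ℝ) (m M : ℝ) : Prop where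
  contDiffAt : ∀ x ≠ 0, ContDiffAt ℝ 2 r x
  homog : ∀ t : ℝ, 0 < t → ∀ x, r (t • x) = r x
  pos : 0 < m
  lower : ∀ x, m ≤ r x
  upper : ∀ x, r x ≤ M

/-- The radial graph of `r`, a surface star-shaped with respect to the origin. -/
def radialGraph (r : E3 → ℝ) : Set E3 := {x | ‖x‖ = r x}

/-- A continuous function that vanishes on the radial graph only. -/
noncomputable def radialLevel (r : E3 → ℝ) (x : E3) : ℝ := ‖x‖ / r x - 1

theorem exists_frame {ω : E3} (hω : ‖ω‖ = 1) :
    ∃ e : OrthonormalBasis (Fin 3) ℝ E3, e 2 = ω := by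
  have h := Orthonormal.exists_orthonormalBasis_extension_of_card_eq (𝕜 := ℝ) (E := E3)
    (ι := Fin 3) (by simp) (v := fun _ => ω) (s := {2}) (by
      constructor
      · rintro ⟨i, hi⟩
        exact hω
      · rintro ⟨i, hi⟩ ⟨j, hj⟩ hij
        exact absurd (Subtype.ext (hi.trans hj.symm)) hij)
  obtain ⟨e, he⟩ := h
  exact ⟨e, he 2 rfl⟩

namespace IsRadial

variable {r : E3 → ℝ} {m M : ℝ}

theorem pos_apply (h : IsRadial r m M) (x : E3) : 0 < r x := h.pos.trans_le (h.lower x)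

theorem mem_iff (h : IsRadial r m M) (x : E3) : x ∈ radialGraph r ↔ radialLevel r x = 0 := by
  rw [radialLevel, sub_eq_zero, div_eq_one_iff_eq (h.pos_apply x).ne']
  rfl

theorem ne_zero (h : IsRadial r m M) {x : E3} (hx : x ∈ radialGraph r) : x ≠ 0 := by
  rintro rfl
  have : ‖(0 : E3)‖ = r 0 := hx
  rw [norm_zero] at this
  exact (h.pos_apply 0).ne this

theorem contDiffAt_radialLevel (h : IsRadial r m M) {x : E3} (hx : x ≠ 0) :
    ContDiffAt ℝ 2 (radialLevel r) x :=
  ((contDiffAt_norm ℝ hx).div (h.contDiffAt x hx) (h.pos_apply x).ne').sub contDiffAt_const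

theorem continuous_radialLevel (h : IsRadial r m M) : Continuous (radialLevel r) := by
  rw [continuous_iff_continuousAt]
  intro x
  by_cases hx : x = 0
  · subst hx
    refine ContinuousAt.sub ?_ continuousAt_const
    have h0 : ‖(0 : E3)‖ / r 0 = 0 := by simp
    rw [ContinuousAt, h0]
    have hlim : Tendsto (fun x : E3 => ‖x‖ / m) (𝓝 0) (𝓝 0) := by
      have : Continuous fun x : E3 => ‖x‖ / m := by fun_prop
      simpa using this.tendsto 0
    refine squeeze_zero (fun x => div_nonneg (norm_nonneg x) (h.pos_apply x).le) (fun x => ?_) hlim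
    exact div_le_div_of_nonneg_left (norm_nonneg x) h.pos (h.lower x)
  · exact (h.contDiffAt_radialLevel hx).continuousAt

theorem radialLevel_smul (h : IsRadial r m M) {t : ℝ} (ht : 0 < t) (x : E3) :
    radialLevel r (t • x) = t * (‖x‖ / r x) - 1 := by
  rw [radialLevel, h.homog t ht, norm_smul, Real.norm_of_nonneg ht.le, mul_div_assoc]

theorem mem_innerDomain (h : IsRadial r m M) {x : E3} (hx : radialLevel r x < 0) :
    x ∈ innerDomain (radialGraph r) := by
  refine mem_innerDomain_of_neg h.continuous_radialLevel h.mem_iff ?_ hx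
  refine (Metric.isBounded_closedBall (x := (0 : E3)) (r := M)).subset fun y hy => ?_
  rw [mem_closedBall_zero_iff]
  have : ‖y‖ / r y < 1 := by
    have : ‖y‖ / r y - 1 < 0 := hy
    linarith
  rw [div_lt_one (h.pos_apply y)] at this
  exact this.le.trans (h.upper y)

theorem mem_outerDomain (h : IsRadial r m M) {x : E3} (hx : 0 < radialLevel r x) :
    x ∈ outerDomain (radialGraph r) := by
  have h1 : 1 < ‖x‖ / r x := by
    rw [radialLevel] at hx
    linarith
  refine mem_outerDomain_of_ray (v := x) ?_ fun t ht => ?_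
  · rintro rfl
    rw [norm_zero, zero_div] at h1
    linarith
  · have : x + t • x = (1 + t) • x := by module
    rw [this, h.mem_iff, h.radialLevel_smul (by positivity)]
    nlinarith

/-- The level function increases in the radial direction. -/
theorem fderiv_radialLevel_self (h : IsRadial r m M) {x : E3} (hx : x ∈ radialGraph r) :
    0 < fderiv ℝ (radialLevel r) x x := by
  refine fderiv_pos_of_hasDerivAt (d := 1)
    ((h.contDiffAt_radialLevel (h.ne_zero hx)).differentiableAt (by simp)) ?_ one_pos
  have h1 : ‖x‖ / r x = 1 := by
    have : ‖x‖ = r x := hx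
    rw [this, div_self (h.pos_apply x).ne']
  have h2 : (fun τ : ℝ => radialLevel r (x + τ • x)) =ᶠ[𝓝 0] fun τ => τ := by
    filter_upwards [lt_mem_nhds (show (-1 : ℝ) < 0 by norm_num)] with τ hτ
    have : x + τ • x = (1 + τ) • x := by module
    rw [this, h.radialLevel_smul (by linarith), h1]
    ring
  exact (hasDerivAt_id (0 : ℝ)).congr_of_eventuallyEq h2

theorem isRegularLevelSetAt (h : IsRadial r m M) {x : E3} (hx : x ∈ radialGraph r) :
    IsRegularLevelSetAt (radialGraph r) (radialLevel r) x where
  mem := hx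
  contDiffAt := h.contDiffAt_radialLevel (h.ne_zero hx)
  fderiv_ne_zero h0 := by
    have := h.fderiv_radialLevel_self hx
    simp [h0] at this
  outer := Eventually.of_forall fun _ hy => h.mem_outerDomain hy
  inner := Eventually.of_forall fun _ hy => h.mem_innerDomain hy
  zero := Eventually.of_forall fun y => (h.mem_iff y).symm

theorem continuousAt (h : IsRadial r m M) {x : E3} (hx : x ≠ 0) : ContinuousAt r x :=
  (h.contDiffAt x hx).continuousAt

/-- The point of the radial graph over `y ≠ 0`. -/
theorem project_mem (h : IsRadial r m M) {y : E3} (hy : y ≠ 0) :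
    (r y / ‖y‖) • y ∈ radialGraph r := by
  have h1 : 0 < ‖y‖ := norm_pos_iff.2 hy
  have h2 : 0 < r y / ‖y‖ := div_pos (h.pos_apply y) h1
  rw [radialGraph, mem_ofPred_eq, h.homog _ h2, norm_smul, Real.norm_of_nonneg h2.le]
  field_simp

theorem nonempty_homeomorph (h : IsRadial r m M) :
    Nonempty (radialGraph r ≃ₜ Metric.sphere (0 : E3) 1) := by
  have hs : ∀ ω : Metric.sphere (0 : E3) 1, ‖(ω : E3)‖ = 1 := fun ω => by
    simp
  have hs0 : ∀ ω : Metric.sphere (0 : E3) 1, (ω : E3) ≠ 0 := fun ω h0 => by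
    have := hs ω
    simp [h0] at this
  have hx0 : ∀ x : radialGraph r, ‖(x : E3)‖ ≠ 0 := fun x => norm_ne_zero_iff.2 (h.ne_zero x.2)
  refine ⟨{
    toFun := fun x => ⟨‖(x : E3)‖⁻¹ • (x : E3), ?_⟩
    invFun := fun ω => ⟨(r ω / ‖(ω : E3)‖) • (ω : E3), h.project_mem (hs0 ω)⟩
    left_inv := fun x => ?_
    right_inv := fun ω => ?_
    continuous_toFun := ?_
    continuous_invFun := ?_ }⟩
  · rw [mem_sphere_zero_iff_norm, norm_smul, norm_inv, norm_norm, inv_mul_cancel₀ (hx0 x)]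
  · ext1
    have h1 : 0 < ‖(x : E3)‖⁻¹ := inv_pos.2 (norm_pos_iff.2 (h.ne_zero x.2))
    have h2 : ‖(x : E3)‖ = r x := x.2
    simp only
    rw [h.homog _ h1, ← h2, norm_smul, norm_inv, norm_norm, smul_smul, inv_mul_cancel₀ (hx0 x),
      div_one, mul_inv_cancel₀ (hx0 x), one_smul]
  · ext1
    simp only
    rw [hs ω, div_one, norm_smul, hs ω, mul_one, Real.norm_of_nonneg (h.pos_apply _).le, smul_smul,
      inv_mul_cancel₀ (h.pos_apply _).ne', one_smul]
  · exact ((continuous_subtype_val.norm.inv₀ hx0).smul continuous_subtype_val).subtype_mk _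
  · refine Continuous.subtype_mk ?_ _
    have hr : Continuous fun ω : Metric.sphere (0 : E3) 1 => r ω :=
      continuous_iff_continuousAt.2 fun ω =>
        (h.continuousAt (hs0 ω)).comp continuous_subtype_val.continuousAt
    exact (hr.div continuous_subtype_val.norm fun ω => norm_ne_zero_iff.2 (hs0 ω)).smul
      continuous_subtype_val

/-- Central projection from an affine tangent plane of the unit sphere parametrizes a half of the
radial graph. -/
theorem isC11Surface (h : IsRadial r m M) : IsC11Surface (radialGraph r) := by
  intro p hp
  have hp0 := h.ne_zero hp
  have hpn : ‖p‖ ≠ 0 := norm_ne_zero_iff.2 hp0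
  obtain ⟨e, he⟩ := exists_frame (ω := ‖p‖⁻¹ • p) (by
    rw [norm_smul, norm_inv, norm_norm, inv_mul_cancel₀ hpn])
  have hon := e.inner_eq_ite
  set y : E2 → E3 := fun q => e 2 + (q 0 • e 0 + q 1 • e 1) with hy
  have hy2 : ∀ q, ⟪e 2, y q⟫ = 1 := fun q => by
    simp [hy, inner_add_right, inner_smul_right, hon]
  have hy0 : ∀ q, y q ≠ 0 := fun q h0 => by
    have := hy2 q
    simp [h0] at this
  set X : E2 → E3 := fun q => (r (y q) / ‖y q‖) • y q with hX
  set V : Set E3 := {x | 0 < ⟪e 2, x⟫} with hV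
  set Λ : E3 → E2 := fun x => !₂[⟪e 0, x⟫ / ⟪e 2, x⟫, ⟪e 1, x⟫ / ⟪e 2, x⟫] with hΛ
  have hcoef : ∀ q, 0 < r (y q) / ‖y q‖ := fun q =>
    div_pos (h.pos_apply _) (norm_pos_iff.2 (hy0 q))
  have hXV : ∀ q, X q ∈ V := fun q => by
    rw [hV, mem_ofPred_eq, hX]
    simp only [inner_smul_right, hy2, mul_one]
    exact hcoef q
  have hΛX : ∀ q, Λ (X q) = q := fun q => by
    have h1 := (hcoef q).ne'
    have e0 : ⟪e 0, y q⟫ = q 0 := by simp [hy, inner_add_right, inner_smul_right, hon]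
    have e1 : ⟪e 1, y q⟫ = q 1 := by simp [hy, inner_add_right, inner_smul_right, hon]
    ext i
    fin_cases i
    · simp only [hΛ, hX, inner_smul_right, hy2, e0, mul_one]
      simpa using mul_div_cancel_left₀ (q 0) h1
    · simp only [hΛ, hX, inner_smul_right, hy2, e1, mul_one]
      simpa using mul_div_cancel_left₀ (q 1) h1
  have hyd : ContDiff ℝ 2 y := by
    have h0 : ContDiff ℝ 2 fun q : E2 => q 0 := by fun_prop
    have h1 : ContDiff ℝ 2 fun q : E2 => q 1 := by fun_prop
    exact contDiff_const.add ((h0.smul contDiff_const).add (h1.smul contDiff_const))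
  have hXd : ContDiff ℝ 2 X := by
    rw [contDiff_iff_contDiffAt]
    intro q
    exact (((h.contDiffAt _ (hy0 q)).comp q hyd.contDiffAt).div
      ((contDiffAt_norm ℝ (hy0 q)).comp q hyd.contDiffAt) (norm_ne_zero_iff.2 (hy0 q))).smul
      hyd.contDiffAt
  have hΛc : ∀ x ∈ V, DifferentiableAt ℝ Λ x := fun x hx => by
    have hx' : ⟪e 2, x⟫ ≠ 0 := (show (0 : ℝ) < ⟪e 2, x⟫ from hx).ne'
    rw [differentiableAt_euclidean]
    intro i
    have hd : ∀ j, DifferentiableAt ℝ (fun x : E3 => ⟪e j, x⟫) x := fun j =>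
      (innerSL ℝ (e j)).differentiableAt
    have hq : ∀ j, DifferentiableAt ℝ (fun x : E3 => ⟪e j, x⟫ / ⟪e 2, x⟫) x := fun j => by
      have hdiv : ∀ f g : E3 → ℝ, DifferentiableAt ℝ f x → DifferentiableAt ℝ g x → g x ≠ 0 →
          DifferentiableAt ℝ (fun x => f x / g x) x := fun f g hf hg h => by
        simp_rw [div_eq_mul_inv]
        exact hf.mul (DifferentiableAt.inv hg h)
      exact hdiv (fun x => ⟪e j, x⟫) (fun x => ⟪e 2, x⟫) (hd j) (hd 2) hx'
    fin_cases i
    · exact hq 0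
    · exact hq 1
  refine ⟨univ, V, X, isOpen_univ, ?_, ?_, (hXd.of_le (by norm_num)).contDiffOn, ?_, ?_, ?_, ?_⟩
  · exact isOpen_lt continuous_const (innerSL ℝ (e 2)).continuous
  · rw [hV, mem_ofPred_eq, he, real_inner_smul_left, real_inner_self_eq_norm_sq]
    have := norm_pos_iff.2 hp0
    positivity
  · exact (ContDiff.locallyLipschitz (𝕂 := ℝ)
      (hXd.fderiv_right (m := 1) (by norm_num))).locallyLipschitzOn
  · intro q _
    have h1 : HasFDerivAt X (fderiv ℝ X q) q := (hXd.differentiable (by simp) q).hasFDerivAt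
    have h2 := ((hΛc (X q) (hXV q)).hasFDerivAt).comp q h1
    have h3 : HasFDerivAt (Λ ∘ X) (ContinuousLinearMap.id ℝ E2) q :=
      (hasFDerivAt_id q).congr_of_eventuallyEq (Eventually.of_forall hΛX)
    have h4 := h2.unique h3
    exact Function.LeftInverse.injective (g := fderiv ℝ Λ (X q)) fun v => by
      simpa using congrArg (fun A : E2 →L[ℝ] E2 => A v) h4
  · have hemb : IsEmbedding fun q : (univ : Set E2) => (⟨X q, hXV q⟩ : V) := by
      refine Function.LeftInverse.isEmbedding (f := fun x : V => ⟨Λ x, trivial⟩) ?_ ?_ ?_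
      · exact fun q => Subtype.ext (hΛX q)
      · exact Continuous.subtype_mk (continuous_iff_continuousAt.2 fun x : V =>
          (hΛc x x.2).continuousAt.comp continuous_subtype_val.continuousAt) _
      · exact Continuous.subtype_mk (hXd.continuous.comp continuous_subtype_val) _
    exact IsEmbedding.subtypeVal.comp hemb
  · ext x
    constructor
    · rintro ⟨q, -, rfl⟩
      exact ⟨hXV q, h.project_mem (hy0 q)⟩
    · rintro ⟨hxV, hxS⟩
      have ha : 0 < ⟪e 2, x⟫ := hxV
      have hyx : y (Λ x) = ⟪e 2, x⟫⁻¹ • x := by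
        have hx := e.sum_repr x
        rw [Fin.sum_univ_three] at hx
        simp only [OrthonormalBasis.repr_apply_apply] at hx
        have : y (Λ x) = ⟪e 2, x⟫⁻¹ • (⟪e 0, x⟫ • e 0 + ⟪e 1, x⟫ • e 1 + ⟪e 2, x⟫ • e 2) := by
          simp only [hy, hΛ]
          rw [smul_add, smul_smul ⟪e 2, x⟫⁻¹ ⟪e 2, x⟫, inv_mul_cancel₀ ha.ne']
          simp only [Matrix.cons_val_zero, Matrix.cons_val_one, div_eq_inv_mul]
          module
        rw [this, hx]
      refine ⟨Λ x, trivial, ?_⟩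
      simp only [hX]
      have hxn : ‖x‖ = r x := hxS
      have hx0 : ‖x‖ ≠ 0 := norm_ne_zero_iff.2 (h.ne_zero hxS)
      rw [hyx, h.homog _ (inv_pos.2 ha), norm_smul, Real.norm_of_nonneg (inv_pos.2 ha).le,
        smul_smul, ← hxn]
      have : ‖x‖ / (⟪e 2, x⟫⁻¹ * ‖x‖) * ⟪e 2, x⟫⁻¹ = 1 := by
        field_simp
      rw [this, one_smul]

theorem isSphereLikeC11Surface (h : IsRadial r m M) : IsSphereLikeC11Surface (radialGraph r) :=
  ⟨h.isC11Surface, h.nonempty_homeomorph⟩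

theorem isCompact (h : IsRadial r m M) : IsCompact (radialGraph r) := by
  refine Metric.isCompact_of_isClosed_isBounded ?_ ?_
  · have : radialGraph r = radialLevel r ⁻¹' {0} := Set.ext fun x => h.mem_iff x
    rw [this]
    exact isClosed_singleton.preimage h.continuous_radialLevel
  · refine (Metric.isBounded_closedBall (x := (0 : E3)) (r := M)).subset fun y hy => ?_
    rw [mem_closedBall_zero_iff]
    exact (le_of_eq hy).trans (h.upper y)

/-- Where `r` is constant, the surface is a piece of a round sphere. -/
theorem meanCurvature_of_eventuallyEq (h : IsRadial r m M) {x : E3} (hx : x ∈ radialGraph r)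
    {lam : ℝ} (hl : 0 < lam) (heq : ∀ᶠ y in 𝓝 x, r y = lam) :
    meanCurvature (radialGraph r) x = lam⁻¹ := by
  have hdef : ∀ {y : E3}, y ∈ radialGraph r → (∀ᶠ w in 𝓝 y, r w = lam) →
      IsDefiningFunctionAt (radialGraph r) (fun w => ‖w‖ ^ 2 - lam ^ 2) y ((2 : ℝ) • y) := by
    intro y hy hloc
    have hsign : ∀ᶠ w in 𝓝 y, ∃ k > 0, ‖w‖ ^ 2 - lam ^ 2 = k * radialLevel r w := by
      filter_upwards [hloc] with w hw
      refine ⟨lam * (‖w‖ + lam), by positivity, ?_⟩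
      rw [radialLevel, hw]
      field_simp
      ring
    refine ⟨hy, ?_, smul_ne_zero two_ne_zero (h.ne_zero hy), ?_, ?_, ?_, ?_⟩
    · refine ((hasStrictFDerivAt_norm_sq y).hasFDerivAt.sub_const (lam ^ 2)).congr_fderiv ?_
      ext v
      simp
    · exact Eventually.of_forall fun w => by fun_prop
    · filter_upwards [hsign] with w ⟨k, hk, hw⟩ hpos
      rw [hw] at hpos
      exact h.mem_outerDomain (pos_of_mul_pos_right hpos hk.le)
    · filter_upwards [hsign] with w ⟨k, hk, hw⟩ hneg
      rw [hw] at hneg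
      exact h.mem_innerDomain (by nlinarith)
    · filter_upwards [hsign] with w ⟨k, hk, hw⟩
      rw [hw, h.mem_iff]
      simp [hk.ne']
  have hnormal : ∀ {y : E3}, y ∈ radialGraph r → (∀ᶠ w in 𝓝 y, r w = lam) →
      outerNormal (radialGraph r) y = lam⁻¹ • y := by
    intro y hy hloc
    have hn : ‖y‖ = lam := by
      have : ‖y‖ = r y := hy
      rw [this, hloc.self_of_nhds]
    rw [(hdef hy hloc).outerNormal_eq, norm_smul, hn, smul_smul]
    congr 1
    simp
  have hA : HasFDerivWithinAt (outerNormal (radialGraph r))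
      (lam⁻¹ • ContinuousLinearMap.id ℝ E3) (radialGraph r) x := by
    refine HasFDerivWithinAt.congr_of_eventuallyEq (f := fun y : E3 => lam⁻¹ • y)
      ((hasFDerivAt_id x).const_smul lam⁻¹).hasFDerivWithinAt ?_ (hnormal hx heq)
    filter_upwards [self_mem_nhdsWithin, nhdsWithin_le_nhds heq.eventually_nhds] with y hy1 hy2
    exact hnormal hy1 hy2
  have hxn : ‖x‖ = lam := by
    have : ‖x‖ = r x := hx
    rw [this, heq.self_of_nhds]
  obtain ⟨e, he⟩ := exists_frame (ω := lam⁻¹ • x) (by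
    rw [norm_smul, hxn, Real.norm_of_nonneg (by positivity), inv_mul_cancel₀ hl.ne'])
  have ho : Orthonormal ℝ ![e 0, e 1, outerNormal (radialGraph r) x] := by
    rw [hnormal hx heq, ← he]
    have : ![e 0, e 1, e 2] = e := by
      funext i
      fin_cases i <;> rfl
    rw [this]
    exact e.orthonormal
  rw [(hdef hx heq).meanCurvature_eq hA ho]
  have h1 := e.inner_eq_ite 0 0
  have h2 := e.inner_eq_ite 1 1
  simp only [smul_apply, ContinuousLinearMap.id_apply, inner_smul_right, h1, h2]
  simp

end IsRadial

/-! ### Spheres with many inward spikes -/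

/-- A smooth nondecreasing function of the cosine `c`, which vanishes up to `cos δ`. -/
noncomputable def bump (δ c : ℝ) : ℝ := expNegInvGlue ((c - Real.cos δ) / (1 - Real.cos δ))

/-- The directions of the spikes, distinct unit vectors in an open half of the equatorial plane. -/
noncomputable def spikeDir (N i : ℕ) : E3 := !₂[Real.cos (i / N), Real.sin (i / N), 0]

/-- The angular radius of the spikes. -/
noncomputable def spikeWidth (N : ℕ) : ℝ := 1 / (8 * N)

/-- The relative depth of the spikes in the direction of `x`. -/
noncomputable def dent (N : ℕ) (x : E3) : ℝ :=
  ∑ i ∈ Finset.range N, bump (spikeWidth N) (⟪spikeDir N i, x⟫ / ‖x‖)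

/-- The radius, in the direction of `x`, of the sphere of radius `lam` with `N` inward spikes. -/
noncomputable def spikyRadius (N : ℕ) (lam : ℝ) (x : E3) : ℝ := lam * (1 - dent N x)

/-- The sphere of radius `lam` with `N` narrow inward spikes. -/
noncomputable def spikySphere (N : ℕ) (lam : ℝ) : Set E3 := radialGraph (spikyRadius N lam)

section Bump

variable {δ : ℝ}

theorem bump_nonneg (δ c : ℝ) : 0 ≤ bump δ c := expNegInvGlue.nonneg _

theorem contDiff_bump (δ : ℝ) : ContDiff ℝ 2 (bump δ) := by
  have h : ContDiff ℝ 2 expNegInvGlue := by exact_mod_cast expNegInvGlue.contDiff (n := 2)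
  exact h.comp ((contDiff_id.sub contDiff_const).div_const _)

theorem monotone_bump (δ : ℝ) : Monotone (bump δ) := fun a b hab => by
  refine expNegInvGlue.monotone (div_le_div_of_nonneg_right (by linarith) ?_)
  linarith [Real.cos_le_one δ]

theorem bump_eq_zero {c : ℝ} (hc : c ≤ Real.cos δ) : bump δ c = 0 :=
  expNegInvGlue.zero_of_nonpos (div_nonpos_of_nonpos_of_nonneg (by linarith)
    (by linarith [Real.cos_le_one δ]))

theorem bump_one (hδ : Real.cos δ < 1) : bump δ 1 = Real.exp (-1) := by
  rw [bump, div_self (by linarith), expNegInvGlue, if_neg (by norm_num), inv_one]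

theorem bump_le (hδ : Real.cos δ < 1) {c : ℝ} (hc : c ≤ 1) : bump δ c ≤ Real.exp (-1) := by
  rw [← bump_one hδ]
  exact monotone_bump δ hc

/-- The bump attains its maximum on `(-∞, 1]` at `1` only. -/
theorem eq_one_of_bump_eq (hδ : Real.cos δ < 1) {c : ℝ} (h : bump δ c = Real.exp (-1)) :
    c = 1 := by
  unfold bump expNegInvGlue at h
  split_ifs at h with h0
  · exact absurd h (Real.exp_pos _).ne
  · have h1 : ((c - Real.cos δ) / (1 - Real.cos δ))⁻¹ = 1 := by
      linarith [Real.exp_injective h]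
    have h2 := inv_eq_one.1 h1
    rw [div_eq_one_iff_eq (by linarith)] at h2
    linarith

end Bump

section Directions

variable {N : ℕ}

theorem inner_spikeDir (N i j : ℕ) :
    ⟪spikeDir N i, spikeDir N j⟫ = Real.cos (i / N - j / N) := by
  rw [Real.cos_sub]
  simp [spikeDir, PiLp.inner_apply, Fin.sum_univ_three]
  ring

theorem norm_spikeDir (N i : ℕ) : ‖spikeDir N i‖ = 1 := by
  rw [norm_eq_sqrt_real_inner, inner_spikeDir, sub_self, Real.cos_zero, Real.sqrt_one]

theorem spikeWidth_pos (hN : 2 ≤ N) : 0 < spikeWidth N := by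
  have : (0 : ℝ) < N := by exact_mod_cast (by omega : 0 < N)
  unfold spikeWidth
  positivity

theorem spikeWidth_le (hN : 2 ≤ N) : spikeWidth N ≤ 1 / 16 := by
  have : (2 : ℝ) ≤ N := by exact_mod_cast hN
  unfold spikeWidth
  exact one_div_le_one_div_of_le (by norm_num) (by linarith)

theorem cos_spikeWidth_pos (hN : 2 ≤ N) : 0 < Real.cos (spikeWidth N) :=
  Real.cos_pos_of_mem_Ioo ⟨by linarith [spikeWidth_pos hN, Real.pi_pos],
    by linarith [spikeWidth_le hN, Real.pi_gt_three]⟩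

theorem cos_spikeWidth_lt_one (hN : 2 ≤ N) : Real.cos (spikeWidth N) < 1 := by
  rw [← Real.cos_zero]
  exact Real.cos_lt_cos_of_nonneg_of_le_pi le_rfl
    (by linarith [spikeWidth_le hN, Real.pi_gt_three]) (spikeWidth_pos hN)

theorem inner_le_norm (N i : ℕ) (x : E3) : ⟪spikeDir N i, x⟫ ≤ ‖x‖ := by
  have := real_inner_le_norm (spikeDir N i) x
  rwa [norm_spikeDir, one_mul] at this

theorem inner_div_norm_le_one (N i : ℕ) (x : E3) : ⟪spikeDir N i, x⟫ / ‖x‖ ≤ 1 :=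
  div_le_one_of_le₀ (inner_le_norm N i x) (norm_nonneg x)

/-- The caps that carry the spikes are disjoint. -/
theorem eq_of_mem_caps (hN : 2 ≤ N) {i j : ℕ} (hi : i ∈ Finset.range N) (hj : j ∈ Finset.range N)
    {x : E3} (hx : x ≠ 0) (h1 : Real.cos (spikeWidth N) * ‖x‖ ≤ ⟪spikeDir N i, x⟫)
    (h2 : Real.cos (spikeWidth N) * ‖x‖ ≤ ⟪spikeDir N j, x⟫) : i = j := by
  by_contra hij
  have hN0 : (0 : ℝ) < N := by exact_mod_cast (by omega : 0 < N)
  have hxn : 0 < ‖x‖ := norm_pos_iff.2 hx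
  set δ := spikeWidth N with hδ
  have hδ0 := spikeWidth_pos hN
  have hcos : 1 - δ ^ 2 / 2 ≤ Real.cos δ := Real.one_sub_sq_div_two_le_cos
  -- the distance from the direction of `x` to the axis of the cap
  have hclose : ∀ k, Real.cos δ * ‖x‖ ≤ ⟪spikeDir N k, x⟫ →
      ‖spikeDir N k - ‖x‖⁻¹ • x‖ ≤ δ := by
    intro k hk
    rw [← sq_le_sq₀ (norm_nonneg _) hδ0.le, norm_sub_sq_real, norm_spikeDir, norm_smul, norm_inv,
      norm_norm, inv_mul_cancel₀ hxn.ne', inner_smul_right]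
    have : Real.cos δ ≤ ‖x‖⁻¹ * ⟪spikeDir N k, x⟫ := by
      rw [inv_mul_eq_div, le_div_iff₀ hxn]
      exact hk
    linarith
  have hdist : ‖spikeDir N i - spikeDir N j‖ ≤ 2 * δ := by
    have e : spikeDir N i - spikeDir N j =
        (spikeDir N i - ‖x‖⁻¹ • x) - (spikeDir N j - ‖x‖⁻¹ • x) := by abel
    rw [e]
    refine (norm_sub_le _ _).trans ?_
    linarith [hclose i h1, hclose j h2]
  have hsq : ‖spikeDir N i - spikeDir N j‖ ^ 2 = 2 - 2 * Real.cos (i / N - j / N) := by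
    rw [norm_sub_sq_real, norm_spikeDir, norm_spikeDir, inner_spikeDir]
    ring
  have hi' : (i : ℝ) < N := by exact_mod_cast Finset.mem_range.1 hi
  have hj' : (j : ℝ) < N := by exact_mod_cast Finset.mem_range.1 hj
  have hi0 : (0 : ℝ) ≤ i := Nat.cast_nonneg i
  have hj0 : (0 : ℝ) ≤ j := Nat.cast_nonneg j
  set s : ℝ := i / N - j / N with hs
  have hsN : s * N = i - j := by
    rw [hs]
    field_simp
  have hs1 : |s| ≤ 1 := by
    rw [abs_le]
    constructor <;> nlinarith
  have hs2 : 1 ≤ s ^ 2 * N ^ 2 := by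
    rw [← mul_pow, hsN]
    have : (1 : ℤ) ≤ ((i : ℤ) - j) ^ 2 := by
      have : (i : ℤ) - j ≠ 0 := by omega
      have := sq_pos_of_ne_zero this
      omega
    exact_mod_cast this
  have hup := Real.cos_le_one_sub_mul_cos_sq (x := s) (hs1.trans (by linarith [Real.pi_gt_three]))
  have hle : 2 - 2 * Real.cos s ≤ (2 * δ) ^ 2 := by
    rw [← hsq]
    gcongr
  have h3 : 4 / Real.pi ^ 2 * s ^ 2 ≤ 4 * δ ^ 2 := by
    have : 2 * (2 / Real.pi ^ 2 * s ^ 2) = 4 / Real.pi ^ 2 * s ^ 2 := by ring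
    linarith
  have hδN : δ ^ 2 * N ^ 2 = 1 / 64 := by
    rw [hδ, spikeWidth]
    field_simp
    norm_num
  have h4 : s ^ 2 * N ^ 2 ≤ Real.pi ^ 2 * (δ ^ 2 * N ^ 2) := by
    have h5 : s ^ 2 ≤ Real.pi ^ 2 * δ ^ 2 := by
      have hpi : (0 : ℝ) < Real.pi ^ 2 := by positivity
      rw [div_mul_eq_mul_div, div_le_iff₀ hpi] at h3
      linarith
    nlinarith [sq_nonneg (N : ℝ)]
  rw [hδN] at h4
  nlinarith [Real.pi_lt_four, Real.pi_pos]

/-- The caps around distinct spike directions are disjoint, so at most one spike is felt at a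
point. -/
theorem dent_eq_of_mem_cap (hN : 2 ≤ N) {i : ℕ} (hi : i ∈ Finset.range N) {x : E3} (hx : x ≠ 0)
    (h : Real.cos (spikeWidth N) * ‖x‖ ≤ ⟪spikeDir N i, x⟫) :
    dent N x = bump (spikeWidth N) (⟪spikeDir N i, x⟫ / ‖x‖) := by
  refine Finset.sum_eq_single_of_mem i hi fun j hj hji => bump_eq_zero ?_
  rw [div_le_iff₀ (norm_pos_iff.2 hx)]
  by_contra hcon
  exact hji (eq_of_mem_caps hN hj hi hx (not_le.1 hcon).le h)

theorem dent_eq_zero {x : E3} (hx : x ≠ 0)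
    (h : ∀ i ∈ Finset.range N, ⟪spikeDir N i, x⟫ < Real.cos (spikeWidth N) * ‖x‖) :
    dent N x = 0 := by
  refine Finset.sum_eq_zero fun i hi => bump_eq_zero ?_
  rw [div_le_iff₀ (norm_pos_iff.2 hx)]
  exact (h i hi).le

theorem dent_nonneg (N : ℕ) (x : E3) : 0 ≤ dent N x := Finset.sum_nonneg fun _ _ => bump_nonneg _ _

theorem dent_le (hN : 2 ≤ N) (x : E3) : dent N x ≤ Real.exp (-1) := by
  by_cases hx : x = 0
  · subst hx
    have : dent N 0 = 0 := Finset.sum_eq_zero fun i _ => bump_eq_zero (by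
      simpa using (cos_spikeWidth_pos hN).le)
    rw [this]
    positivity
  by_cases h : ∃ i ∈ Finset.range N, Real.cos (spikeWidth N) * ‖x‖ ≤ ⟪spikeDir N i, x⟫
  · obtain ⟨i, hi, h⟩ := h
    rw [dent_eq_of_mem_cap hN hi hx h]
    exact bump_le (cos_spikeWidth_lt_one hN) (inner_div_norm_le_one N i x)
  · push Not at h
    rw [dent_eq_zero hx h]
    positivity

theorem exp_neg_one_lt : Real.exp (-1) < 1 := by
  rw [Real.exp_lt_one_iff]
  norm_num

theorem dent_smul {t : ℝ} (ht : 0 < t) (x : E3) : dent N (t • x) = dent N x := by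
  unfold dent
  refine Finset.sum_congr rfl fun i _ => ?_
  rw [inner_smul_right, norm_smul, Real.norm_of_nonneg ht.le, mul_div_mul_left _ _ ht.ne']

theorem isRadial_spikyRadius (hN : 2 ≤ N) {lam : ℝ} (hl : 0 < lam) :
    IsRadial (spikyRadius N lam) (lam * (1 - Real.exp (-1))) lam where
  contDiffAt x hx := by
    refine contDiffAt_const.mul (contDiffAt_const.sub (ContDiffAt.sum fun i _ => ?_))
    refine (contDiff_bump _).contDiffAt.comp x (ContDiffAt.div ?_ (contDiffAt_norm ℝ hx)
      (norm_ne_zero_iff.2 hx))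
    exact (innerSL ℝ (spikeDir N i)).contDiff.contDiffAt
  homog t ht x := by rw [spikyRadius, spikyRadius, dent_smul ht]
  pos := mul_pos hl (by linarith [exp_neg_one_lt])
  lower x := mul_le_mul_of_nonneg_left (by linarith [dent_le hN x]) hl.le
  upper x := mul_le_of_le_one_right hl.le (by linarith [dent_nonneg N x])

open Pointwise in
theorem spikySphere_eq_smul (N : ℕ) {lam : ℝ} (hl : 0 < lam) :
    spikySphere N lam = lam • spikySphere N 1 := by
  ext x
  rw [mem_smul_set_iff_inv_smul_mem₀ hl.ne']
  simp only [spikySphere, radialGraph, mem_ofPred_eq, spikyRadius, dent_smul (inv_pos.2 hl),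
    norm_smul, Real.norm_of_nonneg (inv_pos.2 hl).le]
  rw [one_mul, inv_mul_eq_iff_eq_mul₀ hl.ne']

end Directions

/-! ### Area and total mean curvature of a spike -/

section Spike

variable {N i : ℕ} {lam : ℝ}

/-- The radius of the spiky sphere as a function of the angle `φ` to the axis of a spike. -/
noncomputable def spikeRadius (N : ℕ) (lam φ : ℝ) : ℝ :=
  lam * (1 - bump (spikeWidth N) (Real.cos φ))

/-- Distance to the axis of a spike, as a function of the angle `φ` to this axis. -/
noncomputable def spikeX (N : ℕ) (lam φ : ℝ) : ℝ := spikeRadius N lam φ * Real.sin φ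

/-- Height along the axis of a spike, as a function of the angle `φ` to this axis. -/
noncomputable def spikeZ (N : ℕ) (lam φ : ℝ) : ℝ := spikeRadius N lam φ * Real.cos φ

/-- The closed cap of the surface that carries the `i`-th spike. -/
noncomputable def spikeCap (N : ℕ) (lam : ℝ) (i : ℕ) : Set E3 :=
  {x ∈ spikySphere N lam | Real.cos (spikeWidth N) * ‖x‖ ≤ ⟪spikeDir N i, x⟫}

/-- The round part of the surface. -/
noncomputable def roundPart (N : ℕ) (lam : ℝ) : Set E3 :=
  {x ∈ spikySphere N lam |
    ∀ i ∈ Finset.range N, ⟪spikeDir N i, x⟫ < Real.cos (spikeWidth N) * ‖x‖}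

theorem contDiff_spikeRadius (N : ℕ) (lam : ℝ) : ContDiff ℝ 2 (spikeRadius N lam) :=
  contDiff_const.mul (contDiff_const.sub ((contDiff_bump _).comp Real.contDiff_cos))

theorem contDiff_spikeX (N : ℕ) (lam : ℝ) : ContDiff ℝ 2 (spikeX N lam) :=
  (contDiff_spikeRadius N lam).mul Real.contDiff_sin

theorem contDiff_spikeZ (N : ℕ) (lam : ℝ) : ContDiff ℝ 2 (spikeZ N lam) :=
  (contDiff_spikeRadius N lam).mul Real.contDiff_cos

theorem hasDerivAt_spikeRadius (N : ℕ) (lam φ : ℝ) :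
    HasDerivAt (spikeRadius N lam) (deriv (spikeRadius N lam) φ) φ :=
  ((contDiff_spikeRadius N lam).differentiable (by simp) φ).hasDerivAt

theorem deriv_spikeX (N : ℕ) (lam φ : ℝ) : deriv (spikeX N lam) φ =
    deriv (spikeRadius N lam) φ * Real.sin φ + spikeRadius N lam φ * Real.cos φ :=
  ((hasDerivAt_spikeRadius N lam φ).mul (Real.hasDerivAt_sin φ)).deriv

theorem deriv_spikeZ (N : ℕ) (lam φ : ℝ) : deriv (spikeZ N lam) φ =
    deriv (spikeRadius N lam) φ * Real.cos φ - spikeRadius N lam φ * Real.sin φ := by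
  have h : deriv (spikeZ N lam) φ = _ :=
    ((hasDerivAt_spikeRadius N lam φ).mul (Real.hasDerivAt_cos φ)).deriv
  rw [h]
  ring

theorem deriv_spikeRadius_nonneg (hl : 0 < lam) {φ : ℝ} (h0 : 0 ≤ φ) (hπ : φ ≤ Real.pi) :
    0 ≤ deriv (spikeRadius N lam) φ := by
  have h1 : HasDerivAt (bump (spikeWidth N)) (deriv (bump (spikeWidth N)) (Real.cos φ))
      (Real.cos φ) := ((contDiff_bump _).differentiable (by simp) _).hasDerivAt
  have h2 := ((h1.comp φ (Real.hasDerivAt_cos φ)).const_sub 1).const_mul lam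
  have h3 : deriv (spikeRadius N lam) φ = _ := h2.deriv
  have h4 : 0 ≤ deriv (bump (spikeWidth N)) (Real.cos φ) := (monotone_bump _).deriv_nonneg
  have h5 := Real.sin_nonneg_of_nonneg_of_le_pi h0 hπ
  rw [h3]
  have : 0 ≤ lam * (deriv (bump (spikeWidth N)) (Real.cos φ) * Real.sin φ) := by positivity
  linarith

theorem spikeRadius_pos (hN : 2 ≤ N) (hl : 0 < lam) (φ : ℝ) : 0 < spikeRadius N lam φ :=
  mul_pos hl (by linarith [bump_le (cos_spikeWidth_lt_one hN) (Real.cos_le_one φ), exp_neg_one_lt])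

theorem spikeRadius_le (hl : 0 < lam) (φ : ℝ) : spikeRadius N lam φ ≤ lam :=
  mul_le_of_le_one_right hl.le (by linarith [bump_nonneg (spikeWidth N) (Real.cos φ)])

theorem deriv_spikeX_pos (hN : 2 ≤ N) (hl : 0 < lam) {φ : ℝ} (hφ : φ ∈ Icc 0 (spikeWidth N)) :
    0 < deriv (spikeX N lam) φ := by
  have hδ := spikeWidth_le hN
  have hπ := Real.pi_gt_three
  rw [deriv_spikeX]
  have h1 := deriv_spikeRadius_nonneg (N := N) hl hφ.1 (by linarith [hφ.2])
  have h2 := spikeRadius_pos hN hl φ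
  have h3 : 0 < Real.cos φ :=
    Real.cos_pos_of_mem_Ioo ⟨by linarith [hφ.1], by linarith [hφ.2]⟩
  have h4 : 0 ≤ Real.sin φ := Real.sin_nonneg_of_nonneg_of_le_pi hφ.1 (by linarith [hφ.2])
  positivity

theorem spikeX_zero : spikeX N lam 0 = 0 := by simp [spikeX]

variable {e : OrthonormalBasis (Fin 3) ℝ E3}

theorem inner_frame_two (he : e 2 = spikeDir N i) (x z t : ℝ) :
    ⟪spikeDir N i, cylPoint e 0 x z t⟫ = z := by
  have := (inner_cylPoint_sub e 0 x z t).2.2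
  rwa [sub_zero, real_inner_comm, he] at this

theorem norm_spike (hN : 2 ≤ N) (hl : 0 < lam) (φ t : ℝ) :
    ‖cylPoint e 0 (spikeX N lam φ) (spikeZ N lam φ) t‖ = spikeRadius N lam φ := by
  rw [← sq_eq_sq₀ (norm_nonneg _) (spikeRadius_pos hN hl φ).le]
  have := norm_cylPoint_sub_sq e 0 (spikeX N lam φ) (spikeZ N lam φ) t
  rw [sub_zero] at this
  rw [this, spikeX, spikeZ]
  linear_combination spikeRadius N lam φ ^ 2 * Real.sin_sq_add_cos_sq φ

theorem spike_mem_cap (hN : 2 ≤ N) (hl : 0 < lam) (hi : i ∈ Finset.range N)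
    (he : e 2 = spikeDir N i) {φ : ℝ} (hφ : φ ∈ Icc 0 (spikeWidth N)) (t : ℝ) :
    cylPoint e 0 (spikeX N lam φ) (spikeZ N lam φ) t ∈ spikeCap N lam i := by
  have hR := spikeRadius_pos hN hl φ
  have hn := norm_spike (e := e) hN hl φ t
  have hcap : Real.cos (spikeWidth N) * ‖cylPoint e 0 (spikeX N lam φ) (spikeZ N lam φ) t‖ ≤
      ⟪spikeDir N i, cylPoint e 0 (spikeX N lam φ) (spikeZ N lam φ) t⟫ := by
    rw [hn, inner_frame_two he, spikeZ, mul_comm]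
    refine mul_le_mul_of_nonneg_left (Real.cos_le_cos_of_nonneg_of_le_pi hφ.1 ?_ hφ.2) hR.le
    linarith [spikeWidth_le hN, Real.pi_gt_three]
  refine ⟨?_, hcap⟩
  have hp0 : cylPoint e 0 (spikeX N lam φ) (spikeZ N lam φ) t ≠ 0 := by
    rw [← norm_ne_zero_iff, hn]
    exact hR.ne'
  rw [spikySphere, radialGraph, mem_ofPred_eq, spikyRadius, dent_eq_of_mem_cap hN hi hp0 hcap,
    hn, inner_frame_two he, spikeZ, mul_div_cancel_left₀ _ hR.ne', spikeRadius]

theorem exists_spike_of_mem_cap (hN : 2 ≤ N) (hl : 0 < lam) (hi : i ∈ Finset.range N)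
    (he : e 2 = spikeDir N i) {p : E3} (hp : p ∈ spikeCap N lam i) :
    ∃ φ ∈ Icc 0 (spikeWidth N), ∃ t ∈ Ico 0 (2 * Real.pi),
      p = cylPoint e 0 (spikeX N lam φ) (spikeZ N lam φ) t := by
  obtain ⟨hpS, hcap⟩ := hp
  have hp0 := (isRadial_spikyRadius hN hl).ne_zero hpS
  have hpn : 0 < ‖p‖ := norm_pos_iff.2 hp0
  obtain ⟨t, ht, hc, hs⟩ := exists_polar ⟪e 0, p⟫ ⟪e 1, p⟫
  have hsum := e.sum_repr p
  rw [Fin.sum_univ_three] at hsum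
  simp only [OrthonormalBasis.repr_apply_apply] at hsum
  set ξ := √(⟪e 0, p⟫ ^ 2 + ⟪e 1, p⟫ ^ 2) with hξ
  have hpc : p = cylPoint e 0 ξ ⟪e 2, p⟫ t := by
    rw [cylPoint, zero_add, ← hc, ← hs, hsum]
  have hsq : ξ ^ 2 + ⟪e 2, p⟫ ^ 2 = ‖p‖ ^ 2 := by
    have := norm_cylPoint_sub_sq e 0 ξ ⟪e 2, p⟫ t
    rw [sub_zero, ← hpc] at this
    exact this.symm
  have hle : ⟪e 2, p⟫ / ‖p‖ ≤ 1 := by rw [he]; exact inner_div_norm_le_one N i p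
  have hge : Real.cos (spikeWidth N) ≤ ⟪e 2, p⟫ / ‖p‖ := by
    rw [le_div_iff₀ hpn, he]
    exact hcap
  set φ := Real.arccos (⟪e 2, p⟫ / ‖p‖) with hφ
  have hcos : Real.cos φ = ⟪e 2, p⟫ / ‖p‖ :=
    Real.cos_arccos (by linarith [cos_spikeWidth_pos hN]) hle
  have hR : spikeRadius N lam φ = ‖p‖ := by
    have h1 : ‖p‖ = spikyRadius N lam p := hpS
    rw [spikyRadius, dent_eq_of_mem_cap hN hi hp0 hcap, ← he, ← hcos] at h1
    exact h1.symm
  have hz : ⟪e 2, p⟫ = ‖p‖ * Real.cos φ := by rw [hcos]; field_simp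
  have hsin : 0 ≤ Real.sin φ :=
    Real.sin_nonneg_of_nonneg_of_le_pi (Real.arccos_nonneg _) (Real.arccos_le_pi _)
  have hx : ξ = ‖p‖ * Real.sin φ := by
    rw [← sq_eq_sq₀ (Real.sqrt_nonneg _) (by positivity), mul_pow]
    rw [hz] at hsq
    linear_combination hsq - ‖p‖ ^ 2 * Real.sin_sq_add_cos_sq φ
  refine ⟨φ, ⟨Real.arccos_nonneg _, ?_⟩, t, ht, ?_⟩
  · have := Real.arccos_le_arccos hge
    rwa [Real.arccos_cos (spikeWidth_pos hN).le
      (by linarith [spikeWidth_le hN, Real.pi_gt_three])] at this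
  · rw [spikeX, spikeZ, hR, ← hx, ← hz]
    exact hpc

theorem spikeCap_eq (hN : 2 ≤ N) (hl : 0 < lam) (hi : i ∈ Finset.range N)
    (he : e 2 = spikeDir N i) :
    spikeCap N lam i = {cylPoint e 0 0 (spikeZ N lam 0) 0} ∪
      revolutionPatch e 0 (spikeX N lam) (spikeZ N lam) (Ioc 0 (spikeWidth N)) := by
  ext p
  constructor
  · intro hp
    obtain ⟨φ, hφ, t, ht, rfl⟩ := exists_spike_of_mem_cap hN hl hi he hp
    rcases hφ.1.eq_or_lt with rfl | h0
    · left
      rw [spikeX_zero]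
      exact cylPoint_zero_left _ _ _ _ _
    · exact Or.inr ⟨φ, ⟨h0, hφ.2⟩, t, ht, rfl⟩
  · rintro (rfl | ⟨φ, hφ, t, ht, rfl⟩)
    · have := spike_mem_cap hN hl hi he (φ := 0) ⟨le_rfl, (spikeWidth_pos hN).le⟩ 0
      rwa [spikeX_zero] at this
    · exact spike_mem_cap hN hl hi he (Ioc_subset_Icc_self hφ) t

theorem spikeCap_ae_eq (hN : 2 ≤ N) (hl : 0 < lam) (hi : i ∈ Finset.range N)
    (he : e 2 = spikeDir N i) : spikeCap N lam i =ᵐ[μHE[2]]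
      revolutionPatch e 0 (spikeX N lam) (spikeZ N lam) (Ioc 0 (spikeWidth N)) := by
  rw [spikeCap_eq hN hl hi he]
  exact union_ae_eq_right_of_ae_eq_empty
    (ae_eq_empty.2 (euclideanHausdorffMeasure_two_singleton _))

theorem isClosed_spikeCap (hN : 2 ≤ N) (hl : 0 < lam) (i : ℕ) : IsClosed (spikeCap N lam i) := by
  refine (isRadial_spikyRadius hN hl).isCompact.isClosed.inter ?_
  exact isClosed_le (by fun_prop) (innerSL ℝ (spikeDir N i)).continuous

/-- Each spike contributes a negative amount to the total mean curvature, no matter how narrow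
it is. -/
theorem integral_meanCurvature_spikeCap (hN : 2 ≤ N) (hl : 0 < lam) (hi : i ∈ Finset.range N) :
    IntegrableOn (meanCurvature (spikySphere N lam)) (spikeCap N lam i) μHE[2] ∧
      ∫ p in spikeCap N lam i, meanCurvature (spikySphere N lam) p ∂μHE[2] ≤
        -(Real.pi * lam / 10) := by
  obtain ⟨e, he⟩ := exists_frame (norm_spikeDir N i)
  have hδ := spikeWidth_pos hN
  have hrad := isRadial_spikyRadius hN hl
  obtain ⟨h1, h2⟩ := integral_meanCurvature_graphPatch_le (e := e) (c := 0)
    (S := spikySphere N lam) hδ (contDiff_spikeX N lam) (contDiff_spikeZ N lam) spikeX_zero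
    (fun φ hφ => deriv_spikeX_pos hN hl hφ) fun φ hφ t => by
      have hmem := (spike_mem_cap hN hl hi he (Ioo_subset_Icc_self hφ) t).1
      refine ⟨_, _, hrad.isRegularLevelSetAt hmem, hrad.fderiv_radialLevel_self hmem, ?_⟩
      rw [inner_cylPoint_zero, deriv_spikeX, deriv_spikeZ, spikeX, spikeZ]
      have : 0 < spikeRadius N lam φ ^ 2 := by
        have := spikeRadius_pos hN hl φ
        positivity
      have hcs := Real.sin_sq_add_cos_sq φ
      calc 0 < spikeRadius N lam φ ^ 2 := this
        _ = _ := by linear_combination (-spikeRadius N lam φ ^ 2) * hcs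
  have hae := spikeCap_ae_eq hN hl hi he
  refine ⟨(integrableOn_congr_set_ae hae).2 h1, ?_⟩
  rw [setIntegral_congr_set hae]
  refine h2.trans ?_
  have hz : spikeZ N lam (spikeWidth N) = lam * Real.cos (spikeWidth N) := by
    rw [spikeZ, spikeRadius, bump_eq_zero le_rfl, sub_zero, mul_one]
  have hx : spikeX N lam (spikeWidth N) = lam * Real.sin (spikeWidth N) := by
    rw [spikeX, spikeRadius, bump_eq_zero le_rfl, sub_zero, mul_one]
  have hz0 : spikeZ N lam 0 = lam * (1 - Real.exp (-1)) := by
    rw [spikeZ, spikeRadius, Real.cos_zero, bump_one (cos_spikeWidth_lt_one hN), mul_one]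
  rw [hz, hx, hz0]
  have hw := spikeWidth_le hN
  have hcos : 1 - spikeWidth N ^ 2 / 2 ≤ Real.cos (spikeWidth N) := Real.one_sub_sq_div_two_le_cos
  have hsin := Real.sin_le hδ.le
  have hexp := Real.exp_neg_one_gt_d9
  have hπ := Real.pi_lt_d2
  have hπ0 := Real.pi_pos
  have hps : Real.pi * Real.sin (spikeWidth N) ≤ 3.15 * (1 / 16) :=
    mul_le_mul hπ.le (hsin.trans hw)
      (Real.sin_nonneg_of_nonneg_of_le_pi hδ.le (by linarith [Real.pi_gt_three])) (by norm_num)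
  have hw2 : spikeWidth N ^ 2 ≤ (1 / 16) ^ 2 := by gcongr
  have key : 1 / 10 ≤ Real.cos (spikeWidth N) - (1 - Real.exp (-1)) -
      Real.pi * Real.sin (spikeWidth N) := by
    norm_num at hps hw2 hexp ⊢
    linarith
  have hpl : 0 < Real.pi * lam := by positivity
  nlinarith [mul_le_mul_of_nonneg_left key hpl.le]

theorem measure_spikeCap (hN : 2 ≤ N) (hl : 0 < lam) (hi : i ∈ Finset.range N) :
    0 < μHE[2] (spikeCap N lam i) ∧
      μHE[2] (spikeCap N lam i) ≤ ENNReal.ofReal (2 * Real.pi * lam ^ 2 * spikeWidth N) := by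
  obtain ⟨e, he⟩ := exists_frame (norm_spikeDir N i)
  have hδ := spikeWidth_pos hN
  obtain ⟨-, h1, h2⟩ := measure_graphPatch (e := e) (c := 0) hδ (contDiff_spikeX N lam)
    (contDiff_spikeZ N lam) spikeX_zero fun φ hφ => deriv_spikeX_pos hN hl hφ
  rw [measure_congr (spikeCap_ae_eq hN hl hi he)]
  refine ⟨h1, ?_⟩
  rw [h2]
  refine ENNReal.ofReal_le_ofReal ?_
  rw [mul_assoc (2 * Real.pi)]
  refine mul_le_mul_of_nonneg_left ?_ (by positivity)
  have hw := spikeWidth_le hN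
  have hπ := Real.pi_gt_three
  have hsin := Real.sin_le hδ.le
  have hdc := (hasDerivAt_deriv_of_contDiff (contDiff_spikeRadius N lam) 0).2.2.2
  have hxc := (hasDerivAt_deriv_of_contDiff (contDiff_spikeX N lam) 0).2.2.2
  have hzc := (hasDerivAt_deriv_of_contDiff (contDiff_spikeZ N lam) 0).2.2.2
  have hc : Continuous fun φ => spikeX N lam φ *
      √(deriv (spikeX N lam) φ ^ 2 + deriv (spikeZ N lam) φ ^ 2) :=
    (contDiff_spikeX N lam).continuous.mul ((hxc.pow 2).add (hzc.pow 2)).sqrt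
  have hbound : ∀ φ ∈ Icc 0 (spikeWidth N), spikeX N lam φ *
      √(deriv (spikeX N lam) φ ^ 2 + deriv (spikeZ N lam) φ ^ 2) ≤
      lam * spikeWidth N * (deriv (spikeRadius N lam) φ + lam) := by
    intro φ hφ
    have hR := spikeRadius_pos hN hl φ
    have hR' := deriv_spikeRadius_nonneg (N := N) hl hφ.1 (by linarith [hφ.2])
    have hRl := spikeRadius_le (N := N) hl φ
    have hs : 0 ≤ Real.sin φ := Real.sin_nonneg_of_nonneg_of_le_pi hφ.1 (by linarith [hφ.2])
    refine mul_le_mul ?_ ?_ (Real.sqrt_nonneg _) (by positivity)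
    · exact mul_le_mul hRl ((Real.sin_le hφ.1).trans hφ.2) hs hl.le
    · refine Real.sqrt_le_iff.2 ⟨by positivity, ?_⟩
      have e1 : deriv (spikeX N lam) φ ^ 2 + deriv (spikeZ N lam) φ ^ 2 =
          deriv (spikeRadius N lam) φ ^ 2 + spikeRadius N lam φ ^ 2 := by
        rw [deriv_spikeX, deriv_spikeZ]
        linear_combination (deriv (spikeRadius N lam) φ ^ 2 + spikeRadius N lam φ ^ 2) *
          Real.sin_sq_add_cos_sq φ
      rw [e1]
      nlinarith
  refine (intervalIntegral.integral_mono_on hδ.le (hc.intervalIntegrable _ _)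
    (Continuous.intervalIntegrable (by fun_prop) _ _) hbound).trans ?_
  rw [intervalIntegral.integral_const_mul, intervalIntegral.integral_add
    (hdc.intervalIntegrable _ _) (by simp), intervalIntegral.integral_eq_sub_of_hasDerivAt
    (fun φ _ => hasDerivAt_spikeRadius N lam φ) (hdc.intervalIntegrable _ _),
    intervalIntegral.integral_const, sub_zero, smul_eq_mul]
  have hR0 : spikeRadius N lam 0 = lam * (1 - Real.exp (-1)) := by
    rw [spikeRadius, Real.cos_zero, bump_one (cos_spikeWidth_lt_one hN)]
  have hRδ := spikeRadius_le (N := N) hl (spikeWidth N)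
  have hexp : Real.exp (-1) < 1 / 2 := by
    have := Real.exp_neg_one_lt_d9
    norm_num at this ⊢
    linarith
  rw [hR0]
  have : spikeRadius N lam (spikeWidth N) - lam * (1 - Real.exp (-1)) + spikeWidth N * lam ≤
      lam := by nlinarith
  calc _ ≤ lam * spikeWidth N * lam := mul_le_mul_of_nonneg_left this (by positivity)
    _ = _ := by ring

end Spike

/-! ### Area and total mean curvature of the spiky spheres -/

section SpikySphere

variable {N : ℕ} {lam : ℝ}

theorem measure_sphere {k : ℝ} (hk : 0 < k) :
    μHE[2] (Metric.sphere (0 : E3) k) = ENNReal.ofReal (4 * Real.pi * k ^ 2) := by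
  have h0 : (0 : E3) = shellCenter 0 := by
    ext i
    fin_cases i <;> simp [shellCenter]
  rw [h0, measure_congr (sphere_ae_eq_patch hk 0), measure_arcPatch hk Real.pi_pos.le (by simp)
    measurableSet_Ioo subset_rfl Ioo_subset_Icc_self fun φ hφ => ?_]
  · rw [Real.cos_zero, Real.cos_pi]
    congr 1
    ring
  · rw [arcX, zero_add]
    exact mul_pos hk (Real.sin_pos_of_mem_Ioo hφ)

theorem spikySphere_eq_union (N : ℕ) (lam : ℝ) :
    spikySphere N lam = roundPart N lam ∪ ⋃ i ∈ Finset.range N, spikeCap N lam i := by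
  ext x
  simp only [mem_union, mem_iUnion, exists_prop]
  constructor
  · intro hx
    by_cases h : ∃ i ∈ Finset.range N, Real.cos (spikeWidth N) * ‖x‖ ≤ ⟪spikeDir N i, x⟫
    · obtain ⟨i, hi, h⟩ := h
      exact Or.inr ⟨i, hi, hx, h⟩
    · push Not at h
      exact Or.inl ⟨hx, h⟩
  · rintro (h | ⟨i, -, h⟩) <;> exact h.1

theorem disjoint_roundPart (N : ℕ) (lam : ℝ) :
    Disjoint (roundPart N lam) (⋃ i ∈ Finset.range N, spikeCap N lam i) := by
  rw [Set.disjoint_left]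
  intro x h1 h2
  simp only [mem_iUnion, exists_prop] at h2
  obtain ⟨i, hi, h⟩ := h2
  exact absurd (h1.2 i hi) (not_lt.2 h.2)

theorem roundPart_subset_sphere (hN : 2 ≤ N) (hl : 0 < lam) :
    roundPart N lam ⊆ Metric.sphere (0 : E3) lam := by
  intro x hx
  have h : ‖x‖ = spikyRadius N lam x := hx.1
  rw [mem_sphere_zero_iff_norm, h, spikyRadius,
    dent_eq_zero ((isRadial_spikyRadius hN hl).ne_zero hx.1) hx.2, sub_zero, mul_one]

theorem measurableSet_iUnion_spikeCap (hN : 2 ≤ N) (hl : 0 < lam) :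
    MeasurableSet (⋃ i ∈ Finset.range N, spikeCap N lam i) :=
  Finset.measurableSet_biUnion _ fun i _ => (isClosed_spikeCap hN hl i).measurableSet

theorem measurableSet_roundPart (hN : 2 ≤ N) (hl : 0 < lam) : MeasurableSet (roundPart N lam) := by
  have h : roundPart N lam = spikySphere N lam \ ⋃ i ∈ Finset.range N, spikeCap N lam i := by
    rw [spikySphere_eq_union, union_sdiff_right, (disjoint_roundPart N lam).sdiff_eq_left]
  rw [h]
  exact (isRadial_spikyRadius hN hl).isCompact.isClosed.measurableSet.diff
    (measurableSet_iUnion_spikeCap hN hl)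

theorem measure_roundPart_le (hN : 2 ≤ N) (hl : 0 < lam) :
    μHE[2] (roundPart N lam) ≤ ENNReal.ofReal (4 * Real.pi * lam ^ 2) :=
  (measure_mono (roundPart_subset_sphere hN hl)).trans (measure_sphere hl).le

theorem meanCurvature_roundPart (hN : 2 ≤ N) (hl : 0 < lam) {x : E3} (hx : x ∈ roundPart N lam) :
    meanCurvature (spikySphere N lam) x = lam⁻¹ := by
  have hrad := isRadial_spikyRadius hN hl
  have hx0 := hrad.ne_zero hx.1
  refine hrad.meanCurvature_of_eventuallyEq hx.1 hl ?_
  have h : ∀ᶠ y : E3 in 𝓝 x, ∀ i ∈ Finset.range N,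
      ⟪spikeDir N i, y⟫ < Real.cos (spikeWidth N) * ‖y‖ := by
    rw [Filter.eventually_all_finset]
    intro i hi
    exact ((innerSL ℝ (spikeDir N i)).continuous.continuousAt).eventually_lt
      (by fun_prop : Continuous fun y : E3 => Real.cos (spikeWidth N) * ‖y‖).continuousAt
      (hx.2 i hi)
  filter_upwards [h, eventually_ne_nhds hx0] with y hy hy0
  rw [spikyRadius, dent_eq_zero hy0 hy, sub_zero, mul_one]

theorem integral_meanCurvature_roundPart (hN : 2 ≤ N) (hl : 0 < lam) :
    IntegrableOn (meanCurvature (spikySphere N lam)) (roundPart N lam) μHE[2] ∧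
      ∫ p in roundPart N lam, meanCurvature (spikySphere N lam) p ∂μHE[2] ≤
        4 * Real.pi * lam := by
  have hm := measurableSet_roundPart hN hl
  have hle := measure_roundPart_le hN hl
  have hfin : μHE[2] (roundPart N lam) ≠ ∞ := ne_top_of_le_ne_top ENNReal.ofReal_ne_top hle
  have heq : EqOn (meanCurvature (spikySphere N lam)) (fun _ => lam⁻¹) (roundPart N lam) :=
    fun x hx => meanCurvature_roundPart hN hl hx
  refine ⟨(integrableOn_congr_fun heq hm).2 (integrableOn_const hfin), ?_⟩
  rw [setIntegral_congr_fun hm heq, setIntegral_const, smul_eq_mul, Measure.real]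
  have h1 : (μHE[2] (roundPart N lam)).toReal ≤ 4 * Real.pi * lam ^ 2 :=
    ENNReal.toReal_le_of_le_ofReal (by positivity) hle
  calc _ ≤ 4 * Real.pi * lam ^ 2 * lam⁻¹ := mul_le_mul_of_nonneg_right h1 (by positivity)
    _ = 4 * Real.pi * lam := by field_simp

theorem pairwiseDisjoint_spikeCap (hN : 2 ≤ N) (hl : 0 < lam) :
    Set.Pairwise (↑(Finset.range N) : Set ℕ) (Function.onFun Disjoint (spikeCap N lam)) := by
  intro i hi j hj hij
  rw [Function.onFun, Set.disjoint_left]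
  intro x h1 h2
  exact hij (eq_of_mem_caps hN hi hj ((isRadial_spikyRadius hN hl).ne_zero h1.1) h1.2 h2.2)

/-- The total mean curvature decreases linearly in the number of spikes. -/
theorem totalMeanCurvature_spikySphere_le (hN : 2 ≤ N) (hl : 0 < lam) :
    IntegrableOn (meanCurvature (spikySphere N lam)) (spikySphere N lam) μHE[2] ∧
      totalMeanCurvature (spikySphere N lam) ≤ lam * (Real.pi * (4 - N / 10)) := by
  obtain ⟨h1, h2⟩ := integral_meanCurvature_roundPart hN hl
  have h3 := fun i (hi : i ∈ Finset.range N) => integral_meanCurvature_spikeCap hN hl hi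
  have hcaps : IntegrableOn (meanCurvature (spikySphere N lam))
      (⋃ i ∈ Finset.range N, spikeCap N lam i) μHE[2] :=
    integrableOn_finset_iUnion.2 fun i hi => (h3 i hi).1
  have hu := spikySphere_eq_union N lam
  constructor
  · have := h1.union hcaps
    rwa [← hu] at this
  · rw [totalMeanCurvature]
    have e1 : ∫ p in spikySphere N lam, meanCurvature (spikySphere N lam) p ∂μHE[2] =
        ∫ p in roundPart N lam ∪ ⋃ i ∈ Finset.range N, spikeCap N lam i,
          meanCurvature (spikySphere N lam) p ∂μHE[2] := by rw [← hu]
    rw [e1, setIntegral_union (disjoint_roundPart N lam) (measurableSet_iUnion_spikeCap hN hl) h1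
      hcaps, integral_biUnion_finset _ (fun i _ => (isClosed_spikeCap hN hl i).measurableSet)
      (pairwiseDisjoint_spikeCap hN hl) fun i hi => (h3 i hi).1]
    have hsum := Finset.sum_le_sum fun i hi => (h3 i hi).2
    rw [Finset.sum_const, Finset.card_range, nsmul_eq_mul] at hsum
    linarith

theorem area_spikySphere (hN : 2 ≤ N) (hl : 0 < lam) :
    0 < area (spikySphere N lam) ∧
      area (spikySphere N lam) ≤ ENNReal.ofReal (5 * Real.pi * lam ^ 2) := by
  have hN0 : (0 : ℝ) < N := by exact_mod_cast (by omega : 0 < N)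
  constructor
  · refine (measure_spikeCap hN hl (i := 0) (Finset.mem_range.2 (by omega))).1.trans_le
      (measure_mono fun x hx => hx.1)
  · rw [area, spikySphere_eq_union]
    refine (measure_union_le _ _).trans ?_
    have hcaps : μHE[2] (⋃ i ∈ Finset.range N, spikeCap N lam i) ≤
        ENNReal.ofReal (Real.pi * lam ^ 2 / 4) := by
      refine (measure_biUnion_finset_le _ _).trans ?_
      refine (Finset.sum_le_sum fun i hi => (measure_spikeCap hN hl hi).2).trans ?_
      rw [Finset.sum_const, Finset.card_range, nsmul_eq_mul, ← ENNReal.ofReal_natCast,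
        ← ENNReal.ofReal_mul hN0.le]
      refine ENNReal.ofReal_le_ofReal (le_of_eq ?_)
      rw [spikeWidth]
      field_simp
      norm_num
    refine (add_le_add (measure_roundPart_le hN hl) hcaps).trans ?_
    rw [← ENNReal.ofReal_add (by positivity) (by positivity)]
    refine ENNReal.ofReal_le_ofReal ?_
    have : 0 < Real.pi * lam ^ 2 := by positivity
    linarith

open Pointwise in
/-- The scaled spiky sphere of prescribed area. -/
theorem exists_spikySphere_area (hN : 2 ≤ N) {A₀ : ℝ} (hA₀ : 0 < A₀) :
    ∃ lam, √(A₀ / (5 * Real.pi)) ≤ lam ∧ area (spikySphere N lam) = ENNReal.ofReal A₀ := by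
  obtain ⟨h1, h2⟩ := area_spikySphere hN one_pos
  set a := (area (spikySphere N 1)).toReal with ha
  have hfin : area (spikySphere N 1) ≠ ∞ := ne_top_of_le_ne_top ENNReal.ofReal_ne_top h2
  have hapos : 0 < a := ENNReal.toReal_pos h1.ne' hfin
  have hale : a ≤ 5 * Real.pi := by
    have := ENNReal.toReal_le_of_le_ofReal (by positivity) h2
    linarith
  have hlpos : 0 < √(A₀ / a) := Real.sqrt_pos.2 (div_pos hA₀ hapos)
  refine ⟨√(A₀ / a), Real.sqrt_le_sqrt (div_le_div_of_nonneg_left hA₀.le hapos hale), ?_⟩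
  rw [spikySphere_eq_smul N hlpos, area, Measure.euclideanHausdorffMeasure_smul₀ _ hlpos.ne',
    ENNReal.smul_def, smul_eq_mul]
  have e1 : μHE[2] (spikySphere N 1) = ENNReal.ofReal a := (ENNReal.ofReal_toReal hfin).symm
  have e2 : ((‖√(A₀ / a)‖₊ ^ 2 : ℝ≥0) : ℝ≥0∞) = ENNReal.ofReal (A₀ / a) := by
    rw [ENNReal.ofReal, ENNReal.coe_inj]
    ext
    rw [NNReal.coe_pow, coe_nnnorm, Real.norm_of_nonneg hlpos.le, Real.sq_sqrt (by positivity),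
      Real.coe_toNNReal _ (by positivity)]
  rw [e1, e2, ← ENNReal.ofReal_mul (by positivity), div_mul_cancel₀ _ hapos.ne']

/-- The tips of the spikes are the points of the surface that are closest to the origin. -/
theorem mem_spikySphere_tip_iff (hN : 2 ≤ N) (hl : 0 < lam) {x : E3}
    (hx : ‖x‖ = 1) : (lam * (1 - Real.exp (-1))) • x ∈ spikySphere N lam ↔
      ∃ i ∈ Finset.range N, x = spikeDir N i := by
  have hk : 0 < lam * (1 - Real.exp (-1)) := mul_pos hl (by linarith [exp_neg_one_lt])
  have hx0 : x ≠ 0 := by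
    rintro rfl
    simp at hx
  have h1 : (lam * (1 - Real.exp (-1))) • x ∈ spikySphere N lam ↔ dent N x = Real.exp (-1) := by
    rw [spikySphere, radialGraph, mem_ofPred_eq, norm_smul, hx, Real.norm_of_nonneg hk.le,
      spikyRadius, dent_smul hk, mul_one]
    constructor
    · intro h
      linarith [mul_left_cancel₀ hl.ne' h]
    · intro h
      rw [h]
  rw [h1]
  constructor
  · intro h
    by_contra! hcon
    by_cases hcap : ∃ i ∈ Finset.range N, Real.cos (spikeWidth N) * ‖x‖ ≤ ⟪spikeDir N i, x⟫
    · obtain ⟨i, hi, hcap⟩ := hcap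
      rw [dent_eq_of_mem_cap hN hi hx0 hcap, hx, div_one] at h
      have h2 := eq_one_of_bump_eq (cos_spikeWidth_lt_one hN) h
      exact hcon i hi ((inner_eq_one_iff_of_norm_eq_one (norm_spikeDir N i) hx).1 h2).symm
    · push Not at hcap
      rw [dent_eq_zero hx0 hcap] at h
      exact (Real.exp_pos _).ne h
  · rintro ⟨i, hi, rfl⟩
    have hin : ⟪spikeDir N i, spikeDir N i⟫ = 1 := by
      rw [inner_spikeDir, sub_self, Real.cos_zero]
    rw [dent_eq_of_mem_cap hN hi hx0
      (by rw [hx, hin, mul_one]; exact (cos_spikeWidth_lt_one hN).le), hx, hin, div_one,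
      bump_one (cos_spikeWidth_lt_one hN)]

theorem spikeDir_zero_pos {i : ℕ} (hi : i ∈ Finset.range N) :
    0 < spikeDir N i 0 := by
  have hi' : (i : ℝ) < N := by exact_mod_cast Finset.mem_range.1 hi
  have h0 : (0 : ℝ) ≤ i := Nat.cast_nonneg i
  have h1 : (i : ℝ) / N < 1 := (div_lt_one (by linarith)).2 hi'
  have h2 : 0 ≤ (i : ℝ) / N := div_nonneg h0 (Nat.cast_nonneg N)
  simpa [spikeDir] using Real.cos_pos_of_mem_Ioo
    (x := i / N) ⟨by linarith [Real.pi_pos], by linarith [Real.pi_gt_three]⟩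

theorem spikeDir_two (N i : ℕ) : spikeDir N i 2 = 0 := by simp [spikeDir]

/-- The two poles lie in the surface. -/
theorem pole_mem_spikySphere (hN : 2 ≤ N) (hl : 0 < lam) {s : ℝ} (hs : s ^ 2 = 1) :
    (!₂[0, 0, s * lam] : E3) ∈ spikySphere N lam := by
  set x : E3 := !₂[0, 0, s * lam] with hx
  have hn : ‖x‖ = lam := by
    rw [← sq_eq_sq₀ (norm_nonneg _) hl.le, EuclideanSpace.norm_sq_eq, Fin.sum_univ_three]
    simp [hx, mul_pow, hs]
  have hin : ∀ i, ⟪spikeDir N i, x⟫ = 0 := fun i => by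
    simp [hx, spikeDir, PiLp.inner_apply, Fin.sum_univ_three]
  rw [spikySphere, radialGraph, mem_ofPred_eq, spikyRadius, dent_eq_zero, hn, sub_zero, mul_one]
  · rw [← norm_pos_iff, hn]
    exact hl
  · intro i _
    rw [hin, hn]
    exact mul_pos (cos_spikeWidth_pos hN) hl

end SpikySphere

/-! ### Asymmetry of the spiky spheres -/

section Asymmetry

variable {N : ℕ} {lam : ℝ}

/-- The half turn about the line through `c` with direction `u` maps `x` to a point with the same
height and the same distance to `c`; the distance to the origin is computed from the foot
`c - ⟪c, u⟫ • u` of the line. -/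
theorem exists_half_turn {u : E3} (hu : ‖u‖ = 1) (c x : E3) :
    ∃ y : E3, ⟪x - c, u⟫ = ⟪y - c, u⟫ ∧ ‖x - c‖ = ‖y - c‖ ∧
      ‖y‖ ^ 2 = 4 * ‖c - ⟪c, u⟫ • u‖ ^ 2 + ‖x‖ ^ 2 - 4 * ⟪c - ⟪c, u⟫ • u, x⟫ := by
  have huu : ⟪u, u⟫ = 1 := by rw [real_inner_self_eq_norm_sq, hu, one_pow]
  have e1 : (2 : ℝ) • (c + ⟪x - c, u⟫ • u) - x - c = (2 * ⟪x - c, u⟫) • u - (x - c) := by module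
  have e3 : ∀ v : E3, ‖(2 * ⟪v, u⟫) • u - v‖ ^ 2 = ‖v‖ ^ 2 := fun v => by
    rw [norm_sub_sq_real, norm_smul, hu, real_inner_smul_left, real_inner_comm, Real.norm_eq_abs,
      mul_one, sq_abs]
    ring
  refine ⟨(2 : ℝ) • (c + ⟪x - c, u⟫ • u) - x, ?_, ?_, ?_⟩
  · rw [e1, inner_sub_left _ (x - c), real_inner_smul_left, huu]
    ring
  · rw [e1, ← sq_eq_sq₀ (norm_nonneg _) (norm_nonneg _), e3]
  · set w := c - ⟪c, u⟫ • u with hw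
    have hwu : ⟪w, u⟫ = 0 := by
      rw [hw, inner_sub_left, real_inner_smul_left, huu, mul_one, sub_self]
    have e2 : (2 : ℝ) • (c + ⟪x - c, u⟫ • u) - x = (2 : ℝ) • w + ((2 * ⟪x, u⟫) • u - x) := by
      rw [hw, inner_sub_left]
      module
    rw [e2, norm_add_sq_real, e3, norm_smul, real_inner_smul_left, inner_sub_right,
      inner_smul_right, hwu, Real.norm_eq_abs, mul_pow, sq_abs]
    ring

/-- An axis of symmetry passes through the origin, because the half turn about any other line
moves one of the poles out of the circumscribed ball.  The spike tips lie in an open half of the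
equatorial plane, and a rotation about a line through the origin can only leave such a set
invariant if all of its points are on the line. -/
theorem not_isRotationallySymmetric_spikySphere (hN : 2 ≤ N) (hl : 0 < lam) :
    ¬ IsRotationallySymmetric (spikySphere N lam) := by
  rintro ⟨c, u, hu, hsym⟩
  have hrad := isRadial_spikyRadius hN hl
  have hfoot : ∀ s : ℝ, s ^ 2 = 1 →
      ‖c - ⟪c, u⟫ • u‖ ^ 2 ≤ ⟪c - ⟪c, u⟫ • u, (!₂[0, 0, s * lam] : E3)⟫ := by
    intro s hs
    have hmem := pole_mem_spikySphere hN hl hs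
    obtain ⟨y, h1, h2, h3⟩ := exists_half_turn hu c (!₂[0, 0, s * lam] : E3)
    have hy : ‖y‖ ≤ lam := (le_of_eq ((hsym _ y h1 h2).1 hmem)).trans (hrad.upper y)
    have hn : ‖(!₂[0, 0, s * lam] : E3)‖ ^ 2 = lam ^ 2 := by
      rw [EuclideanSpace.norm_sq_eq, Fin.sum_univ_three]
      simp [mul_pow, hs]
    have hy2 : ‖y‖ ^ 2 ≤ lam ^ 2 := by gcongr
    linarith
  have hc : c = ⟪c, u⟫ • u := by
    have h1 := hfoot 1 (by norm_num)
    have h2 := hfoot (-1) (by norm_num)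
    have e : (!₂[0, 0, -1 * lam] : E3) = -!₂[0, 0, 1 * lam] := by
      ext i
      fin_cases i <;> simp
    rw [e, inner_neg_right] at h2
    have h3 : ‖c - ⟪c, u⟫ • u‖ ^ 2 ≤ 0 := by linarith
    have h4 : ‖c - ⟪c, u⟫ • u‖ = 0 := by
      have := sq_nonneg ‖c - ⟪c, u⟫ • u‖
      exact pow_eq_zero_iff two_ne_zero |>.1 (le_antisymm h3 this)
    exact sub_eq_zero.1 (norm_eq_zero.1 h4)
  -- rotating the tip of a spike gives the tip of a spike
  have htip : ∀ i ∈ Finset.range N, ∀ y : E3, ‖y‖ = 1 → ⟪y, u⟫ = ⟪spikeDir N i, u⟫ →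
      y 2 = 0 ∧ 0 < y 0 := by
    intro i hi y hy hyu
    set k := lam * (1 - Real.exp (-1)) with hk
    have hin : ∀ x : E3, ⟪x, c⟫ = ⟪c, u⟫ * ⟪x, u⟫ := fun x => by
      conv_lhs => rw [hc, inner_smul_right]
    have h1 : k • spikeDir N i ∈ spikySphere N lam :=
      (mem_spikySphere_tip_iff hN hl (norm_spikeDir N i)).2 ⟨i, hi, rfl⟩
    have h2 : k • y ∈ spikySphere N lam := by
      refine (hsym _ _ ?_ ?_).1 h1
      · rw [inner_sub_left, inner_sub_left, real_inner_smul_left, real_inner_smul_left, hyu]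
      · rw [← sq_eq_sq₀ (norm_nonneg _) (norm_nonneg _), norm_sub_sq_real, norm_sub_sq_real,
          norm_smul, norm_smul, hy, norm_spikeDir, real_inner_smul_left, real_inner_smul_left,
          hin, hin, hyu]
    obtain ⟨j, hj, rfl⟩ := (mem_spikySphere_tip_iff hN hl hy).1 h2
    exact ⟨spikeDir_two N j, spikeDir_zero_pos hj⟩
  have hinner : ∀ x y : E3, ⟪x, y⟫ = x 0 * y 0 + x 1 * y 1 + x 2 * y 2 := fun x y => by
    simp [PiLp.inner_apply, Fin.sum_univ_three, mul_comm]
  have hnorm : ∀ x : E3, ‖x‖ ^ 2 = x 0 ^ 2 + x 1 ^ 2 + x 2 ^ 2 := fun x => by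
    rw [← real_inner_self_eq_norm_sq, hinner]
    ring
  have hu2 : u 0 ^ 2 + u 1 ^ 2 + u 2 ^ 2 = 1 := by rw [← hnorm, hu, one_pow]
  have hmem0 : 0 ∈ Finset.range N := Finset.mem_range.2 (by omega)
  have hmem1 : 1 ∈ Finset.range N := Finset.mem_range.2 (by omega)
  have ha2 := spikeDir_two N
  rcases (show u 2 ^ 2 ≤ 1 by nlinarith [sq_nonneg (u 0), sq_nonneg (u 1)]).eq_or_lt with hv | hv
  · -- the axis is orthogonal to the equatorial plane
    have h0 : u 0 = 0 := by
      have := sq_nonneg (u 1)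
      exact pow_eq_zero_iff two_ne_zero |>.1 (le_antisymm (by linarith) (sq_nonneg (u 0)))
    have h1 : u 1 = 0 := by
      have := sq_nonneg (u 0)
      exact pow_eq_zero_iff two_ne_zero |>.1 (le_antisymm (by linarith) (sq_nonneg (u 1)))
    have h2 := (htip 0 hmem0 (-spikeDir N 0) (by rw [norm_neg, norm_spikeDir]) (by
      rw [inner_neg_left, hinner, h0, h1, ha2]
      ring)).2
    have h3 := spikeDir_zero_pos hmem0
    have : (-spikeDir N 0) 0 = -(spikeDir N 0 0) := rfl
    rw [this] at h2
    linarith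
  · -- otherwise the circle through a tip leaves the equatorial plane, unless it is a point
    have hpar : ∀ i ∈ Finset.range N, ⟪spikeDir N i, u⟫ ^ 2 = 1 := by
      intro i hi
      set h := ⟪spikeDir N i, u⟫ with hh
      have hq : 0 < 1 - u 2 ^ 2 := by linarith
      have hle : h ^ 2 ≤ 1 := by
        have := abs_real_inner_le_norm (spikeDir N i) u
        rw [norm_spikeDir, hu, mul_one] at this
        exact (sq_le_one_iff_abs_le_one _).2 this
      have hy : ∀ s : ℝ, s ^ 2 * (1 - u 2 ^ 2) = 1 - h ^ 2 → h * u 2 + s * (1 - u 2 ^ 2) = 0 := by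
        intro s hs
        set y : E3 := !₂[h * u 0 - s * (u 2 * u 0), h * u 1 - s * (u 2 * u 1),
          h * u 2 + s * (1 - u 2 ^ 2)] with hy
        refine (htip i hi y ?_ ?_).1
        · rw [← sq_eq_sq₀ (norm_nonneg _) zero_le_one, hnorm]
          simp only [hy, Matrix.cons_val_zero, Matrix.cons_val_one, Matrix.cons_val]
          linear_combination (h ^ 2 - 2 * h * s * u 2 + s ^ 2 * u 2 ^ 2) * hu2 + hs
        · rw [hinner]
          simp only [hy, Matrix.cons_val_zero, Matrix.cons_val_one, Matrix.cons_val]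
          linear_combination (h - s * u 2) * hu2
      set s := √((1 - h ^ 2) / (1 - u 2 ^ 2)) with hs
      have hs2 : s ^ 2 * (1 - u 2 ^ 2) = 1 - h ^ 2 := by
        rw [hs, Real.sq_sqrt (div_nonneg (by linarith) hq.le), div_mul_cancel₀ _ hq.ne']
      have h1 := hy s hs2
      have h2 := hy (-s) (by rw [neg_sq]; exact hs2)
      have h3 : s * (1 - u 2 ^ 2) = 0 := by linarith
      have h4 : s = 0 := (mul_eq_zero.1 h3).resolve_right hq.ne'
      rw [h4] at hs2
      linarith
    have h0 := hpar 0 hmem0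
    have h1 := hpar 1 hmem1
    rw [hinner] at h0 h1
    simp only [spikeDir, Matrix.cons_val_zero, Matrix.cons_val_one, Matrix.cons_val, Nat.cast_zero,
      zero_div, Real.cos_zero, Real.sin_zero, zero_mul, add_zero, one_mul, Nat.cast_one] at h0 h1
    have hu1 : u 1 = 0 :=
      pow_eq_zero_iff two_ne_zero |>.1
        (le_antisymm (by nlinarith [sq_nonneg (u 2)]) (sq_nonneg (u 1)))
    rw [hu1, mul_zero, add_zero, mul_pow, h0, mul_one] at h1
    have hN0 : (2 : ℝ) ≤ N := by exact_mod_cast hN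
    have hsin : 0 < Real.sin (1 / N) := by
      refine Real.sin_pos_of_pos_of_lt_pi (by positivity) ?_
      have : (1 : ℝ) / N ≤ 1 := div_le_one_of_le₀ (by linarith) (by linarith)
      linarith [Real.pi_gt_three]
    have := Real.sin_sq_add_cos_sq (1 / (N : ℝ))
    nlinarith

end Asymmetry

theorem exists_spikySphere_sequence (A₀ : ℝ) (hA₀ : 0 < A₀) :
    ∃ S : ℕ → Set E3,
      (∀ n, IsSphereLikeC11Surface (S n) ∧ ¬ IsRotationallySymmetric (S n) ∧
        area (S n) = ENNReal.ofReal A₀ ∧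
        IntegrableOn (meanCurvature (S n)) (S n) μHE[2]) ∧
      Tendsto (fun n => totalMeanCurvature (S n)) atTop atBot := by
  -- with at least `40` spikes the bound for the total mean curvature is not positive
  have hN : ∀ n : ℕ, 2 ≤ n + 40 := fun n => by omega
  choose lam hlam harea using fun n => exists_spikySphere_area (hN n) hA₀
  set l₀ := √(A₀ / (5 * Real.pi)) with hl₀
  have hπ := Real.pi_pos
  have hl₀pos : 0 < l₀ := Real.sqrt_pos.2 (by positivity)
  have hlpos : ∀ n, 0 < lam n := fun n => hl₀pos.trans_le (hlam n)
  refine ⟨fun n => spikySphere (n + 40) (lam n), fun n =>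
    ⟨(isRadial_spikyRadius (hN n) (hlpos n)).isSphereLikeC11Surface,
      not_isRotationallySymmetric_spikySphere (hN n) (hlpos n), harea n,
      (totalMeanCurvature_spikySphere_le (hN n) (hlpos n)).1⟩, ?_⟩
  have hbound : ∀ n : ℕ, totalMeanCurvature (spikySphere (n + 40) (lam n)) ≤
      -(l₀ * Real.pi / 10) * (n : ℝ) := by
    intro n
    refine (totalMeanCurvature_spikySphere_le (hN n) (hlpos n)).2.trans ?_
    push_cast
    have h1 : l₀ * (Real.pi * n) ≤ lam n * (Real.pi * n) :=
      mul_le_mul_of_nonneg_right (hlam n) (by positivity)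
    linarith
  refine tendsto_atBot_mono hbound ?_
  exact (tendsto_natCast_atTop_atTop (R := ℝ)).const_mul_atTop_of_neg
    (by have : 0 < l₀ * Real.pi := by positivity
        linarith)

end TotalMeanCurvature

open TotalMeanCurvature in
theorem theorem2 (A₀ : ℝ) (hA₀ : 0 < A₀) :
    (∃ S : ℕ → Set E3,
      (∀ n, IsSphereLikeC11Surface (S n) ∧ ¬ IsRotationallySymmetric (S n) ∧
        area (S n) = ENNReal.ofReal A₀ ∧
        IntegrableOn (meanCurvature (S n)) (S n) μHE[2]) ∧
      Tendsto (fun n => totalMeanCurvature (S n)) atTop atBot) ∧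
    (∃ T : ℕ → Set E3,
      (∀ n, T n ∈ AxisymmetricC11 ∧
        area (T n) = ENNReal.ofReal A₀ ∧
        IntegrableOn (meanCurvature (T n)) (T n) μHE[2]) ∧
      (∃ c : E3, ApproachesDouble T (Metric.sphere c √(A₀ / (8 * Real.pi)))) ∧
      Tendsto (fun n => totalMeanCurvature (T n)) atTop (𝓝[>] 0)) :=
  ⟨exists_spikySphere_sequence A₀ hA₀, exists_doubleSphere_sequence A₀ hA₀⟩
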